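/- Let $\varepsilon_0>0$, put $\Delta_{\varepsilon_0}=\{z\in\mathbb C:|z|<\varepsilon_0\}$, let $\alpha\in\mathbb R$, and let $a(z)=\sum_{n\ge 1}a_nz^n$ be a holomorphic function on $\Delta_{\varepsilon_0}$ that is not identically zero. Let $p$ and $q$ be real-valued $\mathcal C^\infty$-smooth functions on $(0,\varepsilon_0)$ and $[0,\varepsilon_0)$ respectively, such that $q(0)=0$ and such that the function $g$ with $g(z)=e^{p(|z|)}$ for $0<|z|<\varepsilon_0$ and $g(0)=0$ is $\mathcal C^\infty$-smooth on $\Delta_{\varepsilon_0}$ and vanishes to infinite order at $0$ (all its partial derivatives of all orders vanish at $0$). For $z_2\in\Delta_{\varepsilon_0}$ put $$R(z_2)=q(|z_2|)-\mathrm{Re}\sum_{n\ge1}\frac{a_n}{n}z_2^n,$$ $$P_1(z_2)=\exp\Big[p(|z_2|)+\mathrm{Re}\sum_{n\ge1}\frac{a_n}{in}z_2^n-\log|\cos R(z_2)|\Big]\ (z_2\ne0),\qquad P_1(0)=0,$$ and let $$P=\tfrac1\alpha\log(1+\alpha P_1),\quad F(z_2,t)=-\tfrac1\alpha\log\Big|\frac{\cos(R(z_2)+\alpha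 t)}{\cos R(z_2)}\Big|\quad\text{if }\alpha\neq0,$$ $$P=P_1,\quad F(z_2,t)=\tan(R(z_2))\,t\quad\text{if }\alpha=0.$$ Let $M(a,\alpha,p,q)$ be the germ at $(0,0)\in\mathbb C^2$ of the set $\{\mathrm{Re}\,z_1+P(z_2)+F(z_2,\mathrm{Im}\,z_1)=0\}$, and let $\mathrm{Aut}(M(a,\alpha,p,q),0)$ be the set of germs at $0$ of biholomorphisms between neighbourhoods of $0$ in $\mathbb C^2$ that fix $0$ and map $M(a,\alpha,p,q)$ into itself. For $t\in\mathbb R$ let, near the origin and with the principal branch of the logarithm, $$\phi_t^{a,\alpha}(z_1,z_2)=\Big(-\tfrac1\alpha\log\Big[1+(e^{-\alpha z_1}-1)\exp\Big(\int_0^ta(z_2e^{i\tau})\,d\tau\Big)\Big],\ z_2e^{it}\Big)\quad\text{if }\alpha\ne0,$$ $$\phi_t^{a,\alpha}(z_1,z_2)=\Big(z_1\exp\Big(\int_0^ta(z_2e^{i\tau})\,d\tau\Big),\ z_2e^{it}\Big)\quad\text{if }\alpha=0.$$ Then, as sets of germs at $0$, $$\mathrm{Aut}\big(M(a,\alpha,p,q),0\big)=\{\phi_t^{a,\alpha}: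 t\in\mathbb R\}.$$ Moreover $\{\phi^{a,\alpha}_t\}_{t\in\mathbb R}$ is the one-parameter group generated by the holomorphic vector field $$H^{a,\alpha}(z_1,z_2)=L^\alpha(z_1)a(z_2)\frac{\partial}{\partial z_1}+iz_2\frac{\partial}{\partial z_2},\qquad L^\alpha(z_1)=\tfrac1\alpha(e^{\alpha z_1}-1)\ \text{if }\alpha\neq0,\quad L^0(z_1)=z_1;$$ that is, there is an open neighbourhood $U$ of $0$ in $\mathbb C^2$ such that all the maps $\phi_t^{a,\alpha}$, $t\in\mathbb R$, are holomorphic on $U$ and, for all $z\in U$ and $s,t\in\mathbb R$, $\phi^{a,\alpha}_0(z)=z$, $\phi^{a,\alpha}_s(\phi^{a,\alpha}_t(z))=\phi^{a,\alpha}_{s+t}(z)$ and $\frac{d}{dt}\phi^{a,\alpha}_t(z)=H^{a,\alpha}(\phi^{a,\alpha}_t(z))$. -/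

import Mathlib

open scoped Topology ContDiff

noncomputable section

namespace InfiniteType

/-- A real-valued function `g` on `ℂ = ℝ²` vanishes to infinite order at `0`:
all its real derivatives of all orders vanish at `0`. -/
def VanishesToInfiniteOrder (g : ℂ → ℝ) : Prop :=
  ∀ n : ℕ, iteratedFDeriv ℝ n g 0 = 0

/-- The function `z ↦ exp (p |z|)` for `z ≠ 0`, extended by `0` at `z = 0`. -/
def expRadial (p : ℝ → ℝ) (z : ℂ) : ℝ :=
  if z = 0 then 0 else Real.exp (p ‖z‖)

/-- `R(z) = q(|z|) - Re (∑_{n ≥ 1} (a_n / n) z^n)`; the sequence `c` lists the `a_n`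
(only the entries with `n ≥ 1` are used). -/
def R (c : ℕ → ℂ) (q : ℝ → ℝ) (z : ℂ) : ℝ :=
  q ‖z‖ - (∑' n : ℕ, c (n + 1) / ((n : ℂ) + 1) * z ^ (n + 1)).re

/-- `P₁(z) = exp (p(|z|) + Re (∑_{n ≥ 1} (a_n / (i n)) z^n) - log |cos R(z)|)` for `z ≠ 0`,
and `P₁(0) = 0`. -/
def P₁ (c : ℕ → ℂ) (p q : ℝ → ℝ) (z : ℂ) : ℝ :=
  if z = 0 then 0
  else Real.exp (p ‖z‖
    + (∑' n : ℕ, c (n + 1) / (Complex.I * ((n : ℂ) + 1)) * z ^ (n + 1)).re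
    - Real.log |Real.cos (R c q z)|)

/-- `P = (1/α) log (1 + α P₁)` if `α ≠ 0`, and `P = P₁` if `α = 0`. -/
def P (c : ℕ → ℂ) (α : ℝ) (p q : ℝ → ℝ) (z : ℂ) : ℝ :=
  if α = 0 then P₁ c p q z
  else 1 / α * Real.log (1 + α * P₁ c p q z)

/-- `F(z, t) = -(1/α) log |cos (R(z) + α t) / cos R(z)|` if `α ≠ 0`, and
`F(z, t) = tan (R(z)) t` if `α = 0`. -/
def F (c : ℕ → ℂ) (α : ℝ) (q : ℝ → ℝ) (z : ℂ) (t : ℝ) : ℝ :=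
  if α = 0 then Real.tan (R c q z) * t
  else -(1 / α) * Real.log |Real.cos (R c q z + α * t) / Real.cos (R c q z)|

/-- The set `Re z₁ + P(z₂) + F(z₂, Im z₁) = 0`, `|z₂| < ε₀`, in `ℂ²`; only its germ at the
origin matters. -/
def M (ε₀ : ℝ) (c : ℕ → ℂ) (α : ℝ) (p q : ℝ → ℝ) : Set (ℂ × ℂ) :=
  {z | ‖z.2‖ < ε₀ ∧ z.1.re + P c α p q z.2 + F c α q z.2 z.1.im = 0}

/-- The stability group of the germ at `x` of a subset `S` of `ℂ²`: the germs at `x` of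
biholomorphic maps between neighbourhoods of `x` that fix `x` and map `S` into itself
near `x`. -/
def Aut (S : Set (ℂ × ℂ)) (x : ℂ × ℂ) : Set (Filter.Germ (𝓝 x) (ℂ × ℂ)) :=
  {f | ∃ e : OpenPartialHomeomorph (ℂ × ℂ) (ℂ × ℂ),
    x ∈ e.source ∧
    DifferentiableOn ℂ e e.source ∧
    DifferentiableOn ℂ e.symm e.target ∧
    e x = x ∧
    (∀ᶠ z in 𝓝 x, z ∈ S → e z ∈ S) ∧
    f = ((e : ℂ × ℂ → ℂ × ℂ) : Filter.Germ (𝓝 x) (ℂ × ℂ))}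

/-- `L^α(w) = (exp (α w) - 1) / α` if `α ≠ 0`, and `L^0(w) = w`. -/
def L (α : ℝ) (w : ℂ) : ℂ :=
  if α = 0 then w else 1 / (α : ℂ) * (Complex.exp ((α : ℂ) * w) - 1)

/-- The holomorphic vector field `L^α(z₁) a(z₂) ∂/∂z₁ + i z₂ ∂/∂z₂`. -/
def H (a : ℂ → ℂ) (α : ℝ) (z : ℂ × ℂ) : ℂ × ℂ :=
  (L α z.1 * a z.2, Complex.I * z.2)

/-- The factor `exp (∫₀ᵗ a(w e^{iτ}) dτ)`. -/
def flowFactor (a : ℂ → ℂ) (t : ℝ) (w : ℂ) : ℂ :=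
  Complex.exp (∫ τ in (0 : ℝ)..t, a (w * Complex.exp (Complex.I * (τ : ℂ))))

/-- The map `φ_t^{a,α}`; the logarithm is the principal branch. -/
def φ (a : ℂ → ℂ) (α : ℝ) (t : ℝ) (z : ℂ × ℂ) : ℂ × ℂ :=
  (if α = 0 then z.1 * flowFactor a t z.2
    else -(1 / (α : ℂ)) *
      Complex.log (1 + (Complex.exp (-(α : ℂ) * z.1) - 1) * flowFactor a t z.2),
    z.2 * Complex.exp (Complex.I * (t : ℂ)))

end InfiniteType

end

/-
In a suitable local chart the hypersurface becomes the model `Re (w e^{-i q(|z|)}) + G(|z|) = 0`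
with `G` positive and flat at `0`, and `φ_t` becomes the rotation `(w, e^{it} z)`. It remains to see
that a biholomorphic germ `(f₁, f₂)` preserving the model is such a rotation. Flatness of `G` forces
`f₁ = w k`. On the curve `w = -e^{i q(|z|)} G(|z|)` in the model the defining equation compares
`G(|f₂|)` with `G(|z|)`; since `G` decays faster than every power, this gives `f₂(0, z) = b z` with
`|b| = 1` and then `k(0, z) = 1`. Once the germ is `(w (1 + w^j k), b (z + w^j l))`, comparing the
terms of order `G^j` on curves in the model yields `k(0, ·) = l(0, ·) = 0`, so that `j` can be
raised indefinitely and `f₁ = w`, `f₂ = b z`.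
-/

namespace InfiniteType

open Set Filter Asymptotics Metric

section Flatness

theorem tendsto_norm_nhdsNE_nhds_zero : Tendsto (fun z : ℂ => ‖z‖) (𝓝[≠] 0) (𝓝 0) :=
  tendsto_norm_nhdsNE_zero.mono_right nhdsWithin_le_nhds

theorem norm_pow_isLittleO {m n : ℕ} (h : m < n) :
    (fun z : ℂ => ‖z‖ ^ n) =o[𝓝[≠] 0] fun z => ‖z‖ ^ m :=
  (isLittleO_pow_pow h).comp_tendsto tendsto_norm_nhdsNE_nhds_zero

theorem norm_pow_isBigO {m n : ℕ} (h : m ≤ n) :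
    (fun z : ℂ => ‖z‖ ^ n) =O[𝓝[≠] 0] fun z => ‖z‖ ^ m := by
  rcases h.eq_or_lt with rfl | h
  · exact isBigO_refl _ _
  · exact (norm_pow_isLittleO h).isBigO

/-- A function on `ℂ` that is `O(‖z‖ ^ n)` at the origin for every `n`; the value at `0` itself is
not constrained. -/
def IsFlat {E : Type*} [Norm E] (u : ℂ → E) : Prop :=
  ∀ n : ℕ, u =O[𝓝[≠] 0] fun z => ‖z‖ ^ n

namespace IsFlat

theorem of_isBigO {E F : Type*} [Norm E] [SeminormedAddCommGroup F] {u : ℂ → E} {v : ℂ → F}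
    (hv : IsFlat v) (h : u =O[𝓝[≠] 0] v) : IsFlat u := fun n => h.trans (hv n)

theorem congr' {E : Type*} [Norm E] {u v : ℂ → E} (hu : IsFlat u) (h : u =ᶠ[𝓝[≠] 0] v) :
    IsFlat v := fun n => (hu n).congr' h .rfl

variable {E : Type*} [SeminormedAddCommGroup E] {u v : ℂ → E}

theorem add (hu : IsFlat u) (hv : IsFlat v) : IsFlat fun z => u z + v z :=
  fun n => (hu n).add (hv n)

theorem sub (hu : IsFlat u) (hv : IsFlat v) : IsFlat fun z => u z - v z :=
  fun n => (hu n).sub (hv n)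

theorem neg (hu : IsFlat u) : IsFlat fun z => -u z := fun n => (hu n).neg_left

theorem isBigO_one (hu : IsFlat u) : u =O[𝓝[≠] 0] fun _ => (1 : ℝ) := by simpa using hu 0

theorem tendsto_zero {E : Type*} [NormedAddCommGroup E] {u : ℂ → E} (hu : IsFlat u) :
    Tendsto u (𝓝[≠] 0) (𝓝 0) := by
  have h : Tendsto (fun z : ℂ => ‖z‖ ^ 1) (𝓝[≠] 0) (𝓝 0) := by
    simpa using tendsto_norm_nhdsNE_nhds_zero
  exact (hu 1).trans_tendsto h

theorem mul_isBigO_one {R : Type*} [NormedRing R] {u v : ℂ → R}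
    (hu : IsFlat u) (hv : v =O[𝓝[≠] 0] fun _ => (1 : ℝ)) : IsFlat fun z => u z * v z := fun n => by
  simpa using (hu n).mul hv

theorem of_pow_mul {u : ℂ → ℝ} {m : ℕ} (h : IsFlat fun z => ‖z‖ ^ m * u z) : IsFlat u := by
  intro n
  have hmul := (isBigO_refl (fun z : ℂ => (‖z‖ ^ m)⁻¹) (𝓝[≠] 0)).mul (h (m + n))
  simp only [pow_add] at hmul
  refine hmul.congr' ?_ ?_
  all_goals
    filter_upwards [self_mem_nhdsWithin] with z hz
    have hz : ‖z‖ ≠ 0 := norm_ne_zero_iff.2 hz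
    field_simp

end IsFlat

end Flatness

section AnalyticOrder

theorem exists_norm_eq_one_pow_mul_eq_norm (v : ℂ) {m : ℕ} (hm : m ≠ 0) :
    ∃ d : ℂ, ‖d‖ = 1 ∧ d ^ m * v = (‖v‖ : ℂ) := by
  rcases eq_or_ne v 0 with rfl | hv
  · exact ⟨1, by simp⟩
  obtain ⟨d, hd⟩ := IsAlgClosed.exists_pow_nat_eq ((‖v‖ : ℂ) / v) (Nat.pos_of_ne_zero hm)
  refine ⟨d, ?_, by rw [hd, div_mul_cancel₀ _ hv]⟩
  have h : ‖d‖ ^ m = 1 := by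
    rw [← norm_pow, hd, norm_div, Complex.norm_real, norm_norm, div_self (norm_ne_zero_iff.2 hv)]
  exact (pow_eq_one_iff_of_nonneg (norm_nonneg _) hm).1 h

theorem tendsto_ofReal_mul_nhdsGT {d : ℂ} (hd : ‖d‖ = 1) :
    Tendsto (fun t : ℝ => (t : ℂ) * d) (𝓝[>] 0) (𝓝[≠] 0) := by
  refine tendsto_nhdsWithin_iff.2 ⟨?_, ?_⟩
  · have h : Continuous fun t : ℝ => (t : ℂ) * d := by fun_prop
    simpa using (h.tendsto 0).mono_left nhdsWithin_le_nhds
  · filter_upwards [self_mem_nhdsWithin] with t (ht : 0 < t)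
    exact mul_ne_zero (Complex.ofReal_ne_zero.2 ht.ne') (norm_ne_zero_iff.1 (by simp [hd]))

theorem not_isLittleO_re_pow_mul {v : ℂ → ℂ} {v₀ : ℂ} (hv : Tendsto v (𝓝[≠] 0) (𝓝 v₀))
    (hv₀ : v₀ ≠ 0) {m : ℕ} (hm : m ≠ 0) :
    ¬ (fun z => (z ^ m * v z).re) =o[𝓝[≠] 0] fun z => ‖z‖ ^ m := by
  intro h
  obtain ⟨d, hd, hdv⟩ := exists_norm_eq_one_pow_mul_eq_norm v₀ hm
  have hray := tendsto_ofReal_mul_nhdsGT hd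
  have hlim : Tendsto (fun t : ℝ => (d ^ m * v (t * d)).re) (𝓝[>] 0) (𝓝 ‖v₀‖) := by
    have := (Complex.continuous_re.tendsto _).comp ((hv.comp hray).const_mul (d ^ m))
    rwa [hdv, Complex.ofReal_re] at this
  have hzero : Tendsto (fun t : ℝ => (d ^ m * v (t * d)).re) (𝓝[>] 0) (𝓝 0) := by
    refine (h.comp_tendsto hray).tendsto_div_nhds_zero.congr' ?_
    filter_upwards [self_mem_nhdsWithin] with t (ht : 0 < t)
    have hre : ((t * d : ℂ) ^ m * v (t * d)).re = t ^ m * (d ^ m * v (t * d)).re := by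
      rw [mul_pow, mul_assoc, ← Complex.ofReal_pow, Complex.re_ofReal_mul]
    have hnorm : ‖(t : ℂ) * d‖ = t := by
      rw [norm_mul, hd, mul_one, Complex.norm_of_nonneg ht.le]
    simp only [Function.comp_apply, hre, hnorm]
    field_simp
  exact hv₀ (norm_eq_zero.1 (tendsto_nhds_unique hlim hzero))

theorem isBigO_of_re_mul_isBigO {u E : ℂ → ℂ} {E₀ : ℂ} (hu : AnalyticAt ℂ u 0) (hu0 : u 0 = 0)
    (hE : Tendsto E (𝓝[≠] 0) (𝓝 E₀)) (hE₀ : E₀ ≠ 0) {n : ℕ}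
    (h : (fun z => (u z * E z).re) =O[𝓝[≠] 0] fun z => ‖z‖ ^ n) :
    u =O[𝓝[≠] 0] fun z => ‖z‖ ^ n := by
  by_cases htop : analyticOrderAt u 0 = ⊤
  · have hzero : u =ᶠ[𝓝[≠] 0] 0 := (analyticOrderAt_eq_top.1 htop).filter_mono nhdsWithin_le_nhds
    exact hzero.trans_isBigO (isBigO_zero _ _)
  obtain ⟨v, hv, hv0, huv⟩ := hu.analyticOrderAt_ne_top.1 htop
  set m := analyticOrderNatAt u 0
  simp only [sub_zero, smul_eq_mul] at huv
  have hm : m ≠ 0 := fun hm => hv0 (by simpa [hm, hu0] using huv.self_of_nhds.symm)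
  have hvt : Tendsto v (𝓝[≠] 0) (𝓝 (v 0)) := hv.continuousAt.tendsto.mono_left nhdsWithin_le_nhds
  have huv' := huv.filter_mono (nhdsWithin_le_nhds (s := {0}ᶜ))
  have hnm : n ≤ m := by
    by_contra! hlt
    refine not_isLittleO_re_pow_mul (hvt.mul hE) (mul_ne_zero hv0 hE₀) hm ?_
    refine (h.trans_isLittleO (norm_pow_isLittleO hlt)).congr' ?_ .rfl
    filter_upwards [huv'] with z hz
    rw [hz, mul_assoc]
  have hum : u =O[𝓝[≠] 0] fun z => ‖z‖ ^ m * 1 :=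
    huv'.trans_isBigO (IsBigO.mul (isBigO_of_le _ fun z => by simp) (hvt.isBigO_one ℝ))
  simp only [mul_one] at hum
  exact hum.trans (norm_pow_isBigO hnm)

theorem IsFlat.eventually_eq_zero {u : ℂ → ℂ} (h : IsFlat u) (hu : AnalyticAt ℂ u 0) :
    ∀ᶠ z in 𝓝 0, u z = 0 := by
  by_contra htop
  rw [← analyticOrderAt_eq_top] at htop
  obtain ⟨v, hv, hv0, huv⟩ := hu.analyticOrderAt_ne_top.1 htop
  set m := analyticOrderNatAt u 0
  have hvt : Tendsto v (𝓝[≠] 0) (𝓝 (v 0)) := hv.continuousAt.tendsto.mono_left nhdsWithin_le_nhds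
  have hinv : (fun z => (v z)⁻¹) =O[𝓝[≠] 0] fun _ => (1 : ℝ) := (hvt.inv₀ hv0).isBigO_one ℝ
  have hpow : (fun z : ℂ => ‖z‖ ^ m) =O[𝓝[≠] 0] fun z => ‖z‖ ^ (m + 1) := by
    refine ((h.mul_isBigO_one hinv) (m + 1)).norm_left.congr' ?_ .rfl
    filter_upwards [huv.filter_mono nhdsWithin_le_nhds, hvt.eventually_ne hv0] with z hz hvz
    rw [hz, sub_zero, smul_eq_mul, mul_assoc, mul_inv_cancel₀ hvz, mul_one, norm_pow]
  refine (norm_pow_isLittleO m.lt_succ_self).not_isBigO ?_ hpow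
  refine Eventually.frequently ?_
  filter_upwards [self_mem_nhdsWithin] with z hz
  exact pow_ne_zero _ (norm_ne_zero_iff.2 hz)

end AnalyticOrder

section SeparatelyHolomorphic

theorem mem_ball_zero_prod {p : ℂ × ℂ} {r : ℝ} :
    p ∈ ball (0 : ℂ × ℂ) r ↔ p.1 ∈ ball (0 : ℂ) r ∧ p.2 ∈ ball (0 : ℂ) r := by
  simp only [mem_ball_zero_iff, Prod.norm_def, max_lt_iff]

/-- Bounded functions on the polydisc of radius `r` that are holomorphic in each variable. This
class is stable under division by the first variable, and no joint continuity is needed. -/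
structure SepHolo (f : ℂ × ℂ → ℂ) (r : ℝ) : Prop where
  bdd : ∃ C, ∀ p ∈ ball (0 : ℂ × ℂ) r, ‖f p‖ ≤ C
  left : ∀ z ∈ ball (0 : ℂ) r, DifferentiableOn ℂ (fun w => f (w, z)) (ball 0 r)
  right : ∀ w ∈ ball (0 : ℂ) r, DifferentiableOn ℂ (fun z => f (w, z)) (ball 0 r)

theorem norm_dslope_zero_le {f : ℂ → ℂ} {r s C : ℝ} (hr : 0 < r) (hrs : r < s)
    (hf : DifferentiableOn ℂ f (ball 0 s)) (hC : ∀ w ∈ closedBall (0 : ℂ) r, ‖f w‖ ≤ C) {w : ℂ}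
    (hw : w ∈ closedBall (0 : ℂ) r) : ‖dslope f 0 w‖ ≤ 2 * C / r := by
  have hcl : closure (ball (0 : ℂ) r) = closedBall 0 r := closure_ball _ hr.ne'
  have hd : DifferentiableOn ℂ (dslope f 0) (ball 0 s) :=
    (Complex.differentiableOn_dslope (ball_mem_nhds 0 (hr.trans hrs))).2 hf
  refine Complex.norm_le_of_forall_mem_frontier_norm_le (U := ball 0 r) isBounded_ball
    (DifferentiableOn.diffContOnCl (hcl ▸ hd.mono (closedBall_subset_ball hrs))) ?_ (hcl ▸ hw)
  intro ξ hξ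
  rw [frontier_ball _ hr.ne'] at hξ
  have hξr : ‖ξ‖ = r := mem_sphere_zero_iff_norm.1 hξ
  have hξ0 : ξ ≠ 0 := ne_zero_of_mem_sphere hr.ne' ⟨ξ, hξ⟩
  rw [dslope_of_ne _ hξ0, slope_def_field, norm_div, sub_zero, hξr, two_mul]
  gcongr
  exact (norm_sub_le _ _).trans
    (add_le_add (hC _ (sphere_subset_closedBall hξ)) (hC _ (mem_closedBall_self hr.le)))

/-- The quotient `(f (w, z) - f (0, z)) / w`, extended to `w = 0` by the derivative in `w`. -/
noncomputable def fstSlope (f : ℂ × ℂ → ℂ) (p : ℂ × ℂ) : ℂ :=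
  dslope (fun w => f (w, p.2)) 0 p.1

theorem eq_add_mul_fstSlope (f : ℂ × ℂ → ℂ) (p : ℂ × ℂ) :
    f p = f (0, p.2) + p.1 * fstSlope f p := by
  have h := sub_smul_dslope (fun w => f (w, p.2)) 0 p.1
  rw [sub_zero, smul_eq_mul] at h
  rw [fstSlope, h, add_sub_cancel]

namespace SepHolo

variable {f : ℂ × ℂ → ℂ} {r : ℝ}

theorem fstSlope_left (h : SepHolo f r) (hr : 0 < r) {z : ℂ} (hz : z ∈ ball (0 : ℂ) r) :
    DifferentiableOn ℂ (fun w => fstSlope f (w, z)) (ball 0 r) :=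
  (Complex.differentiableOn_dslope (ball_mem_nhds 0 hr)).2 (h.left z hz)

theorem exists_norm_fstSlope_le (h : SepHolo f r) (hr : 0 < r) : ∃ C, ∀ z ∈ ball (0 : ℂ) r,
    ∀ w ∈ closedBall (0 : ℂ) (r / 2), ‖fstSlope f (w, z)‖ ≤ C := by
  obtain ⟨C, hC⟩ := h.bdd
  have hr2 : r / 2 < r := half_lt_self hr
  exact ⟨_, fun z hz w hw => norm_dslope_zero_le (half_pos hr) hr2 (h.left z hz)
    (fun w hw => hC _ (mem_ball_zero_prod.2 ⟨closedBall_subset_ball hr2 hw, hz⟩)) hw⟩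

theorem fstSlope_right_of_ne (h : SepHolo f r) {w : ℂ} (hw : w ∈ ball (0 : ℂ) r) (hw0 : w ≠ 0) :
    DifferentiableOn ℂ (fun z => fstSlope f (w, z)) (ball 0 r) := by
  have hfg : (fun z => fstSlope f (w, z)) = fun z => (f (w, z) - f (0, z)) / (w - 0) := by
    ext z
    simp only [fstSlope, dslope_of_ne _ hw0, slope_def_field]
  rw [hfg]
  have hr : 0 < r := pos_of_mem_ball hw
  exact ((h.right w hw).sub (h.right 0 (mem_ball_self hr))).div_const _

theorem tendstoUniformlyOn_fstSlope (h : SepHolo f r) (hr : 0 < r) :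
    TendstoUniformlyOn (fun w z => fstSlope f (w, z)) (fun z => fstSlope f (0, z)) (𝓝[≠] 0)
      (ball 0 r) := by
  obtain ⟨C, hC⟩ := h.exists_norm_fstSlope_le hr
  rw [Metric.tendstoUniformlyOn_iff]
  intro ε hε
  have hlim : Tendsto (fun w : ℂ => ‖w‖ * (2 * C / (r / 2))) (𝓝[≠] 0) (𝓝 0) := by
    simpa using tendsto_norm_nhdsNE_nhds_zero.mul_const (2 * C / (r / 2))
  filter_upwards [hlim.eventually (gt_mem_nhds hε),
    nhdsWithin_le_nhds (closedBall_mem_nhds (0 : ℂ) (half_pos hr))] with w hw hwr z hz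
  have hslope := sub_smul_dslope (fun w => fstSlope f (w, z)) 0 w
  rw [dist_comm, dist_eq_norm, ← hslope, sub_zero, norm_smul]
  refine lt_of_le_of_lt ?_ hw
  gcongr
  exact norm_dslope_zero_le (half_pos hr) (half_lt_self hr) (h.fstSlope_left hr hz) (hC z hz) hwr

/-- For `w = 0` the quotient is the uniform limit of the quotients with `w ≠ 0`, which are
holomorphic in `z`. -/
theorem fstSlope (h : SepHolo f r) (hr : 0 < r) : SepHolo (fstSlope f) (r / 2) := by
  obtain ⟨C, hC⟩ := h.exists_norm_fstSlope_le hr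
  have hsub : ball (0 : ℂ) (r / 2) ⊆ ball 0 r := ball_subset_ball (half_le_self hr.le)
  refine ⟨⟨C, fun p hp => ?_⟩, fun z hz => (h.fstSlope_left hr (hsub hz)).mono hsub,
    fun w hw => DifferentiableOn.mono ?_ hsub⟩
  · obtain ⟨h1, h2⟩ := mem_ball_zero_prod.1 hp
    exact hC p.2 (hsub h2) p.1 (ball_subset_closedBall h1)
  · rcases eq_or_ne w 0 with rfl | hw0
    · refine (h.tendstoUniformlyOn_fstSlope hr).tendstoLocallyUniformlyOn.differentiableOn ?_
        isOpen_ball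
      filter_upwards [self_mem_nhdsWithin, nhdsWithin_le_nhds (ball_mem_nhds (0 : ℂ) hr)]
        with w hw0 hw using h.fstSlope_right_of_ne hw hw0
    · exact h.fstSlope_right_of_ne (hsub hw) hw0

end SepHolo

/-- Germs at the origin of bounded, separately holomorphic functions. -/
def IsSepHolo (f : ℂ × ℂ → ℂ) : Prop := ∃ r > 0, SepHolo f r

namespace IsSepHolo

variable {f : ℂ × ℂ → ℂ} {W : ℂ → ℂ}

theorem of_differentiableAt (h : ∀ᶠ p in 𝓝 (0 : ℂ × ℂ), DifferentiableAt ℂ f p) :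
    IsSepHolo f := by
  have hcont : ∀ᶠ p in 𝓝 0, ‖f p‖ ≤ ‖f 0‖ + 1 :=
    h.self_of_nhds.continuousAt.norm.eventually (Iic_mem_nhds (lt_add_one _))
  obtain ⟨r, hr, hf⟩ := Metric.eventually_nhds_iff_ball.1 (h.and hcont)
  refine ⟨r, hr, ⟨_, fun p hp => (hf p hp).2⟩, fun z hz w hw => ?_, fun w hw z hz => ?_⟩
  all_goals
    have hd := (hf (w, z) (mem_ball_zero_prod.2 ⟨hw, hz⟩)).1
    exact DifferentiableAt.differentiableWithinAt (by fun_prop)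

theorem analyticAt (h : IsSepHolo f) : AnalyticAt ℂ (fun z => f (0, z)) 0 := by
  obtain ⟨r, hr, h⟩ := h
  exact (h.right 0 (mem_ball_self hr)).analyticAt (ball_mem_nhds 0 hr)

theorem exists_eq_add_mul (h : IsSepHolo f) :
    ∃ g : ℂ × ℂ → ℂ, IsSepHolo g ∧ ∀ p : ℂ × ℂ, f p = f (0, p.2) + p.1 * g p := by
  obtain ⟨r, hr, h⟩ := h
  exact ⟨_, ⟨r / 2, half_pos hr, h.fstSlope hr⟩, eq_add_mul_fstSlope f⟩

theorem const_mul (h : IsSepHolo f) (c : ℂ) : IsSepHolo fun p => c * f p := by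
  obtain ⟨r, hr, ⟨C, hC⟩, hl, hr'⟩ := h
  refine ⟨r, hr, ⟨‖c‖ * C, fun p hp => ?_⟩, fun z hz => (hl z hz).const_mul c,
    fun w hw => (hr' w hw).const_mul c⟩
  rw [norm_mul]
  gcongr
  exact hC p hp

theorem isBigO_one (h : IsSepHolo f) (hW : Tendsto W (𝓝[≠] 0) (𝓝 0)) :
    (fun z => f (W z, z)) =O[𝓝[≠] 0] fun _ => (1 : ℝ) := by
  obtain ⟨r, hr, ⟨C, hC⟩, -, -⟩ := h
  refine IsBigO.of_bound C ?_
  filter_upwards [hW (ball_mem_nhds 0 hr),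
    nhdsWithin_le_nhds (ball_mem_nhds (0 : ℂ) hr)] with z hz hz'
  simpa using hC (W z, z) (mem_ball_zero_prod.2 ⟨hz, hz'⟩)

theorem sub_isBigO (h : IsSepHolo f) (hW : Tendsto W (𝓝[≠] 0) (𝓝 0)) :
    (fun z => f (W z, z) - f (0, z)) =O[𝓝[≠] 0] W := by
  obtain ⟨g, hg, hfg⟩ := h.exists_eq_add_mul
  have hmul := (isBigO_refl W (𝓝[≠] 0)).norm_right.mul (hg.isBigO_one hW)
  simp only [mul_one] at hmul
  refine hmul.of_norm_right.congr_left fun z => ?_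
  rw [hfg (W z, z), add_sub_cancel_left]

theorem tendsto_zero_left (h : IsSepHolo f) :
    Tendsto (fun z => f (0, z)) (𝓝[≠] 0) (𝓝 (f 0)) :=
  h.analyticAt.continuousAt.tendsto.mono_left nhdsWithin_le_nhds

theorem tendsto (h : IsSepHolo f) (hW : Tendsto W (𝓝[≠] 0) (𝓝 0)) :
    Tendsto (fun z => f (W z, z)) (𝓝[≠] 0) (𝓝 (f 0)) := by
  simpa using ((h.sub_isBigO hW).trans_tendsto hW).add h.tendsto_zero_left

theorem isBigO_norm_zero_left (h : IsSepHolo f) (hf0 : f 0 = 0) :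
    (fun z => f (0, z)) =O[𝓝[≠] 0] fun z => ‖z‖ := by
  have hd := h.analyticAt.differentiableAt.isBigO_sub
  simp only [sub_zero, Prod.mk_zero_zero, hf0] at hd
  exact hd.norm_right.mono nhdsWithin_le_nhds

end IsSepHolo

end SeparatelyHolomorphic

section Profile

theorem exists_forall_lt_of_tendsto_zero {g : ℝ → ℝ} {δ : ℝ} (hδ : 0 < δ)
    (hc : ContinuousOn g (Ioc 0 δ)) (hpos : 0 < g δ) (hlim : Tendsto g (𝓝[>] 0) (𝓝 0)) :
    ∃ s ∈ Ioc 0 δ, ∀ t ∈ Ioo 0 s, g t < g s := by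
  obtain ⟨η, hη, hsmall⟩ :=
    mem_nhdsGT_iff_exists_Ioo_subset.1 (hlim.eventually (gt_mem_nhds hpos))
  have hη : 0 < η := hη
  have hηδ : η ≤ δ := not_lt.1 fun h => lt_irrefl (g δ) (hsmall ⟨hδ, h⟩)
  have hclosed : IsClosed (Icc η δ ∩ g ⁻¹' Ici (g δ)) :=
    (hc.mono fun s hs => ⟨hη.trans_le hs.1, hs.2⟩).preimage_isClosed_of_isClosed isClosed_Icc
      isClosed_Ici
  obtain ⟨s, ⟨hs, hgs⟩, hmin⟩ := (isCompact_Icc.of_isClosed_subset hclosed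
    inter_subset_left).exists_isLeast ⟨δ, ⟨hηδ, le_rfl⟩, le_refl (g δ)⟩
  refine ⟨s, ⟨hη.trans_le hs.1, hs.2⟩, fun t ht => ?_⟩
  by_contra! hle
  have hgt : g δ ≤ g t := le_trans hgs hle
  have hηt : η ≤ t := not_lt.1 fun h => hgt.not_gt (hsmall ⟨ht.1, h⟩)
  exact ht.2.not_ge (hmin ⟨⟨hηt, ht.2.le.trans hs.2⟩, hgt⟩)

theorem antitoneOn_div_pow {g : ℝ → ℝ} {δ : ℝ} {N : ℕ}
    (hg : ∀ s ∈ Ioo 0 δ, DifferentiableAt ℝ g s)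
    (hle : ∀ s ∈ Ioo 0 δ, s * deriv g s ≤ N * g s) :
    AntitoneOn (fun s => g s / s ^ N) (Ioo 0 δ) := by
  have hder : ∀ s ∈ Ioo 0 δ, HasDerivAt (fun s => g s / s ^ N)
      ((s * deriv g s - N * g s) / (s * s ^ N)) s := fun s hs => by
    have hs0 : s ≠ 0 := hs.1.ne'
    refine ((hg s hs).hasDerivAt.div (hasDerivAt_pow N s) (pow_ne_zero N hs0)).congr_deriv ?_
    rcases N with _ | N
    · simp [field]
    · simp only [Nat.add_sub_cancel, pow_succ]
      field_simp
  refine antitoneOn_of_deriv_nonpos (convex_Ioo _ _)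
    (fun s hs => (hder s hs).continuousAt.continuousWithinAt) ?_ ?_ <;> rw [interior_Ioo]
  · exact fun s hs => (hder s hs).differentiableAt.differentiableWithinAt
  · intro s hs
    rw [(hder s hs).deriv]
    have := hs.1
    exact div_nonpos_of_nonpos_of_nonneg (sub_nonpos.2 (hle s hs)) (by positivity)

/-- The data of a model hypersurface `Re (w e ^ {-i q(|z|)}) + G(|z|) = 0`: a positive function `G`
flat at `0` together with its derivative, whose second derivative is flat as well (`G_taylor`), and
a function `q` on `[0, δ)` of class `C^{1,1}`. -/
structure Profile (G q : ℝ → ℝ) : Prop where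
  G_zero : G 0 = 0
  G_pos : ∀ᶠ s in 𝓝[>] 0, 0 < G s
  G_differentiableAt : ∀ᶠ s in 𝓝 0, DifferentiableAt ℝ G s
  G_isBigO : ∀ n : ℕ, G =O[𝓝 0] fun s => s ^ n
  deriv_G_isBigO : ∀ n : ℕ, deriv G =O[𝓝 0] fun s => s ^ n
  G_taylor : ∀ n : ℕ, ∀ᶠ s in 𝓝[>] 0, ∀ t, |t - s| ≤ s →
    |G t - G s - deriv G s * (t - s)| ≤ s ^ n * (t - s) ^ 2
  q_zero : q 0 = 0
  q_lipschitz : ∃ C, ∀ᶠ δ in 𝓝[>] 0, LipschitzOnWith C q (Ico 0 δ)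
  q_taylor : ∃ C, ∀ᶠ δ in 𝓝[>] 0, ∀ s ∈ Ioo 0 δ, ∀ t ∈ Ioo 0 δ,
    |q t - q s - deriv q s * (t - s)| ≤ C * (t - s) ^ 2

namespace Profile

variable {G q : ℝ → ℝ}

theorem tendsto_G_div_pow (H : Profile G q) (K : ℕ) :
    Tendsto (fun s => G s / s ^ K) (𝓝[>] 0) (𝓝 0) := by
  have hs : Tendsto (fun s : ℝ => s) (𝓝[>] 0) (𝓝 0) := tendsto_nhdsWithin_of_tendsto_nhds tendsto_id
  refine IsBigO.trans_tendsto ?_ hs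
  refine ((((H.G_isBigO (K + 1)).mono nhdsWithin_le_nhds).mul
    (isBigO_refl (fun s : ℝ => (s ^ K)⁻¹) _)).congr' ?_ ?_)
  · exact .of_forall fun s => (div_eq_mul_inv _ _).symm
  · filter_upwards [self_mem_nhdsWithin] with s (hs : 0 < s)
    rw [pow_succ]
    field_simp

theorem eventually_regular (H : Profile G q) :
    ∀ᶠ δ in 𝓝[>] 0, ∀ s ∈ Ioc 0 δ, 0 < G s ∧ DifferentiableAt ℝ G s := by
  have h := H.G_pos.and (H.G_differentiableAt.filter_mono nhdsWithin_le_nhds)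
  obtain ⟨a, ha, hsub⟩ := mem_nhdsGT_iff_exists_Ioo_subset.1 h
  filter_upwards [Ioo_mem_nhdsGT ha] with δ hδ s hs
  exact hsub ⟨hs.1, hs.2.trans_lt hδ.2⟩

/-- Since `G s / s ^ K` tends to `0`, this quotient is larger at some `s` near `0` than at
all smaller radii. -/
theorem false_of_descent (H : Profile G q) (K : ℕ)
    (h : ∀ᶠ s in 𝓝[>] 0, ∃ t ∈ Ioo 0 s, G s * t ^ K ≤ G t * s ^ K) : False := by
  obtain ⟨a, ha, hsub⟩ := mem_nhdsGT_iff_exists_Ioo_subset.1 h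
  obtain ⟨δ, hreg, hδ⟩ := (H.eventually_regular.and (Ioo_mem_nhdsGT ha)).exists
  have hc : ContinuousOn (fun s => G s / s ^ K) (Ioc 0 δ) := fun s hs =>
    ((hreg s hs).2.continuousAt.div (continuousAt_id.pow K)
      (pow_ne_zero K hs.1.ne')).continuousWithinAt
  obtain ⟨s, hs, hlt⟩ := exists_forall_lt_of_tendsto_zero hδ.1 hc
    (div_pos (hreg δ ⟨hδ.1, le_rfl⟩).1 (pow_pos hδ.1 K)) (H.tendsto_G_div_pow K)
  obtain ⟨t, ht, hle⟩ := hsub ⟨hs.1, hs.2.trans_lt hδ.2⟩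
  refine (hlt t ht).not_ge ?_
  rwa [div_le_div_iff₀ (pow_pos hs.1 K) (pow_pos ht.1 K)]

theorem not_isBigO_mul_deriv (H : Profile G q) :
    ¬ (fun s => s * deriv G s) =O[𝓝[>] 0] G := by
  intro h
  obtain ⟨c, hc⟩ := h.bound
  obtain ⟨N, hN⟩ := exists_nat_ge c
  obtain ⟨a, ha, hsub⟩ := mem_nhdsGT_iff_exists_Ioo_subset.1 hc
  obtain ⟨δ, hreg, hδ⟩ := (H.eventually_regular.and (Ioo_mem_nhdsGT ha)).exists
  have hanti : AntitoneOn (fun s => G s / s ^ N) (Ioo 0 δ) := by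
    refine antitoneOn_div_pow (fun s hs => (hreg s ⟨hs.1, hs.2.le⟩).2) fun s hs => ?_
    have hG : 0 < G s := (hreg s ⟨hs.1, hs.2.le⟩).1
    calc s * deriv G s ≤ ‖s * deriv G s‖ := le_abs_self _
      _ ≤ c * ‖G s‖ := hsub ⟨hs.1, hs.2.trans hδ.2⟩
      _ ≤ N * G s := by rw [Real.norm_of_nonneg hG.le]; gcongr
  refine H.false_of_descent N ?_
  filter_upwards [Ioo_mem_nhdsGT hδ.1] with s hs
  have hs2 : 0 < s / 2 ∧ s / 2 < s := ⟨half_pos hs.1, half_lt_self hs.1⟩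
  refine ⟨s / 2, hs2, ?_⟩
  have hle := hanti ⟨hs2.1, hs2.2.trans hs.2⟩ hs hs2.2.le
  rwa [div_le_div_iff₀ (pow_pos hs.1 N) (pow_pos hs2.1 N)] at hle

theorem not_contracting (H : Profile G q) {Y l : ℝ → ℝ} (K : ℕ)
    (h : ∀ᶠ s in 𝓝[>] 0, 1 < l s ∧ 0 < Y s ∧ l s * Y s ≤ s ∧ G s ≤ l s ^ K * G (Y s)) :
    False := by
  refine H.false_of_descent K ?_
  filter_upwards [h, H.G_pos, self_mem_nhdsWithin] with s ⟨hl, hY0, hY, hG⟩ hGs (_ : 0 < s)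
  have : 0 < l s := one_pos.trans hl
  have hGY : 0 < G (Y s) := pos_of_mul_pos_right (hGs.trans_le hG) (by positivity)
  refine ⟨Y s, ⟨hY0, (lt_mul_of_one_lt_left hY0 hl).trans_le hY⟩, ?_⟩
  calc G s * Y s ^ K ≤ l s ^ K * G (Y s) * Y s ^ K := by gcongr
    _ = G (Y s) * (l s * Y s) ^ K := by ring
    _ ≤ G (Y s) * s ^ K := by gcongr

theorem not_expanding (H : Profile G q) {Y l : ℝ → ℝ} (K : ℕ)
    (hc : ∀ᶠ s in 𝓝[>] 0, ContinuousOn Y (Icc 0 s)) (hY0 : Y 0 = 0)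
    (h : ∀ᶠ s in 𝓝[>] 0, 1 < l s ∧ l s * s ≤ Y s ∧ G (Y s) ≤ l s ^ K * G s) : False := by
  obtain ⟨a, ha, hsub⟩ := mem_nhdsGT_iff_exists_Ioo_subset.1 (h.and H.G_pos)
  refine H.false_of_descent K ?_
  filter_upwards [hc, Ioo_mem_nhdsGT ha] with s hc hs
  obtain ⟨⟨hl, hY, -⟩, -⟩ := hsub hs
  have hsY : s < Y s := (lt_mul_of_one_lt_left hs.1 hl).trans_le hY
  obtain ⟨t, ht, hts⟩ := intermediate_value_Icc hs.1.le hc ⟨hY0.symm ▸ hs.1.le, hsY.le⟩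
  have ht0 : t ≠ 0 := by rintro rfl; exact hs.1.ne (hY0.symm.trans hts)
  have hts' : t ≠ s := by rintro rfl; exact hsY.ne hts.symm
  have ht : t ∈ Ioo 0 s := ⟨ht.1.lt_of_ne' ht0, ht.2.lt_of_ne hts'⟩
  obtain ⟨⟨hlt, hYt, hGt⟩, hGt0⟩ := hsub ⟨ht.1, ht.2.trans hs.2⟩
  have : 0 < G t := hGt0
  refine ⟨t, ht, ?_⟩
  have hlt0 : 0 ≤ l t * t := mul_nonneg (zero_le_one.trans hlt.le) ht.1.le
  calc G s * t ^ K ≤ l t ^ K * G t * t ^ K := by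
        rw [← hts]; have := ht.1; gcongr
    _ = G t * (l t * t) ^ K := by ring
    _ ≤ G t * s ^ K := by rw [← hts]; gcongr

theorem isFlat_G_norm_comp (H : Profile G q) {y : ℂ → ℂ} (hy : y =O[𝓝[≠] 0] fun z => ‖z‖) :
    IsFlat fun z => G ‖y z‖ := fun n =>
  have hy0 : Tendsto (fun z => ‖y z‖) (𝓝[≠] 0) (𝓝 0) :=
    hy.norm_left.trans_tendsto tendsto_norm_nhdsNE_nhds_zero
  ((H.G_isBigO n).comp_tendsto hy0).trans (hy.norm_left.pow n)

theorem isFlat_G_norm (H : Profile G q) : IsFlat fun z : ℂ => G ‖z‖ :=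
  H.isFlat_G_norm_comp (isBigO_refl _ _).norm_right

theorem isFlat_deriv_G_norm (H : Profile G q) : IsFlat fun z : ℂ => deriv G ‖z‖ := fun n =>
  (H.deriv_G_isBigO n).comp_tendsto tendsto_norm_nhdsNE_nhds_zero

theorem eventually_G_norm_pos (H : Profile G q) : ∀ᶠ z : ℂ in 𝓝[≠] 0, 0 < G ‖z‖ :=
  tendsto_norm_nhdsNE_zero.eventually H.G_pos

theorem q_norm_sub_isBigO (H : Profile G q) {l : Filter ℂ} {x y : ℂ → ℂ}
    (hx : Tendsto x l (𝓝 0)) (hy : Tendsto y l (𝓝 0)) :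
    (fun z => q ‖x z‖ - q ‖y z‖) =O[l] fun z => ‖x z‖ - ‖y z‖ := by
  obtain ⟨C, hC⟩ := H.q_lipschitz
  obtain ⟨δ, hlip, hδ : 0 < δ⟩ := (hC.and self_mem_nhdsWithin).exists
  refine IsBigO.of_bound C ?_
  filter_upwards [hx (ball_mem_nhds 0 hδ), hy (ball_mem_nhds 0 hδ)] with z hxz hyz
  exact hlip.norm_sub_le ⟨norm_nonneg _, mem_ball_zero_iff.1 hxz⟩
    ⟨norm_nonneg _, mem_ball_zero_iff.1 hyz⟩

theorem eventually_continuousAt_q_norm (H : Profile G q) :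
    ∀ᶠ z : ℂ in 𝓝 0, ContinuousAt (fun z : ℂ => q ‖z‖) z := by
  obtain ⟨C, hC⟩ := H.q_lipschitz
  obtain ⟨δ, hlip, hδ : 0 < δ⟩ := (hC.and self_mem_nhdsWithin).exists
  have hc : ContinuousOn (fun z : ℂ => q ‖z‖) (ball 0 δ) :=
    hlip.continuousOn.comp continuous_norm.continuousOn fun z hz =>
      ⟨norm_nonneg z, mem_ball_zero_iff.1 hz⟩
  filter_upwards [ball_mem_nhds (0 : ℂ) hδ] with z hz
  exact hc.continuousAt (isOpen_ball.mem_nhds hz)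

theorem eventually_continuousAt_G_norm (H : Profile G q) :
    ∀ᶠ z : ℂ in 𝓝 0, ContinuousAt (fun z : ℂ => G ‖z‖) z := by
  filter_upwards [tendsto_norm_zero.eventually H.G_differentiableAt] with z hz
  exact ContinuousAt.comp (f := fun z : ℂ => ‖z‖) hz.continuousAt continuous_norm.continuousAt

end Profile

end Profile

section Model

/-- The hypersurface `Re (w e ^ {-i q(|z|)}) + G(|z|) = 0`. -/
def Model (G q : ℝ → ℝ) : Set (ℂ × ℂ) :=
  {p | (p.1 * Complex.exp ((-q ‖p.2‖ : ℝ) * Complex.I)).re + G ‖p.2‖ = 0}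

/-- The first coordinate `w` of the point of `Model G q` over `z` at which the imaginary part of
`w e ^ {-i q(|z|)}` is `τ z`. -/
noncomputable def curve (G q : ℝ → ℝ) (τ : ℂ → ℝ) (z : ℂ) : ℂ :=
  Complex.exp (q ‖z‖ * Complex.I) * (Complex.I * τ z - G ‖z‖)

/-- The unimodular factor `e ^ {i (q(|x|) - q(|y|))}`. -/
noncomputable def phase (q : ℝ → ℝ) (x y : ℂ) : ℂ := Complex.exp ((q ‖x‖ - q ‖y‖ : ℝ) * Complex.I)

/-- The factor by which the map `(w, z) ↦ (w k(w, z), f(w, z))` multiplies the coordinate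
`w e ^ {-i q(|z|)}`. -/
noncomputable def multiplier (q : ℝ → ℝ) (k f : ℂ × ℂ → ℂ) (w z : ℂ) : ℂ :=
  k (w, z) * phase q z (f (w, z))

variable {G q : ℝ → ℝ} {f₁ f₂ k : ℂ × ℂ → ℂ} {τ : ℂ → ℝ}

theorem curve_mul_exp (τ : ℂ → ℝ) (z y : ℂ) :
    curve G q τ z * Complex.exp ((-q ‖y‖ : ℝ) * Complex.I) =
      (Complex.I * τ z - G ‖z‖) * phase q z y := by
  rw [curve, phase, mul_right_comm, mul_comm, ← Complex.exp_add]
  congr 2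
  push_cast
  ring

theorem phase_self (x : ℂ) : phase q x x = 1 := by simp [phase]

theorem norm_phase (x y : ℂ) : ‖phase q x y‖ = 1 := Complex.norm_exp_ofReal_mul_I _

theorem phase_mul_phase (x y z : ℂ) : phase q x y * phase q y z = phase q x z := by
  rw [phase, phase, phase, ← Complex.exp_add]
  congr 1
  push_cast
  ring

theorem norm_phase_sub_one_le (x y : ℂ) : ‖phase q x y - 1‖ ≤ ‖q ‖x‖ - q ‖y‖‖ := by
  rw [phase, mul_comm]
  exact Real.norm_exp_I_mul_ofReal_sub_one_le

theorem curve_mem_model (τ : ℂ → ℝ) (z : ℂ) : (curve G q τ z, z) ∈ Model G q := by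
  rw [Model, mem_ofPred_eq, curve_mul_exp, phase_self]
  simp

theorem norm_curve (τ : ℂ → ℝ) (z : ℂ) : ‖curve G q τ z‖ = ‖Complex.I * τ z - G ‖z‖‖ := by
  rw [curve, norm_mul, Complex.norm_exp_ofReal_mul_I, one_mul]

theorem curve_isBigO {g : ℂ → ℝ} (hG : (fun z => G ‖z‖) =O[𝓝[≠] 0] g) (hτ : τ =O[𝓝[≠] 0] g) :
    curve G q τ =O[𝓝[≠] 0] g := by
  have h : (fun z => Complex.I * τ z - G ‖z‖) =O[𝓝[≠] 0] g :=
    ((hτ.norm_left.congr_left fun z => by simp).of_norm_left).sub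
      ((hG.norm_left.congr_left fun z => by simp).of_norm_left)
  exact (h.norm_left.congr_left fun z => (norm_curve τ z).symm).of_norm_left

theorem eventually_re_mul_multiplier (hW : Tendsto (curve G q τ) (𝓝[≠] 0) (𝓝 0))
    (hM : ∀ᶠ p in 𝓝 (0 : ℂ × ℂ), p ∈ Model G q → (p.1 * k p, f₂ p) ∈ Model G q) :
    ∀ᶠ z in 𝓝[≠] 0, ((Complex.I * τ z - G ‖z‖) * multiplier q k f₂ (curve G q τ z) z).re =
      -G ‖f₂ (curve G q τ z, z)‖ := by
  filter_upwards [(hW.prodMk_nhds (tendsto_id.mono_left nhdsWithin_le_nhds)).eventually hM]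
    with z hz
  have hmem := hz (curve_mem_model τ z)
  rw [Model, mem_ofPred_eq, mul_right_comm, id, curve_mul_exp] at hmem
  rw [multiplier, mul_comm (k _), ← mul_assoc]
  exact eq_neg_of_add_eq_zero_left hmem

namespace Profile

theorem curve_isBigO (H : Profile G q) {n : ℕ} (hτ : τ =O[𝓝[≠] 0] fun z => ‖z‖ ^ n) :
    curve G q τ =O[𝓝[≠] 0] fun z => ‖z‖ ^ n :=
  InfiniteType.curve_isBigO (H.isFlat_G_norm n) hτ

theorem phase_sub_one_isBigO (H : Profile G q) {x y : ℂ → ℂ}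
    (hx : Tendsto x (𝓝[≠] 0) (𝓝 0)) (hy : Tendsto y (𝓝[≠] 0) (𝓝 0)) :
    (fun z => phase q (x z) (y z) - 1) =O[𝓝[≠] 0] fun z => ‖x z‖ - ‖y z‖ :=
  (isBigO_of_le _ fun _ => norm_phase_sub_one_le _ _).trans (H.q_norm_sub_isBigO hx hy)

theorem tendsto_phase (H : Profile G q) {x y : ℂ → ℂ}
    (hx : Tendsto x (𝓝[≠] 0) (𝓝 0)) (hy : Tendsto y (𝓝[≠] 0) (𝓝 0)) :
    Tendsto (fun z => phase q (x z) (y z)) (𝓝[≠] 0) (𝓝 1) := by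
  have h : Tendsto (fun z => ‖x z‖ - ‖y z‖) (𝓝[≠] 0) (𝓝 0) := by simpa using hx.norm.sub hy.norm
  simpa using ((H.phase_sub_one_isBigO hx hy).trans_tendsto h).add_const 1

theorem multiplier_sub_isBigO (H : Profile G q) (hk : IsSepHolo k) (hf₂ : IsSepHolo f₂)
    (h₂ : f₂ 0 = 0) {W : ℂ → ℂ} (hW : Tendsto W (𝓝[≠] 0) (𝓝 0)) :
    (fun z => multiplier q k f₂ (W z) z - multiplier q k f₂ 0 z) =O[𝓝[≠] 0] W := by
  have hk' : (fun z => (k (W z, z) - k (0, z)) * phase q z (f₂ (W z, z))) =O[𝓝[≠] 0] W :=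
    (hk.sub_isBigO hW).norm_left.congr_left (fun z => by simp [norm_phase]) |>.of_norm_left
  have hphase : (fun z => phase q (f₂ (0, z)) (f₂ (W z, z)) - 1) =O[𝓝[≠] 0] W := by
    refine (H.phase_sub_one_isBigO (h₂ ▸ hf₂.tendsto_zero_left) (h₂ ▸ hf₂.tendsto hW)).trans ?_
    refine IsBigO.trans (isBigO_of_le _ fun z => ?_) (hf₂.sub_isBigO hW)
    rw [norm_sub_rev (f₂ _)]
    exact abs_norm_sub_norm_le _ _
  have hbdd : (fun z => k (0, z) * phase q z (f₂ (0, z))) =O[𝓝[≠] 0] fun _ => (1 : ℝ) :=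
    (hk.isBigO_one tendsto_const_nhds).norm_left.congr_left
      (fun z => by simp [norm_phase]) |>.of_norm_left
  have hmul := hbdd.norm_right.mul hphase.norm_right
  simp only [norm_one, one_mul] at hmul
  refine (hk'.add hmul.of_norm_right).congr_left fun z => ?_
  rw [multiplier, multiplier, ← phase_mul_phase z (f₂ (0, z)) (f₂ (W z, z))]
  ring

theorem tendsto_multiplier (H : Profile G q) (hk : IsSepHolo k) (hf₂ : IsSepHolo f₂)
    (h₂ : f₂ 0 = 0) {W : ℂ → ℂ} (hW : Tendsto W (𝓝[≠] 0) (𝓝 0)) :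
    Tendsto (fun z => multiplier q k f₂ (W z) z) (𝓝[≠] 0) (𝓝 (k 0)) := by
  simpa [multiplier] using (hk.tendsto hW).mul
    (H.tendsto_phase (tendsto_id.mono_left nhdsWithin_le_nhds) (h₂ ▸ hf₂.tendsto hW))

theorem isBigO_norm_curve (H : Profile G q) (hf₂ : IsSepHolo f₂) (h₂ : f₂ 0 = 0)
    (hτ : τ =O[𝓝[≠] 0] fun z => ‖z‖) :
    (fun z => f₂ (curve G q τ z, z)) =O[𝓝[≠] 0] fun z => ‖z‖ := by
  have hW : curve G q τ =O[𝓝[≠] 0] fun z => ‖z‖ := by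
    simpa using H.curve_isBigO (n := 1) (by simpa using hτ)
  simpa using ((hf₂.sub_isBigO (hW.trans_tendsto tendsto_norm_nhdsNE_nhds_zero)).trans hW).add
    (hf₂.isBigO_norm_zero_left h₂)

theorem eventually_fst_eq_zero (H : Profile G q) (hf₁ : IsSepHolo f₁) (hf₂ : IsSepHolo f₂)
    (h₁ : f₁ 0 = 0) (h₂ : f₂ 0 = 0)
    (hM : ∀ᶠ p in 𝓝 (0 : ℂ × ℂ), p ∈ Model G q → (f₁ p, f₂ p) ∈ Model G q) :
    ∀ᶠ z in 𝓝 0, f₁ (0, z) = 0 := by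
  set W := curve G q fun _ => 0
  have hW : IsFlat W := fun n => H.curve_isBigO (isBigO_zero _ _)
  set E : ℂ → ℂ := fun z => phase q 0 (f₂ (W z, z)) with hE
  have hE1 : Tendsto E (𝓝[≠] 0) (𝓝 1) :=
    H.tendsto_phase tendsto_const_nhds (h₂ ▸ hf₂.tendsto hW.tendsto_zero)
  have hre : ∀ᶠ z in 𝓝[≠] 0, (f₁ (W z, z) * E z).re = -G ‖f₂ (W z, z)‖ := by
    filter_upwards [(hW.tendsto_zero.prodMk_nhds
      (tendsto_id.mono_left nhdsWithin_le_nhds)).eventually hM] with z hz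
    have hmem := hz (curve_mem_model _ z)
    rw [Model, mem_ofPred_eq] at hmem
    simpa [hE, phase, H.q_zero] using eq_neg_of_add_eq_zero_left hmem
  have hdiff : IsFlat fun z => ((f₁ (W z, z) - f₁ (0, z)) * E z).re :=
    ((hW.of_isBigO (hf₁.sub_isBigO hW.tendsto_zero)).mul_isBigO_one (hE1.isBigO_one ℝ)).of_isBigO
      (isBigO_of_le _ fun z => Complex.abs_re_le_norm _)
  have hflat : IsFlat fun z => (f₁ (0, z) * E z).re := by
    refine ((H.isFlat_G_norm_comp
      (H.isBigO_norm_curve hf₂ h₂ (isBigO_zero _ _))).neg.sub hdiff).congr' ?_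
    filter_upwards [hre] with z hz
    rw [← hz, sub_mul, Complex.sub_re, sub_sub_cancel]
  have hf : IsFlat fun z => f₁ (0, z) := fun n =>
    isBigO_of_re_mul_isBigO hf₁.analyticAt h₁ hE1 one_ne_zero (hflat n)
  exact hf.eventually_eq_zero hf₁.analyticAt

/-- On the points of the model with `Im (w e ^ {-i q(|z|)}) = |z| ^ n`, which is much larger than
`G(|z|)`, the equation of the model forces the multiplier to be real up to a flat error. -/
theorem isFlat_im_multiplier (H : Profile G q) (hk : IsSepHolo k) (hf₂ : IsSepHolo f₂)
    (h₂ : f₂ 0 = 0)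
    (hM : ∀ᶠ p in 𝓝 (0 : ℂ × ℂ), p ∈ Model G q → (p.1 * k p, f₂ p) ∈ Model G q) :
    IsFlat fun z => (multiplier q k f₂ 0 z).im := by
  suffices h : ∀ n : ℕ, (fun z => (multiplier q k f₂ 0 z).im) =O[𝓝[≠] 0] fun z => ‖z‖ ^ (n + 1) from
    fun n => (h n).trans (norm_pow_isBigO n.le_succ)
  intro n
  set τ : ℂ → ℝ := fun z => ‖z‖ ^ (n + 1)
  have hτ : τ =O[𝓝[≠] 0] fun z => ‖z‖ := by simpa using norm_pow_isBigO (Nat.le_add_left 1 n)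
  set W := curve G q τ
  have hW : W =O[𝓝[≠] 0] τ := H.curve_isBigO (isBigO_refl _ _)
  have hW0 : Tendsto W (𝓝[≠] 0) (𝓝 0) :=
    hW.trans_tendsto (hτ.trans_tendsto tendsto_norm_nhdsNE_nhds_zero)
  have hre : (fun z => (multiplier q k f₂ (W z) z).re) =O[𝓝[≠] 0] fun _ => (1 : ℝ) :=
    (isBigO_of_le _ fun z => Complex.abs_re_le_norm _).trans
      ((H.tendsto_multiplier hk hf₂ h₂ hW0).isBigO_one ℝ)
  have him : IsFlat fun z => (multiplier q k f₂ (W z) z).im := by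
    refine .of_pow_mul (m := n + 1) <| ((H.isFlat_G_norm_comp
      (H.isBigO_norm_curve hf₂ h₂ hτ)).sub (H.isFlat_G_norm.mul_isBigO_one hre)).congr' ?_
    filter_upwards [eventually_re_mul_multiplier hW0 hM] with z hz
    simp only [Complex.mul_re, Complex.sub_re, Complex.sub_im, Complex.I_re, Complex.I_im,
      Complex.ofReal_re, Complex.ofReal_im, Complex.mul_im] at hz
    linarith
  have hdiff : (fun z => (multiplier q k f₂ (W z) z - multiplier q k f₂ 0 z).im) =O[𝓝[≠] 0] τ :=
    (isBigO_of_le _ fun z => Complex.abs_im_le_norm _).trans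
      ((H.multiplier_sub_isBigO hk hf₂ h₂ hW0).trans hW)
  exact ((him (n + 1)).sub hdiff).congr_left fun z => by rw [Complex.sub_im, sub_sub_cancel]

end Profile

end Model

section RadialScaling

theorem IsFlat.tendsto_div_pow {u : ℂ → ℂ} (hu : IsFlat u) (n : ℕ) :
    Tendsto (fun z => u z / z ^ n) (𝓝[≠] 0) (𝓝 0) := by
  have h : u =o[𝓝[≠] 0] fun z => z ^ n :=
    (((hu (n + 1)).trans_isLittleO (norm_pow_isLittleO n.lt_succ_self)).congr_right
      fun z => (norm_pow z n).symm).of_norm_right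
  exact h.tendsto_div_nhds_zero

theorem norm_ofReal_mul {d : ℂ} {s : ℝ} (hs : 0 < s) (hd : ‖d‖ = 1) : ‖(s : ℂ) * d‖ = s := by
  rw [norm_mul, hd, mul_one, Complex.norm_of_nonneg hs.le]

theorem exists_one_add_mul_le_pow {c : ℝ} (hc : 0 < c) (C : ℝ) :
    ∃ K : ℕ, ∀ x, 0 ≤ x → 1 + C * x ≤ (1 + c * x) ^ K := by
  obtain ⟨K, hK⟩ := exists_nat_ge (C / c)
  rw [div_le_iff₀ hc] at hK
  refine ⟨K, fun x hx => ?_⟩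
  have hcx : 0 ≤ c * x := mul_nonneg hc.le hx
  calc 1 + C * x ≤ 1 + K * c * x := by gcongr
    _ = 1 + K * (c * x) := by ring
    _ ≤ (1 + c * x) ^ K := one_add_mul_le_pow (by linarith) K

theorem tendsto_const_mul_pow_nhdsGT (C : ℝ) {m : ℕ} (hm : m ≠ 0) :
    Tendsto (fun s : ℝ => C * s ^ m) (𝓝[>] 0) (𝓝 0) := by
  have h : Continuous fun s : ℝ => C * s ^ m := by fun_prop
  simpa [hm] using (h.tendsto 0).mono_left nhdsWithin_le_nhds

theorem exists_tendsto_sub_deriv_mul_div_pow {h : ℂ → ℂ} (hh : AnalyticAt ℂ h 0) (h0 : h 0 = 0)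
    (hne : ¬ ∀ᶠ z in 𝓝 0, h z = deriv h 0 * z) :
    ∃ m ≠ 0, ∃ v₀ ≠ 0,
      Tendsto (fun z => (h z - deriv h 0 * z) / z ^ (m + 1)) (𝓝[≠] 0) (𝓝 v₀) := by
  set u : ℂ → ℂ := fun z => dslope h 0 z - deriv h 0
  have hu : AnalyticAt ℂ u 0 := by
    obtain ⟨p, hp⟩ := hh
    exact AnalyticAt.sub ⟨_, hp.has_fpower_series_dslope_fslope⟩ analyticAt_const
  have hhu : ∀ z, h z - deriv h 0 * z = z * u z := fun z => by
    have hs := sub_smul_dslope h 0 z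
    rw [sub_zero, smul_eq_mul, h0, sub_zero] at hs
    rw [← hs]
    ring
  have hord : analyticOrderAt u 0 ≠ ⊤ := by
    refine mt analyticOrderAt_eq_top.1 fun hz => hne ?_
    filter_upwards [hz] with z hz
    rw [← sub_eq_zero, hhu, hz, mul_zero]
  obtain ⟨v, hv, hv0, huv⟩ := hu.analyticOrderAt_ne_top.1 hord
  simp only [sub_zero, smul_eq_mul] at huv
  refine ⟨analyticOrderNatAt u 0, fun hm => hv0 ?_, v 0, hv0, ?_⟩
  · simpa [hm, u] using huv.self_of_nhds.symm
  · refine (hv.continuousAt.tendsto.mono_left nhdsWithin_le_nhds).congr' ?_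
    filter_upwards [huv.filter_mono nhdsWithin_le_nhds, self_mem_nhdsWithin] with z hz (hz0 : z ≠ 0)
    rw [hhu, hz, pow_succ]
    field_simp

/-- A map `y` of a neighbourhood of the origin that multiplies the function `G(|z|)` by a factor
`ρ` with a positive limit `κ` at the origin. -/
structure RadialScaling (G : ℝ → ℝ) (y : ℂ → ℂ) (ρ : ℂ → ℝ) (κ : ℝ) : Prop where
  continuousAt : ∀ᶠ z in 𝓝 0, ContinuousAt y z
  map_zero : y 0 = 0
  tendsto : Tendsto ρ (𝓝[≠] 0) (𝓝 κ)
  limit_pos : 0 < κ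
  scaling : ∀ᶠ z in 𝓝[≠] 0, ρ z * G ‖z‖ = G ‖y z‖

namespace RadialScaling

variable {G q : ℝ → ℝ} {y : ℂ → ℂ} {ρ : ℂ → ℝ} {κ c C : ℝ} {b d : ℂ} {m : ℕ}

theorem eventually_scaling_ray (A : RadialScaling G y ρ κ) (hd : ‖d‖ = 1) :
    ∀ᶠ s : ℝ in 𝓝[>] 0, ρ (s * d) * G s = G ‖y (s * d)‖ ∧ 0 < ρ (s * d) := by
  filter_upwards [(tendsto_ofReal_mul_nhdsGT hd).eventually
    (A.scaling.and (A.tendsto.eventually (lt_mem_nhds A.limit_pos))), self_mem_nhdsWithin]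
    with s ⟨hsc, hpos⟩ (hs : 0 < s)
  rw [norm_ofReal_mul hs hd] at hsc
  exact ⟨hsc, hpos⟩

theorem not_inward (A : RadialScaling G y ρ κ) (H : Profile G q) (hd : ‖d‖ = 1) (hc : 0 < c)
    (hy : ∀ᶠ s : ℝ in 𝓝[>] 0, (1 + c * s ^ m) * ‖y (s * d)‖ ≤ s)
    (hρ : ∀ᶠ s : ℝ in 𝓝[>] 0, 1 ≤ (1 + C * s ^ m) * ρ (s * d)) : False := by
  obtain ⟨K, hK⟩ := exists_one_add_mul_le_pow hc C
  refine H.not_contracting (Y := fun s => ‖y (s * d)‖) (l := fun s => 1 + c * s ^ m) K ?_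
  filter_upwards [hy, hρ, A.eventually_scaling_ray hd, H.G_pos, self_mem_nhdsWithin]
    with s hys hρs ⟨hsc, hpos⟩ hG (hs : 0 < s)
  refine ⟨lt_add_of_pos_right _ (by positivity), norm_pos_iff.2 fun h0 => ?_, hys, ?_⟩
  · rw [h0, norm_zero, H.G_zero] at hsc
    exact (mul_pos hpos hG).ne' hsc
  · rw [← hsc, ← mul_assoc]
    refine le_mul_of_one_le_left hG.le (hρs.trans ?_)
    gcongr
    exact hK _ (by positivity)

theorem eventually_continuousOn_ray (A : RadialScaling G y ρ κ) (hd : ‖d‖ = 1) :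
    ∀ᶠ s : ℝ in 𝓝[>] 0, ContinuousOn (fun t : ℝ => ‖y (t * d)‖) (Icc 0 s) := by
  obtain ⟨r, hr, hc⟩ := Metric.eventually_nhds_iff_ball.1 A.continuousAt
  filter_upwards [Ioo_mem_nhdsGT hr] with s hs t ht
  refine ContinuousAt.continuousWithinAt (ContinuousAt.norm ?_)
  refine ContinuousAt.comp (f := fun t : ℝ => (t : ℂ) * d) (hc _ ?_) (by fun_prop)
  rw [mem_ball_zero_iff, norm_mul, hd, mul_one, Complex.norm_of_nonneg ht.1]
  exact ht.2.trans_lt hs.2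

theorem not_outward (A : RadialScaling G y ρ κ) (H : Profile G q) (hd : ‖d‖ = 1) (hc : 0 < c)
    (hy : ∀ᶠ s : ℝ in 𝓝[>] 0, (1 + c * s ^ m) * s ≤ ‖y (s * d)‖)
    (hρ : ∀ᶠ s : ℝ in 𝓝[>] 0, ρ (s * d) ≤ 1 + C * s ^ m) : False := by
  obtain ⟨K, hK⟩ := exists_one_add_mul_le_pow hc C
  refine H.not_expanding (Y := fun s => ‖y (s * d)‖) (l := fun s => 1 + c * s ^ m) K
    (A.eventually_continuousOn_ray hd) (by simp [A.map_zero]) ?_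
  filter_upwards [hy, hρ, A.eventually_scaling_ray hd, H.G_pos, self_mem_nhdsWithin]
    with s hys hρs ⟨hsc, _⟩ hG (hs : 0 < s)
  refine ⟨lt_add_of_pos_right _ (by positivity), hys, ?_⟩
  rw [← hsc]
  gcongr
  exact hρs.trans (hK _ (by positivity))

/-- A linear part that is not an isometry would let `G` decrease by a bounded factor only while the
radius decreases geometrically. -/
theorem norm_eq_one (A : RadialScaling G y ρ κ) (H : Profile G q)
    (hb : Tendsto (fun z => y z / z) (𝓝[≠] 0) (𝓝 b)) : ‖b‖ = 1 := by
  have hd : ‖(1 : ℂ)‖ = 1 := norm_one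
  have hray := tendsto_ofReal_mul_nhdsGT hd
  have hy : Tendsto (fun s : ℝ => ‖y (s * 1)‖ / s) (𝓝[>] 0) (𝓝 ‖b‖) := by
    refine (hb.comp hray).norm.congr' ?_
    filter_upwards [self_mem_nhdsWithin] with s (hs : 0 < s)
    rw [Function.comp_apply, norm_div, norm_ofReal_mul hs hd]
  have hρ := A.tendsto.comp hray
  have hκ := A.limit_pos
  rcases lt_trichotomy ‖b‖ 1 with hlt | heq | hgt
  · obtain ⟨r, hr, hr1⟩ := exists_between hlt
    have hr0 : 0 < r := (norm_nonneg b).trans_lt hr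
    refine (A.not_inward (m := 0) (c := r⁻¹ - 1) (C := (κ / 2)⁻¹) H hd
      (sub_pos.2 ((one_lt_inv₀ hr0).2 hr1)) ?_ ?_).elim
    · filter_upwards [hy.eventually (gt_mem_nhds hr), self_mem_nhdsWithin] with s hys (hs : 0 < s)
      rw [div_lt_iff₀ hs] at hys
      rw [pow_zero, mul_one, add_sub_cancel, inv_mul_le_iff₀ hr0]
      exact hys.le
    · filter_upwards [hρ.eventually (lt_mem_nhds (half_lt_self hκ))] with s hs
      calc 1 = (κ / 2)⁻¹ * (κ / 2) := (inv_mul_cancel₀ (half_pos hκ).ne').symm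
        _ ≤ (1 + (κ / 2)⁻¹ * s ^ 0) * ρ (s * 1) := by
          rw [pow_zero, mul_one]
          exact mul_le_mul (by linarith) hs.le (by positivity) (by positivity)
  · exact heq
  · obtain ⟨r, hr1, hr⟩ := exists_between hgt
    refine (A.not_outward (m := 0) (c := r - 1) (C := κ) H hd (sub_pos.2 hr1) ?_ ?_).elim
    · filter_upwards [hy.eventually (lt_mem_nhds hr), self_mem_nhdsWithin] with s hys (hs : 0 < s)
      rw [lt_div_iff₀ hs] at hys
      rw [pow_zero, mul_one, add_sub_cancel]
      exact hys.le
    · filter_upwards [hρ.eventually (gt_mem_nhds (lt_one_add κ))] with s hs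
      simpa using hs.le

theorem tendsto_norm_ray_sub_div {v₀ : ℂ} {a : ℝ} (hb : ‖b‖ = 1) (hd : ‖d‖ = 1) (hm : m ≠ 0)
    (hy : Tendsto (fun z => (y z - b * z) / (b * z ^ (m + 1))) (𝓝[≠] 0) (𝓝 v₀))
    (hdv : d ^ m * v₀ = a) :
    Tendsto (fun s : ℝ => (‖y (s * d)‖ - s) / (s * s ^ m)) (𝓝[>] 0) (𝓝 a) := by
  set w : ℝ → ℂ := fun s => d ^ m * ((y (s * d) - b * (s * d)) / (b * (s * d) ^ (m + 1)))
  have hw : Tendsto w (𝓝[>] 0) (𝓝 a) :=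
    hdv ▸ (hy.comp (tendsto_ofReal_mul_nhdsGT hd)).const_mul (d ^ m)
  rw [tendsto_iff_norm_sub_tendsto_zero] at hw ⊢
  refine squeeze_zero' (.of_forall fun s => norm_nonneg _) ?_ hw
  filter_upwards [self_mem_nhdsWithin, (tendsto_const_mul_pow_nhdsGT a hm).eventually
    (lt_mem_nhds neg_one_lt_zero)] with s (hs : 0 < s) hs1
  have hb0 : b ≠ 0 := norm_ne_zero_iff.1 (hb.symm ▸ one_ne_zero)
  have hd0 : d ≠ 0 := norm_ne_zero_iff.1 (hd.symm ▸ one_ne_zero)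
  have hs0 : (s : ℂ) ≠ 0 := Complex.ofReal_ne_zero.2 hs.ne'
  have hys : y (s * d) = b * (s * d) * (1 + (s ^ m : ℝ) * w s) := by
    simp only [w]
    push_cast
    field_simp
    ring
  have hnorm : ‖y (s * d)‖ = s * ‖1 + (s ^ m : ℝ) * w s‖ := by
    rw [hys, norm_mul, norm_mul, hb, one_mul, norm_ofReal_mul hs hd]
  have hreal : ‖(1 + (s ^ m : ℝ) * (a : ℂ))‖ = 1 + a * s ^ m := by
    rw [← Complex.ofReal_mul, ← Complex.ofReal_one, ← Complex.ofReal_add, mul_comm,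
      Complex.norm_of_nonneg (by linarith)]
  have hdist : |‖1 + (s ^ m : ℝ) * w s‖ - (1 + a * s ^ m)| ≤ s ^ m * ‖w s - a‖ := by
    rw [← hreal]
    refine (abs_norm_sub_norm_le _ _).trans_eq ?_
    rw [add_sub_add_left_eq_sub, ← mul_sub, norm_mul, Complex.norm_of_nonneg (by positivity)]
  have hrw : (‖y (s * d)‖ - s) / (s * s ^ m) - a =
      (‖1 + (s ^ m : ℝ) * w s‖ - (1 + a * s ^ m)) / s ^ m := by
    rw [hnorm]
    field_simp
    ring
  rw [hrw, norm_div, Real.norm_eq_abs, Real.norm_of_nonneg (by positivity),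
    div_le_iff₀ (by positivity)]
  exact hdist.trans_eq (mul_comm _ _)

theorem not_tendsto_of_one_le_limit (A : RadialScaling G y ρ κ) (H : Profile G q) {v₀ : ℂ}
    (hb : ‖b‖ = 1) (hm : m ≠ 0) (hv₀ : v₀ ≠ 0) (hκ : 1 ≤ κ) (hC : 0 ≤ C)
    (hρ : ∀ᶠ z in 𝓝[≠] 0, |ρ z - κ| ≤ C * ‖z‖ ^ m) :
    ¬ Tendsto (fun z => (y z - b * z) / (b * z ^ (m + 1))) (𝓝[≠] 0) (𝓝 v₀) := by
  intro hy
  have hv : 0 < ‖v₀‖ := norm_pos_iff.2 hv₀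
  obtain ⟨d, hd, hdv⟩ := exists_norm_eq_one_pow_mul_eq_norm (-v₀) hm
  have hlim := tendsto_norm_ray_sub_div (a := -‖v₀‖) hb hd hm hy
    (by rw [norm_neg, mul_neg] at hdv; rw [Complex.ofReal_neg, ← hdv, neg_neg])
  refine A.not_inward (m := m) (C := 2 * C) H hd (half_pos hv) ?_ ?_
  · filter_upwards [hlim.eventually (gt_mem_nhds (neg_lt_neg (half_lt_self hv))),
      self_mem_nhdsWithin] with s hs (hs0 : 0 < s)
    rw [div_lt_iff₀ (by positivity)] at hs
    calc (1 + ‖v₀‖ / 2 * s ^ m) * ‖y (s * d)‖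
        ≤ (1 + ‖v₀‖ / 2 * s ^ m) * (s * (1 - ‖v₀‖ / 2 * s ^ m)) := by gcongr; linarith
      _ = s - s * (‖v₀‖ / 2 * s ^ m) ^ 2 := by ring
      _ ≤ s := sub_le_self _ (by positivity)
  · filter_upwards [(tendsto_ofReal_mul_nhdsGT hd).eventually hρ, self_mem_nhdsWithin,
      (tendsto_const_mul_pow_nhdsGT C hm).eventually (gt_mem_nhds one_half_pos)]
      with s hs (hs0 : 0 < s) hs2
    rw [norm_ofReal_mul hs0 hd] at hs
    have hx : 0 ≤ C * s ^ m := by positivity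
    calc (1 : ℝ) ≤ (1 + 2 * (C * s ^ m)) * (1 - C * s ^ m) := by nlinarith
      _ ≤ (1 + 2 * C * s ^ m) * ρ (s * d) := by
        rw [mul_assoc]
        gcongr
        linarith [(abs_le.1 hs).1]

theorem not_tendsto_of_limit_le_one (A : RadialScaling G y ρ κ) (H : Profile G q) {v₀ : ℂ}
    (hb : ‖b‖ = 1) (hm : m ≠ 0) (hv₀ : v₀ ≠ 0) (hκ : κ ≤ 1)
    (hρ : ∀ᶠ z in 𝓝[≠] 0, |ρ z - κ| ≤ C * ‖z‖ ^ m) :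
    ¬ Tendsto (fun z => (y z - b * z) / (b * z ^ (m + 1))) (𝓝[≠] 0) (𝓝 v₀) := by
  intro hy
  have hv : 0 < ‖v₀‖ := norm_pos_iff.2 hv₀
  obtain ⟨d, hd, hdv⟩ := exists_norm_eq_one_pow_mul_eq_norm v₀ hm
  have hlim := tendsto_norm_ray_sub_div hb hd hm hy hdv
  refine A.not_outward (m := m) (C := C) H hd (half_pos hv) ?_ ?_
  · filter_upwards [hlim.eventually (lt_mem_nhds (half_lt_self hv)), self_mem_nhdsWithin]
      with s hs (hs0 : 0 < s)
    rw [lt_div_iff₀ (by positivity)] at hs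
    linarith
  · filter_upwards [(tendsto_ofReal_mul_nhdsGT hd).eventually hρ, self_mem_nhdsWithin]
      with s hs (hs0 : 0 < s)
    rw [norm_ofReal_mul hs0 hd] at hs
    linarith [(abs_le.1 hs).2]

/-- A displacement of order `m + 1` moves some direction inwards and another one outwards; the flat
function `G` cannot follow at least one of them, depending on the sign of `κ - 1`. -/
theorem not_tendsto_sub_div_pow (A : RadialScaling G y ρ κ) (H : Profile G q) {v₀ : ℂ}
    (hb : ‖b‖ = 1) (hm : m ≠ 0) (hv₀ : v₀ ≠ 0)
    (hρ : (fun z => ρ z - κ) =O[𝓝[≠] 0] fun z => ‖z‖ ^ m) :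
    ¬ Tendsto (fun z => (y z - b * z) / (b * z ^ (m + 1))) (𝓝[≠] 0) (𝓝 v₀) := by
  obtain ⟨C, hC0, hC⟩ := hρ.exists_pos
  have hρC : ∀ᶠ z in 𝓝[≠] 0, |ρ z - κ| ≤ C * ‖z‖ ^ m := by simpa using hC.bound
  rcases le_total 1 κ with hκ | hκ
  · exact A.not_tendsto_of_one_le_limit H hb hm hv₀ hκ hC0.le hρC
  · exact A.not_tendsto_of_limit_le_one H hb hm hv₀ hκ hρC

theorem limit_eq_one (A : RadialScaling G y ρ κ) (H : Profile G q) (hb : ‖b‖ = 1)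
    (hy : (fun z => y z - b * z) =O[𝓝[≠] 0] fun z => G ‖z‖) : κ = 1 := by
  have hyG : (fun z => ‖y z‖ - ‖z‖) =O[𝓝[≠] 0] fun z => G ‖z‖ := by
    refine (isBigO_of_le _ fun z => ?_).trans hy
    simpa [hb] using abs_norm_sub_norm_le (y z) (b * z)
  have hsmall : ∀ᶠ z in 𝓝[≠] 0, |‖y z‖ - ‖z‖| ≤ ‖z‖ := by
    have ho := (hyG.trans (H.isFlat_G_norm 2)).trans_isLittleO (norm_pow_isLittleO one_lt_two)
    filter_upwards [ho.bound one_pos] with z hz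
    simpa using hz
  have htaylor : (fun z => G ‖y z‖ - G ‖z‖ - deriv G ‖z‖ * (‖y z‖ - ‖z‖)) =O[𝓝[≠] 0]
      fun z => (‖y z‖ - ‖z‖) ^ 2 := by
    refine IsBigO.of_bound 1 ?_
    filter_upwards [tendsto_norm_nhdsNE_zero.eventually (H.G_taylor 0), hsmall] with z hT hz
    simpa using hT _ hz
  have hdiff : (fun z => (ρ z - 1) * G ‖z‖) =O[𝓝[≠] 0]
      fun z => (‖G ‖z‖‖ + ‖deriv G ‖z‖‖) * G ‖z‖ := by
    have h₁ : (fun z : ℂ => G ‖z‖ ^ 2) =O[𝓝[≠] 0] fun z => (‖G ‖z‖‖ + ‖deriv G ‖z‖‖) * G ‖z‖ := by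
      simp only [pow_two]
      exact (isBigO_of_le _ fun z => (le_add_of_nonneg_right (norm_nonneg _)).trans
        (le_abs_self _)).mul (isBigO_refl _ _)
    have h₂ := (isBigO_of_le (𝓝[≠] 0) fun z : ℂ => (le_add_of_nonneg_left (a := ‖deriv G ‖z‖‖)
      (norm_nonneg (G ‖z‖))).trans (le_abs_self _)).mul hyG
    refine (((htaylor.trans (hyG.pow 2)).trans h₁).add h₂).congr' ?_ .rfl
    filter_upwards [A.scaling] with z hz
    rw [← hz]
    ring
  have hone : Tendsto (fun z => ρ z - 1) (𝓝[≠] 0) (𝓝 0) := by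
    refine IsBigO.trans_tendsto (g'' := fun z : ℂ => ‖G ‖z‖‖ + ‖deriv G ‖z‖‖) ?_ ?_
    · refine (hdiff.mul (isBigO_refl (fun z : ℂ => (G ‖z‖)⁻¹) (𝓝[≠] 0))).congr' ?_ ?_
      all_goals
        filter_upwards [H.eventually_G_norm_pos] with z hz
        rw [mul_assoc, mul_inv_cancel₀ hz.ne', mul_one]
    · simpa using H.isFlat_G_norm.tendsto_zero.norm.add H.isFlat_deriv_G_norm.tendsto_zero.norm
  exact sub_eq_zero.1 (tendsto_nhds_unique (A.tendsto.sub_const 1) hone)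

end RadialScaling

end RadialScaling

section InvariantCurve

variable {G q : ℝ → ℝ} {f₂ k : ℂ × ℂ → ℂ}

theorem curve_zero_isBigO : curve G q (fun _ => 0) =O[𝓝[≠] 0] fun z => G ‖z‖ :=
  curve_isBigO (isBigO_refl _ _) (isBigO_zero _ _)

theorem norm_sub_norm_isBigO {h : ℂ → ℂ} {b : ℂ} (hb : ‖b‖ = 1) {n : ℕ}
    (hn : (fun z => h z - b * z) =O[𝓝[≠] 0] fun z => ‖z‖ ^ n) :
    (fun z => ‖z‖ - ‖h z‖) =O[𝓝[≠] 0] fun z => ‖z‖ ^ n := by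
  refine (isBigO_of_le _ fun z => ?_).trans hn
  rw [norm_sub_rev (h z)]
  simpa [hb] using abs_norm_sub_norm_le (b * z) (h z)

namespace Profile

theorem isBigO_multiplier_sub (H : Profile G q) (hk : IsSepHolo k) (hf₂ : IsSepHolo f₂)
    (h₂ : f₂ 0 = 0) (him : IsFlat fun z => (multiplier q k f₂ 0 z).im) {κ : ℝ} (hκ : k 0 = κ)
    {n : ℕ} (hn : (fun z => ‖z‖ - ‖f₂ (0, z)‖) =O[𝓝[≠] 0] fun z => ‖z‖ ^ n) :
    (fun z => k (0, z) - κ) =O[𝓝[≠] 0] (fun z => ‖z‖ ^ n) ∧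
      (fun z => multiplier q k f₂ 0 z - κ) =O[𝓝[≠] 0] fun z => ‖z‖ ^ n := by
  have hid : Tendsto id (𝓝[≠] (0 : ℂ)) (𝓝 0) := tendsto_id.mono_left nhdsWithin_le_nhds
  have h0 : Tendsto (fun z => f₂ (0, z)) (𝓝[≠] 0) (𝓝 0) := h₂ ▸ hf₂.tendsto_zero_left
  set E : ℂ → ℂ := fun z => phase q z (f₂ (0, z))
  have hE1 : Tendsto E (𝓝[≠] 0) (𝓝 1) := H.tendsto_phase hid h0
  have hE : (fun z => κ * (E z - 1)) =O[𝓝[≠] 0] fun z => ‖z‖ ^ n :=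
    ((H.phase_sub_one_isBigO hid h0).trans hn).const_mul_left _
  have hkn : (fun z => k (0, z) - κ) =O[𝓝[≠] 0] fun z => ‖z‖ ^ n := by
    refine isBigO_of_re_mul_isBigO (u := fun z => k (0, z) - κ)
      (E := fun z => -Complex.I * E z) (hk.analyticAt.sub analyticAt_const)
      (by rw [Prod.mk_zero_zero, hκ, sub_self]) (hE1.const_mul (-Complex.I)) (by simp) ?_
    refine ((him n).sub ((isBigO_of_le _ fun z => Complex.abs_im_le_norm _).trans hE)).congr_left
      fun z => ?_
    simp only [multiplier, E, Complex.mul_re, Complex.mul_im, Complex.sub_re, Complex.sub_im,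
      Complex.neg_re, Complex.neg_im, Complex.I_re, Complex.I_im, Complex.ofReal_re,
      Complex.ofReal_im, Complex.one_im]
    ring
  refine ⟨hkn, ?_⟩
  have hmul := hkn.norm_right.mul (hE1.isBigO_one ℝ)
  simp only [mul_one] at hmul
  refine (hmul.of_norm_right.add hE).congr_left fun z => ?_
  rw [multiplier]
  ring

theorem limit_multiplier_im_eq_zero (H : Profile G q) (hk : IsSepHolo k) (hf₂ : IsSepHolo f₂)
    (h₂ : f₂ 0 = 0) (him : IsFlat fun z => (multiplier q k f₂ 0 z).im) : (k 0).im = 0 :=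
  tendsto_nhds_unique ((Complex.continuous_im.tendsto _).comp
    (H.tendsto_multiplier hk hf₂ h₂ tendsto_const_nhds)) him.tendsto_zero

theorem continuousAt_curve_zero (H : Profile G q) :
    ∀ᶠ z in 𝓝 0, ContinuousAt (curve G q fun _ => 0) z := by
  filter_upwards [H.eventually_continuousAt_q_norm, H.eventually_continuousAt_G_norm] with z hq hG
  exact (hq.ofReal.mul tendsto_const_nhds).cexp.mul (tendsto_const_nhds.sub hG.ofReal)

theorem tendsto_curve_zero (H : Profile G q) :
    Tendsto (curve G q fun _ => 0) (𝓝[≠] 0) (𝓝 0) :=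
  curve_zero_isBigO.trans_tendsto H.isFlat_G_norm.tendsto_zero

theorem radialScaling (H : Profile G q) (hk : IsSepHolo k) (hf₂ : IsSepHolo f₂)
    (hc : ∀ᶠ p in 𝓝 0, ContinuousAt f₂ p) (h₂ : f₂ 0 = 0) (hk0 : k 0 ≠ 0)
    (hM : ∀ᶠ p in 𝓝 (0 : ℂ × ℂ), p ∈ Model G q → (p.1 * k p, f₂ p) ∈ Model G q) :
    RadialScaling G (fun z => f₂ (curve G q (fun _ => 0) z, z))
      (fun z => (multiplier q k f₂ (curve G q (fun _ => 0) z) z).re) (k 0).re := by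
  set W := curve G q fun _ => 0
  have hW : Tendsto W (𝓝[≠] 0) (𝓝 0) := H.tendsto_curve_zero
  have hW0 : W 0 = 0 := by simp [W, curve, H.G_zero]
  have hWc := H.continuousAt_curve_zero
  have hρ : Tendsto (fun z => (multiplier q k f₂ (W z) z).re) (𝓝[≠] 0) (𝓝 (k 0).re) :=
    (Complex.continuous_re.tendsto _).comp (H.tendsto_multiplier hk hf₂ h₂ hW)
  have hscaling : ∀ᶠ z in 𝓝[≠] 0,
      (multiplier q k f₂ (W z) z).re * G ‖z‖ = G ‖f₂ (W z, z)‖ := by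
    filter_upwards [eventually_re_mul_multiplier hW hM] with z hz
    simp only [Complex.ofReal_zero, mul_zero, zero_sub, neg_mul, Complex.neg_re,
      Complex.re_ofReal_mul, neg_inj] at hz
    rw [← hz, mul_comm]
  have hG : ∀ᶠ z in 𝓝[≠] 0, 0 ≤ G ‖f₂ (W z, z)‖ := by
    have hpos : ∀ᶠ z : ℂ in 𝓝 0, 0 ≤ G ‖z‖ := by
      refine (eventually_nhdsWithin_iff.1 H.eventually_G_norm_pos).mono fun z hz => ?_
      rcases eq_or_ne z 0 with rfl | h0
      · rw [norm_zero, H.G_zero]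
      · exact (hz h0).le
    exact (h₂ ▸ hf₂.tendsto hW : Tendsto (fun z => f₂ (W z, z)) _ (𝓝 0)).eventually hpos
  have hκ : 0 ≤ (k 0).re := ge_of_tendsto hρ <| by
    filter_upwards [hscaling, hG, H.eventually_G_norm_pos] with z hz hGz hGpos
    exact nonneg_of_mul_nonneg_left (hz ▸ hGz) hGpos
  have hreal := H.limit_multiplier_im_eq_zero hk hf₂ h₂ (H.isFlat_im_multiplier hk hf₂ h₂ hM)
  refine ⟨?_, by rw [hW0, Prod.mk_zero_zero, h₂], hρ,
    hκ.lt_of_ne fun h => hk0 (Complex.ext h.symm hreal), hscaling⟩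
  have hpair : Tendsto (fun z => (W z, z)) (𝓝 0) (𝓝 (0 : ℂ × ℂ)) := by
    have h := hWc.self_of_nhds.tendsto.prodMk_nhds (tendsto_id (x := 𝓝 (0 : ℂ)))
    rwa [show curve G q (fun _ => 0) 0 = 0 from hW0] at h
  filter_upwards [hWc, hpair.eventually hc] with z hWz hz
  exact ContinuousAt.comp (f := fun z => (W z, z)) hz (hWz.prodMk continuousAt_id)

theorem re_multiplier_sub_isBigO (H : Profile G q) (hk : IsSepHolo k) (hf₂ : IsSepHolo f₂)
    (h₂ : f₂ 0 = 0) (him : IsFlat fun z => (multiplier q k f₂ 0 z).im) {n : ℕ}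
    (hn : (fun z => ‖z‖ - ‖f₂ (0, z)‖) =O[𝓝[≠] 0] fun z => ‖z‖ ^ n) :
    (fun z => (multiplier q k f₂ (curve G q (fun _ => 0) z) z).re - (k 0).re) =O[𝓝[≠] 0]
      fun z => ‖z‖ ^ n := by
  have hκ : k 0 = (k 0).re :=
    Complex.ext rfl (by simpa using H.limit_multiplier_im_eq_zero hk hf₂ h₂ him)
  have hW : (fun z => multiplier q k f₂ (curve G q (fun _ => 0) z) z - multiplier q k f₂ 0 z)
      =O[𝓝[≠] 0] fun z => ‖z‖ ^ n :=
    (H.multiplier_sub_isBigO hk hf₂ h₂ H.tendsto_curve_zero).trans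
      (H.curve_isBigO (isBigO_zero _ _))
  refine (isBigO_of_le _ fun z => ?_).trans
    (hW.add (H.isBigO_multiplier_sub hk hf₂ h₂ him hκ hn).2)
  rw [sub_add_sub_cancel, ← Complex.ofReal_re (k 0).re, ← Complex.sub_re, Complex.ofReal_re]
  exact Complex.abs_re_le_norm _

theorem norm_deriv_eq_one (H : Profile G q) {y h : ℂ → ℂ} {ρ : ℂ → ℝ} {κ : ℝ}
    (A : RadialScaling G y ρ κ) (hh : DifferentiableAt ℂ h 0) (h0 : h 0 = 0)
    (hyh : IsFlat fun z => y z - h z) : ‖deriv h 0‖ = 1 := by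
  refine A.norm_eq_one H ?_
  have hlim := (hyh.tendsto_div_pow 1).add (hasDerivAt_iff_tendsto_slope.1 hh.hasDerivAt)
  rw [zero_add] at hlim
  refine hlim.congr fun z => ?_
  rw [slope_def_field, h0, sub_zero, sub_zero, pow_one, ← add_div, sub_add_cancel]

theorem eventually_eq_deriv_mul (H : Profile G q) (hk : IsSepHolo k) (hf₂ : IsSepHolo f₂)
    (h₂ : f₂ 0 = 0) (him : IsFlat fun z => (multiplier q k f₂ 0 z).im)
    (A : RadialScaling G (fun z => f₂ (curve G q (fun _ => 0) z, z))
      (fun z => (multiplier q k f₂ (curve G q (fun _ => 0) z) z).re) (k 0).re)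
    (hb : ‖deriv (fun z => f₂ (0, z)) 0‖ = 1) :
    ∀ᶠ z in 𝓝 0, f₂ (0, z) = deriv (fun z => f₂ (0, z)) 0 * z := by
  set h : ℂ → ℂ := fun z => f₂ (0, z)
  set b := deriv h 0
  by_contra hne
  obtain ⟨m, hm, v₀, hv₀, hlim⟩ := exists_tendsto_sub_deriv_mul_div_pow hf₂.analyticAt h₂ hne
  have hhm : (fun z => h z - b * z) =O[𝓝[≠] 0] fun z => ‖z‖ ^ m := by
    have hO := (hlim.isBigO_one ℝ).norm_left.mul (isBigO_refl (fun z : ℂ => ‖z‖ ^ (m + 1)) _)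
    refine IsBigO.trans (.of_norm_left (hO.congr' ?_ (.of_forall fun z => one_mul _)))
      (norm_pow_isBigO m.le_succ)
    filter_upwards [self_mem_nhdsWithin] with z (hz : z ≠ 0)
    rw [← norm_pow, ← norm_mul, div_mul_cancel₀ _ (pow_ne_zero _ hz)]
  refine A.not_tendsto_sub_div_pow H hb hm
    (div_ne_zero hv₀ (norm_ne_zero_iff.1 (hb.symm ▸ one_ne_zero)))
    (H.re_multiplier_sub_isBigO hk hf₂ h₂ him (norm_sub_norm_isBigO hb hhm)) ?_
  have hyh := H.isFlat_G_norm.of_isBigO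
    ((hf₂.sub_isBigO H.tendsto_curve_zero).trans curve_zero_isBigO)
  have hsum := ((hyh.tendsto_div_pow (m + 1)).add hlim).div_const b
  rw [zero_add] at hsum
  refine hsum.congr fun z => ?_
  rw [← add_div, sub_add_sub_cancel, div_div, mul_comm _ b]

theorem exists_eventually_eq_rotation (H : Profile G q) (hk : IsSepHolo k) (hf₂ : IsSepHolo f₂)
    (hc : ∀ᶠ p in 𝓝 0, ContinuousAt f₂ p) (h₂ : f₂ 0 = 0) (hk0 : k 0 ≠ 0)
    (hM : ∀ᶠ p in 𝓝 (0 : ℂ × ℂ), p ∈ Model G q → (p.1 * k p, f₂ p) ∈ Model G q) :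
    ∃ b : ℂ, ‖b‖ = 1 ∧ (∀ᶠ z in 𝓝 0, k (0, z) = 1) ∧ ∀ᶠ z in 𝓝 0, f₂ (0, z) = b * z := by
  have A := H.radialScaling hk hf₂ hc h₂ hk0 hM
  have him := H.isFlat_im_multiplier hk hf₂ h₂ hM
  have hκ : k 0 = (k 0).re :=
    Complex.ext rfl (by simpa using H.limit_multiplier_im_eq_zero hk hf₂ h₂ him)
  have hy := (hf₂.sub_isBigO H.tendsto_curve_zero).trans curve_zero_isBigO
  have hb := H.norm_deriv_eq_one A hf₂.analyticAt.differentiableAt h₂ (H.isFlat_G_norm.of_isBigO hy)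
  have hrot := H.eventually_eq_deriv_mul hk hf₂ h₂ him A hb
  set b := deriv (fun z => f₂ (0, z)) 0
  refine ⟨b, hb, ?_, hrot⟩
  have hrot' : (fun z => f₂ (0, z) - b * z) =ᶠ[𝓝[≠] 0] fun _ => 0 :=
    (hrot.mono fun z hz => sub_eq_zero.2 hz).filter_mono nhdsWithin_le_nhds
  have hk1 : k 0 = 1 := by
    rw [hκ, A.limit_eq_one H hb ((hy.add (hrot'.trans_isBigO (isBigO_zero _ _))).congr_left
      fun z => sub_add_sub_cancel _ _ _), Complex.ofReal_one]
  have hflat : IsFlat fun z => k (0, z) - 1 := fun n => by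
    have := (H.isBigO_multiplier_sub hk hf₂ h₂ him hκ (n := n)
      (norm_sub_norm_isBigO hb (hrot'.trans_isBigO (isBigO_zero _ _)))).1
    rwa [← hκ, hk1] at this
  exact (hflat.eventually_eq_zero (hk.analyticAt.sub analyticAt_const)).mono fun z =>
    sub_eq_zero.1

end Profile

end InvariantCurve

section Pencil

open Polynomial ComplexConjugate

variable {K Λ : ℂ → ℂ} {γ κ : ℂ → ℝ} {j : ℕ}

theorem isFlat_eval_of_forall_ofReal {P : ℂ → ℂ[X]} {N : ℕ} (hdeg : ∀ z, (P z).natDegree ≤ N)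
    (h : ∀ x : ℝ, IsFlat fun z => (P z).eval (x : ℂ)) (ζ : ℂ) : IsFlat fun z => (P z).eval ζ := by
  have hP : ∀ z, (P z).eval ζ = ∑ i ∈ Finset.range (N + 1), (P z).eval ((i : ℝ) : ℂ) *
      (Lagrange.basis (Finset.range (N + 1)) (fun i : ℕ => ((i : ℝ) : ℂ)) i).eval ζ := by
    intro z
    conv_lhs => rw [Lagrange.eq_interpolate (v := fun i : ℕ => ((i : ℝ) : ℂ))
      (s := Finset.range (N + 1)) (f := P z)
      (fun i _ j _ hij => by simpa using hij)
      ((degree_le_of_natDegree_le (hdeg z)).trans_lt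
        (by rw [Finset.card_range]; exact_mod_cast N.lt_succ_self))]
    simp only [Lagrange.interpolate_apply, eval_finsetSum, eval_mul, eval_C]
  intro n
  have hsum := IsBigO.sum (s := Finset.range (N + 1)) fun i _ =>
    (h (i : ℝ) n).mul (isBigO_const_one ℝ ((Lagrange.basis (Finset.range (N + 1))
      (fun i : ℕ => ((i : ℝ) : ℂ)) i).eval ζ) _)
  refine hsum.congr (fun z => ?_) fun z => mul_one _
  rw [hP, Finset.sum_apply]

/-- The real identity extends to complex `x`; at `x = i` the complex conjugates drop out of
the real parts. -/
theorem isFlat_sub_of_pencil (hj : j ≠ 0)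
    (h : ∀ x : ℝ, IsFlat fun z => ((x * Complex.I - 1) ^ (j + 1) * K z).re
      + (x * κ z + γ z) * ((x * Complex.I - 1) ^ j * Λ z).re) :
    IsFlat fun z => K z - (γ z + κ z * Complex.I) * Λ z / 2 := by
  set P : ℂ → ℂ[X] := fun z =>
    (C Complex.I * X - 1) ^ (j + 1) * C (K z) + (C (-Complex.I) * X - 1) ^ (j + 1) * C (conj (K z))
      + (C (κ z : ℂ) * X + C (γ z : ℂ)) * ((C Complex.I * X - 1) ^ j * C (Λ z)
        + (C (-Complex.I) * X - 1) ^ j * C (conj (Λ z))) with hP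
  have hdeg : ∀ z, (P z).natDegree ≤ j + 1 := by
    intro z
    simp only [hP]
    compute_degree
    exact (add_comm 1 j).le
  have hreal : ∀ x : ℝ, IsFlat fun z => (P z).eval (x : ℂ) := fun x n => by
    refine ((h x n).const_mul_left 2).norm_left.congr_left (fun z => ?_) |>.of_norm_left
    rw [← Complex.norm_real]
    congr 1
    simp only [hP, eval_add, eval_mul, eval_sub, eval_pow, eval_C, eval_X, eval_one]
    have hconj : -Complex.I * (x : ℂ) - 1 = conj (x * Complex.I - 1) := by
      simp [mul_comm]
    rw [hconj, mul_comm Complex.I, ← map_pow, ← map_pow, ← map_mul, ← map_mul, Complex.add_conj,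
      Complex.add_conj]
    push_cast
    ring
  intro n
  refine ((isFlat_eval_of_forall_ofReal hdeg hreal Complex.I n).const_mul_left
      ((-2) ^ (j + 1))⁻¹).congr_left fun z => ?_
  have hI : (-1 - 1 : ℂ) = -2 := by norm_num
  simp only [hP, eval_add, eval_mul, eval_sub, eval_pow, eval_C, eval_X, eval_one, neg_mul,
      Complex.I_mul_I, neg_neg, sub_self, hI, zero_pow hj, zero_pow j.succ_ne_zero]
  field_simp
  ring

theorem isFlat_re_add_im_of_pencil (hj : j ≠ 0)
    (h : ∀ x : ℝ, IsFlat fun z => ((x * Complex.I - 1) ^ (j + 1) * K z).re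
      + (x * κ z + γ z) * ((x * Complex.I - 1) ^ j * Λ z).re) :
    IsFlat fun z => γ z * (Λ z).re + κ z * (Λ z).im := by
  intro n
  have hre : (fun z => (K z - (γ z + κ z * Complex.I) * Λ z / 2).re) =O[𝓝[≠] 0] fun z => ‖z‖ ^ n :=
    (isBigO_of_le _ fun z => Complex.abs_re_le_norm _).trans (isFlat_sub_of_pencil hj h n)
  refine (((h 0 n).const_mul_left ((-1) ^ (j + 1))).sub hre).const_mul_left (-2) |>.congr_left
    fun z => ?_
  have hone : ((-1 : ℂ) ^ j) = ((-1 : ℝ) ^ j : ℝ) := by push_cast; rfl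
  have hsq : ((-1 : ℝ) ^ j) * (-1) ^ j = 1 := by rw [← mul_pow]; simp
  simp only [Complex.ofReal_zero, zero_mul, zero_sub, zero_add, pow_succ, hone, mul_assoc,
    Complex.re_ofReal_mul]
  simp only [neg_mul, one_mul, Complex.neg_re, mul_neg, neg_add_rev, neg_neg, Complex.sub_re,
    Complex.div_ofNat_re, Complex.mul_re, Complex.add_re, Complex.ofReal_re, Complex.I_re,
    mul_zero, Complex.ofReal_im, Complex.I_im, mul_one, sub_self, add_zero, Complex.add_im,
    Complex.mul_im, zero_add]
  linear_combination (2 * γ z * (Λ z).re - 2 * (K z).re) * hsq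

end Pencil

section LeadingTerm

open ComplexConjugate

theorem abs_norm_add_sub_le {z : ℂ} (hz : z ≠ 0) (h : ℂ) :
    |‖z + h‖ - ‖z‖ - (h * conj z).re / ‖z‖| ≤ 2 * ‖h‖ ^ 2 / ‖z‖ := by
  have hs : 0 < ‖z‖ := norm_pos_iff.2 hz
  set c := (h * conj z).re / ‖z‖ with hc
  have hcle : |c| ≤ ‖h‖ := by
    rw [hc, abs_div, abs_norm, div_le_iff₀ hs, ← Complex.norm_conj z, ← norm_mul]
    exact Complex.abs_re_le_norm _
  have hsq : ‖z + h‖ ^ 2 = ‖z‖ ^ 2 + 2 * (c * ‖z‖) + ‖h‖ ^ 2 := by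
    rw [hc, div_mul_cancel₀ _ hs.ne', Complex.sq_norm, Complex.sq_norm, Complex.sq_norm,
      Complex.normSq_add, ← Complex.conj_re (z * conj h), map_mul, Complex.conj_conj, mul_comm h]
    ring
  have hNs : |‖z + h‖ - ‖z‖| ≤ ‖h‖ := by simpa using abs_norm_sub_norm_le (z + h) z
  have hprod : |‖z + h‖ - ‖z‖ - c| * (‖z + h‖ + ‖z‖) ≤ 2 * ‖h‖ ^ 2 := by
    calc |‖z + h‖ - ‖z‖ - c| * (‖z + h‖ + ‖z‖)
        = |c * (‖z‖ - ‖z + h‖) + ‖h‖ ^ 2| := by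
          rw [← abs_of_nonneg (by positivity : 0 ≤ ‖z + h‖ + ‖z‖), ← abs_mul]
          congr 1
          linear_combination hsq
      _ ≤ ‖h‖ * ‖h‖ + ‖h‖ ^ 2 := by
          refine (abs_add_le _ _).trans ?_
          rw [abs_mul, abs_sub_comm, abs_of_nonneg (sq_nonneg ‖h‖)]
          gcongr
      _ = 2 * ‖h‖ ^ 2 := by ring
  rw [le_div_iff₀ hs]
  exact (mul_le_mul_of_nonneg_left (le_add_of_nonneg_left (norm_nonneg _))
    (abs_nonneg _)).trans hprod

theorem norm_add_sub_norm_isBigO {h a : ℂ → ℂ} {ε g : ℂ → ℝ} (hε : ε =O[𝓝[≠] 0] g)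
    (hh : h =O[𝓝[≠] 0] ε)
    (ha : (fun z => h z - ε z * a z) =O[𝓝[≠] 0] fun z => ε z * g z) :
    (fun z => ‖z + h z‖ - ‖z‖ - ε z * (a z * conj z / ‖z‖).re) =O[𝓝[≠] 0]
      fun z => ε z * (g z / ‖z‖) := by
  have hinv : (fun _ : ℂ => (1 : ℝ)) =O[𝓝[≠] 0] fun z => ‖z‖⁻¹ := by
    refine ((tendsto_norm_nhdsNE_nhds_zero.isBigO_one ℝ).inv_rev ?_).congr_left fun _ => inv_one
    filter_upwards [self_mem_nhdsWithin] with z (hz : z ≠ 0) h0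
    exact absurd h0 (norm_ne_zero_iff.2 hz)
  have hlin : (fun z => ‖h z - ε z * a z‖) =O[𝓝[≠] 0] fun z => ε z * (g z / ‖z‖) :=
    (ha.norm_left.mul hinv).congr (fun z => mul_one _) fun z => by rw [div_eq_mul_inv, mul_assoc]
  have hquad : (fun z => 2 * ‖h z‖ ^ 2 / ‖z‖) =O[𝓝[≠] 0] fun z => ε z * (g z / ‖z‖) :=
    (((hh.norm_left.mul (hh.trans hε).norm_left).const_mul_left 2).mul
      (isBigO_refl (fun z : ℂ => ‖z‖⁻¹) _)).congr (fun z => by ring) fun z => by ring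
  refine IsBigO.trans (.of_bound 1 ?_) (hquad.add hlin)
  filter_upwards [self_mem_nhdsWithin] with z (hz : z ≠ 0)
  have hre : |((h z - ε z * a z) * conj z / ‖z‖).re| ≤ ‖h z - ε z * a z‖ := by
    refine (Complex.abs_re_le_norm _).trans_eq ?_
    rw [norm_div, norm_mul, Complex.norm_conj, Complex.norm_real, norm_norm,
      mul_div_cancel_right₀ _ (norm_ne_zero_iff.2 hz)]
  rw [one_mul, Real.norm_eq_abs, Real.norm_of_nonneg (by positivity)]
  have hsplit : (h z * conj z).re / ‖z‖ =
      ((h z - ε z * a z) * conj z / ‖z‖).re + ε z * (a z * conj z / ‖z‖).re := by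
    rw [← Complex.re_ofReal_mul, ← Complex.div_ofReal_re, ← Complex.add_re]
    congr 1
    ring
  calc |‖z + h z‖ - ‖z‖ - ε z * (a z * conj z / ‖z‖).re|
      = |(‖z + h z‖ - ‖z‖ - (h z * conj z).re / ‖z‖) +
          ((h z - ε z * a z) * conj z / ‖z‖).re| := by rw [hsplit]; congr 1; ring
    _ ≤ 2 * ‖h z‖ ^ 2 / ‖z‖ + ‖h z - ε z * a z‖ :=
      (abs_add_le _ _).trans (add_le_add (abs_norm_add_sub_le hz (h z)) hre)

/-- The norm of the perturbation `y z` of `z` is `‖z‖ + ε z * δ z` up to an error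
`O(ε G(‖z‖) / ‖z‖)`, where `ε = O(G(‖z‖))` and `δ` is bounded. -/
structure NormExpansion (G : ℝ → ℝ) (ε δ : ℂ → ℝ) (y : ℂ → ℂ) : Prop where
  size_isBigO : ε =O[𝓝[≠] 0] fun z => G ‖z‖
  coeff_isBigO : δ =O[𝓝[≠] 0] fun _ => (1 : ℝ)
  sub_isBigO : (fun z => ‖y z‖ - ‖z‖ - ε z * δ z) =O[𝓝[≠] 0] fun z => ε z * (G ‖z‖ / ‖z‖)

variable {G q : ℝ → ℝ} {ε δ : ℂ → ℝ} {y : ℂ → ℂ}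

theorem G_norm_isBigO_div_norm (G : ℝ → ℝ) :
    (fun z : ℂ => G ‖z‖) =O[𝓝[≠] 0] fun z => G ‖z‖ / ‖z‖ := by
  refine ((isBigO_refl (fun z : ℂ => G ‖z‖ / ‖z‖) _).mul
    (tendsto_norm_nhdsNE_nhds_zero.isBigO_one ℝ)).congr' ?_ (.of_eq <| funext fun z => mul_one _)
  filter_upwards [self_mem_nhdsWithin] with z (hz : z ≠ 0)
  rw [div_mul_cancel₀ _ (norm_ne_zero_iff.2 hz)]

theorem tendsto_of_norm_sub_norm_isBigO (hy : (fun z => ‖y z‖ - ‖z‖) =O[𝓝[≠] 0] fun z => ‖z‖ ^ 2) :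
    Tendsto y (𝓝[≠] 0) (𝓝[≠] 0) := by
  have hlt : (fun z => ‖y z‖ - ‖z‖) =o[𝓝[≠] 0] fun z => ‖z‖ := by
    simpa using hy.trans_isLittleO (norm_pow_isLittleO one_lt_two)
  refine tendsto_nhdsWithin_iff.2 ⟨tendsto_zero_iff_norm_tendsto_zero.2 ?_, ?_⟩
  · simpa using (hlt.isBigO.trans_tendsto tendsto_norm_nhdsNE_nhds_zero).add
      tendsto_norm_nhdsNE_nhds_zero
  · filter_upwards [hlt.bound one_half_pos, self_mem_nhdsWithin] with z hz (hz0 : z ≠ 0) hyz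
    rw [show y z = 0 from hyz, norm_zero, zero_sub, norm_neg, norm_norm] at hz
    linarith [norm_pos_iff.2 hz0]

theorem curve_const_mul_G (x : ℝ) (z : ℂ) :
    curve G q (fun z => x * G ‖z‖) z =
      G ‖z‖ * ((x * Complex.I - 1) * Complex.exp (q ‖z‖ * Complex.I)) := by
  rw [curve]
  push_cast
  ring

theorem curve_const_mul_G_isBigO (x : ℝ) :
    curve G q (fun z => x * G ‖z‖) =O[𝓝[≠] 0] fun z => G ‖z‖ :=
  curve_isBigO (isBigO_refl _ _) (isBigO_const_mul_self _ _ _)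

namespace Profile

theorem deriv_q_norm_isBigO_one (H : Profile G q) :
    (fun z : ℂ => deriv q ‖z‖) =O[𝓝[≠] 0] fun _ => (1 : ℝ) := by
  obtain ⟨C, hC⟩ := H.q_lipschitz
  obtain ⟨δ, hlip, hδ : 0 < δ⟩ := (hC.and self_mem_nhdsWithin).exists
  refine .of_bound C ?_
  filter_upwards [tendsto_norm_nhdsNE_zero.eventually (Ioo_mem_nhdsGT hδ)] with z hz
  rw [norm_one, mul_one]
  exact norm_deriv_le_of_lipschitzOn (Ico_mem_nhds hz.1 hz.2) hlip

theorem q_norm_sub_sub_isBigO (H : Profile G q) (hy : Tendsto y (𝓝[≠] 0) (𝓝[≠] 0)) :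
    (fun z => q ‖y z‖ - q ‖z‖ - deriv q ‖z‖ * (‖y z‖ - ‖z‖)) =O[𝓝[≠] 0]
      fun z => (‖y z‖ - ‖z‖) ^ 2 := by
  obtain ⟨C, hC⟩ := H.q_taylor
  obtain ⟨δ, h, hδ : 0 < δ⟩ := (hC.and self_mem_nhdsWithin).exists
  refine .of_bound C ?_
  filter_upwards [tendsto_norm_nhdsNE_zero.eventually (Ioo_mem_nhdsGT hδ),
    (tendsto_norm_nhdsNE_zero.comp hy).eventually (Ioo_mem_nhdsGT hδ)] with z hz hyz
  simpa using h _ hz _ hyz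

theorem phase_sub_one_add_isBigO (H : Profile G q)
    (hy : Tendsto y (𝓝[≠] 0) (𝓝[≠] 0)) :
    (fun z => phase q z (y z) - 1 + Complex.I * (deriv q ‖z‖ * (‖y z‖ - ‖z‖) : ℝ)) =O[𝓝[≠] 0]
      fun z => (‖y z‖ - ‖z‖) ^ 2 := by
  have hid : Tendsto id (𝓝[≠] (0 : ℂ)) (𝓝 0) := tendsto_id.mono_left nhdsWithin_le_nhds
  have hη := H.q_norm_sub_isBigO hid (hy.mono_right nhdsWithin_le_nhds)
  have hD : Tendsto (fun z => ‖z‖ - ‖y z‖) (𝓝[≠] 0) (𝓝 0) := by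
    simpa using tendsto_norm_nhdsNE_nhds_zero.sub
      (tendsto_norm_nhdsNE_nhds_zero.comp hy)
  have hexp : (fun z => phase q z (y z) - 1 - (q ‖z‖ - q ‖y z‖ : ℝ) * Complex.I) =O[𝓝[≠] 0]
      fun z => (‖y z‖ - ‖z‖) ^ 2 := by
    refine IsBigO.trans (.of_bound 1 ?_) ((hη.pow 2).congr_right fun z => sub_sq_comm _ _)
    filter_upwards [(hη.trans_tendsto hD).norm.eventually
      (ge_mem_nhds (by simp : ‖(0 : ℝ)‖ < 1))] with z hz
    have hnorm : ‖((q ‖z‖ - q ‖y z‖ : ℝ) : ℂ) * Complex.I‖ = ‖q ‖z‖ - q ‖y z‖‖ := by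
      rw [norm_mul, Complex.norm_I, mul_one, Complex.norm_real]
    rw [one_mul, norm_pow, id, ← hnorm]
    exact Complex.norm_exp_sub_one_sub_id_le (hnorm.trans_le hz)
  have hlin : (fun z => (q ‖y z‖ - q ‖z‖ - deriv q ‖z‖ * (‖y z‖ - ‖z‖) : ℝ) * Complex.I)
      =O[𝓝[≠] 0] fun z => (‖y z‖ - ‖z‖) ^ 2 :=
    ((H.q_norm_sub_sub_isBigO hy).norm_left.congr_left fun z => by
      rw [norm_mul, Complex.norm_I, mul_one, Complex.norm_real]).of_norm_left
  refine (hexp.sub hlin).congr_left fun z => ?_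
  push_cast
  ring

theorem G_norm_sub_sub_isBigO (H : Profile G q)
    (hy : (fun z => ‖y z‖ - ‖z‖) =O[𝓝[≠] 0] fun z => ‖z‖ ^ 2) (n : ℕ) :
    (fun z => G ‖y z‖ - G ‖z‖ - deriv G ‖z‖ * (‖y z‖ - ‖z‖)) =O[𝓝[≠] 0]
      fun z => ‖z‖ ^ n * (‖y z‖ - ‖z‖) ^ 2 := by
  refine .of_bound 1 ?_
  have hle : ∀ᶠ z in 𝓝[≠] 0, |‖y z‖ - ‖z‖| ≤ ‖z‖ := by
    filter_upwards [(hy.trans_isLittleO (norm_pow_isLittleO one_lt_two)).bound one_pos] with z hz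
    simpa using hz
  filter_upwards [hle, tendsto_norm_nhdsNE_zero.eventually (H.G_taylor n)] with z hz htaylor
  simpa [abs_of_nonneg, sq_nonneg] using htaylor _ hz

theorem isFlat_G_norm_div_norm (H : Profile G q) : IsFlat fun z => G ‖z‖ / ‖z‖ := by
  refine .of_pow_mul (m := 1) (H.isFlat_G_norm.congr' ?_)
  filter_upwards [self_mem_nhdsWithin] with z (hz : z ≠ 0)
  rw [pow_one, mul_div_cancel₀ _ (norm_ne_zero_iff.2 hz)]

theorem norm_sub_norm_isBigO_of_expansion (H : Profile G q) (hy : NormExpansion G ε δ y) :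
    (fun z => ‖y z‖ - ‖z‖) =O[𝓝[≠] 0] ε := by
  have hsmall := (isBigO_refl ε (𝓝[≠] 0)).mul H.isFlat_G_norm_div_norm.isBigO_one
  have hlin := (isBigO_refl ε (𝓝[≠] 0)).mul hy.coeff_isBigO
  simp only [mul_one] at hsmall hlin
  exact ((hy.sub_isBigO.trans hsmall).add hlin).congr_left fun z => sub_add_cancel _ _

theorem norm_sub_norm_sq_isBigO_of_expansion (H : Profile G q)
    (hy : NormExpansion G ε δ y) :
    (fun z => (‖y z‖ - ‖z‖) ^ 2) =O[𝓝[≠] 0] fun z => ε z * G ‖z‖ := by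
  have hD := H.norm_sub_norm_isBigO_of_expansion hy
  exact (hD.mul (hD.trans hy.size_isBigO)).congr_left fun z => (sq _).symm

theorem phase_expansion (H : Profile G q) (hy : NormExpansion G ε δ y) :
    (fun z => phase q z (y z) - 1 + Complex.I * (deriv q ‖z‖ * (ε z * δ z) : ℝ)) =O[𝓝[≠] 0]
      fun z => ε z * (G ‖z‖ / ‖z‖) := by
  have hD := H.norm_sub_norm_isBigO_of_expansion hy
  have hy0 := tendsto_of_norm_sub_norm_isBigO (hD.trans (hy.size_isBigO.trans (H.isFlat_G_norm 2)))
  have hquad := (H.phase_sub_one_add_isBigO hy0).trans <|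
    (H.norm_sub_norm_sq_isBigO_of_expansion hy).trans
      ((isBigO_refl ε _).mul (G_norm_isBigO_div_norm G))
  have hlin : (fun z => Complex.I * (deriv q ‖z‖ * (‖y z‖ - ‖z‖ - ε z * δ z) : ℝ)) =O[𝓝[≠] 0]
      fun z => ε z * (G ‖z‖ / ‖z‖) := by
    have h := H.deriv_q_norm_isBigO_one.mul hy.sub_isBigO
    simp only [one_mul] at h
    refine (h.norm_left.congr_left fun z => ?_).of_norm_left
    rw [norm_mul Complex.I, Complex.norm_I, one_mul, Complex.norm_real]
  refine (hquad.sub hlin).congr_left fun z => ?_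
  push_cast
  ring

theorem G_norm_expansion (H : Profile G q) (hy : NormExpansion G ε δ y) (n : ℕ) :
    (fun z => G ‖y z‖ - G ‖z‖ - deriv G ‖z‖ * (ε z * δ z)) =O[𝓝[≠] 0]
      fun z => ε z * G ‖z‖ * ‖z‖ ^ n := by
  have hD := H.norm_sub_norm_isBigO_of_expansion hy
  have hquad := (H.G_norm_sub_sub_isBigO
    (hD.trans (hy.size_isBigO.trans (H.isFlat_G_norm 2))) n).trans
    ((isBigO_refl (fun z : ℂ => ‖z‖ ^ n) _).mul
      (H.norm_sub_norm_sq_isBigO_of_expansion hy))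
  have hflat : IsFlat fun z => deriv G ‖z‖ / ‖z‖ := by
    refine .of_pow_mul (m := 1) (H.isFlat_deriv_G_norm.congr' ?_)
    filter_upwards [self_mem_nhdsWithin] with z (hz : z ≠ 0)
    rw [pow_one, mul_div_cancel₀ _ (norm_ne_zero_iff.2 hz)]
  have hlin : (fun z => deriv G ‖z‖ * (‖y z‖ - ‖z‖ - ε z * δ z)) =O[𝓝[≠] 0]
      fun z => ε z * G ‖z‖ * ‖z‖ ^ n :=
    ((isBigO_refl (fun z : ℂ => deriv G ‖z‖) _).mul hy.sub_isBigO).trans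
      (((isBigO_refl (fun z => ε z * G ‖z‖) _).mul (hflat n)).congr_left fun z => by ring)
  exact ((hquad.congr_right fun z => mul_comm _ _).add hlin).congr_left fun z => by ring

theorem one_add_mul_phase_expansion (H : Profile G q) (hy : NormExpansion G ε δ y)
    {X b : ℂ → ℂ} (hXε : X =O[𝓝[≠] 0] ε)
    (hX : (fun z => X z - ε z * b z) =O[𝓝[≠] 0] fun z => ε z * G ‖z‖) :
    (fun z => (1 + X z) * phase q z (y z) - 1 - ε z * b z +
        Complex.I * (deriv q ‖z‖ * (ε z * δ z) : ℝ)) =O[𝓝[≠] 0]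
      fun z => ε z * (G ‖z‖ / ‖z‖) := by
  have hD := H.norm_sub_norm_isBigO_of_expansion hy
  have hy0 := tendsto_of_norm_sub_norm_isBigO (hD.trans (hy.size_isBigO.trans (H.isFlat_G_norm 2)))
  have hph : (fun z => phase q z (y z) - 1) =O[𝓝[≠] 0] fun z => G ‖z‖ :=
    (H.phase_sub_one_isBigO (tendsto_id.mono_left nhdsWithin_le_nhds)
      (hy0.mono_right nhdsWithin_le_nhds)).trans <|
        (hD.neg_left.congr_left fun z => neg_sub _ _).trans hy.size_isBigO
  have hεg := (isBigO_refl ε (𝓝[≠] 0)).mul (G_norm_isBigO_div_norm G)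
  refine (((hX.trans hεg).add (H.phase_expansion hy)).add
    ((hXε.mul hph).trans hεg)).congr_left fun z => ?_
  ring

/-- By `hM`, the point `(G(|z|) (x i - 1) e ^ {i q(|z|)}, z)` of the model is mapped into the model;
this extracts the terms of first order in `ε`. -/
theorem isFlat_of_expansion (H : Profile G q) (hy : NormExpansion G ε δ y)
    (hε : ∀ᶠ z in 𝓝[≠] 0, ε z ≠ 0)
    {X b : ℂ → ℂ} (hXε : X =O[𝓝[≠] 0] ε)
    (hX : (fun z => X z - ε z * b z) =O[𝓝[≠] 0] fun z => ε z * G ‖z‖) {x : ℝ}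
    (hM : ∀ᶠ z in 𝓝[≠] 0, (G ‖z‖ * ((x * Complex.I - 1) * ((1 + X z) * phase q z (y z)))).re =
      -G ‖y z‖) :
    IsFlat fun z => ((x * Complex.I - 1) * b z).re +
      (x * deriv q ‖z‖ + deriv G ‖z‖ / G ‖z‖) * δ z := by
  intro n
  set Err := fun z => (1 + X z) * phase q z (y z) - 1 - ε z * b z +
    Complex.I * (deriv q ‖z‖ * (ε z * δ z) : ℝ) with hErr
  have hErrO : (fun z => G ‖z‖ * ((x * Complex.I - 1) * Err z).re) =O[𝓝[≠] 0]
      fun z => ε z * G ‖z‖ * ‖z‖ ^ n := by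
    have h : (fun z => ((x * Complex.I - 1) * Err z).re) =O[𝓝[≠] 0] fun z => ε z * ‖z‖ ^ n :=
      (isBigO_of_le _ fun z => Complex.abs_re_le_norm _).trans <|
        ((H.one_add_mul_phase_expansion hy hXε hX).const_mul_left _).trans
          ((isBigO_refl ε _).mul (H.isFlat_G_norm_div_norm n))
    exact ((isBigO_refl (fun z : ℂ => G ‖z‖) _).mul h).congr_right fun z => by ring
  refine ((isBigO_refl (fun z => (ε z * G ‖z‖)⁻¹) _).mul
    ((H.G_norm_expansion hy n).neg_left.sub hErrO)).congr' ?_ ?_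
  · filter_upwards [hM, H.eventually_G_norm_pos, hε] with z hz hG h0
    have hfac : (1 + X z) * phase q z (y z) =
        1 + (ε z * b z - Complex.I * (deriv q ‖z‖ * (ε z * δ z) : ℝ)) + Err z := by
      rw [hErr]; ring
    rw [hfac, Complex.re_ofReal_mul, mul_add, mul_add, mul_sub, Complex.add_re, Complex.add_re,
      Complex.sub_re, mul_left_comm, Complex.re_ofReal_mul, ← mul_assoc _ Complex.I,
      mul_comm _ (Complex.ofReal _), Complex.re_ofReal_mul] at hz
    have hone : ((x * Complex.I - 1) * 1).re = -1 := by simp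
    have hI : ((x * Complex.I - 1) * Complex.I).re = -x := by simp
    rw [hone, hI] at hz
    rw [inv_mul_eq_iff_eq_mul₀ (mul_ne_zero h0 hG.ne')]
    have hdiv : G ‖z‖ * (deriv G ‖z‖ / G ‖z‖) = deriv G ‖z‖ := mul_div_cancel₀ _ hG.ne'
    linear_combination -hz - ε z * δ z * hdiv
  · filter_upwards [H.eventually_G_norm_pos, hε] with z hG h0
    rw [inv_mul_cancel_left₀ (mul_ne_zero h0 hG.ne')]

theorem tendsto_curve_const_mul_G (H : Profile G q) (x : ℝ) :
    Tendsto (curve G q fun z => x * G ‖z‖) (𝓝[≠] 0) (𝓝 0) :=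
  (H.isFlat_G_norm.of_isBigO (curve_const_mul_G_isBigO x)).tendsto_zero

theorem curve_pow_mul_isBigO (H : Profile G q) {f : ℂ × ℂ → ℂ} (hf : IsSepHolo f) (x : ℝ) (j : ℕ) :
    (fun z => curve G q (fun z => x * G ‖z‖) z ^ j * f (curve G q (fun z => x * G ‖z‖) z, z))
      =O[𝓝[≠] 0] fun z => G ‖z‖ ^ j := by
  simpa using ((curve_const_mul_G_isBigO (q := q) x).pow j).mul
    (hf.isBigO_one (H.tendsto_curve_const_mul_G x))

theorem curve_pow_mul_sub_isBigO (H : Profile G q) {f : ℂ × ℂ → ℂ} (hf : IsSepHolo f) (x : ℝ)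
    (j : ℕ) :
    (fun z => curve G q (fun z => x * G ‖z‖) z ^ j * f (curve G q (fun z => x * G ‖z‖) z, z) -
      (G ‖z‖ ^ j : ℝ) * (((x * Complex.I - 1) * Complex.exp (q ‖z‖ * Complex.I)) ^ j * f (0, z)))
      =O[𝓝[≠] 0] fun z => G ‖z‖ ^ j * G ‖z‖ := by
  refine (((curve_const_mul_G_isBigO (q := q) x).pow j).mul
    ((hf.sub_isBigO (H.tendsto_curve_const_mul_G x)).trans
      (curve_const_mul_G_isBigO x))).congr_left fun z => ?_
  rw [mul_sub, curve_const_mul_G x z, mul_pow (G ‖z‖ : ℂ)]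
  push_cast
  ring

variable {k l : ℂ × ℂ → ℂ} {j : ℕ}

theorem normExpansion_curve (H : Profile G q) (hl : IsSepHolo l) (hj : j ≠ 0) (x : ℝ) :
    NormExpansion G (fun z => G ‖z‖ ^ j)
      (fun z => (((x * Complex.I - 1) * Complex.exp (q ‖z‖ * Complex.I)) ^ j * l (0, z) *
        conj z / ‖z‖).re)
      (fun z => z + curve G q (fun z => x * G ‖z‖) z ^ j *
        l (curve G q (fun z => x * G ‖z‖) z, z)) := by
  have hsize : (fun z : ℂ => G ‖z‖ ^ j) =O[𝓝[≠] 0] fun z => G ‖z‖ := by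
    obtain ⟨i, rfl⟩ := Nat.exists_eq_succ_of_ne_zero hj
    simpa [pow_succ'] using (isBigO_refl (fun z : ℂ => G ‖z‖) (𝓝[≠] 0)).mul
      (H.isFlat_G_norm.isBigO_one.pow i)
  refine ⟨hsize, ?_, norm_add_sub_norm_isBigO hsize (H.curve_pow_mul_isBigO hl x j)
    (H.curve_pow_mul_sub_isBigO hl x j)⟩
  refine IsBigO.trans (.of_bound (‖(x * Complex.I - 1 : ℂ)‖ ^ j) ?_)
    (hl.isBigO_one (W := fun _ => 0) tendsto_const_nhds)
  filter_upwards [self_mem_nhdsWithin] with z (hz : z ≠ 0)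
  refine (Complex.abs_re_le_norm _).trans_eq ?_
  rw [norm_div, norm_mul, norm_mul, norm_pow, norm_mul, Complex.norm_exp_ofReal_mul_I, mul_one,
    Complex.norm_conj, Complex.norm_real, norm_norm,
    mul_div_cancel_right₀ _ (norm_ne_zero_iff.2 hz)]

theorem isFlat_leading_term (H : Profile G q) (hk : IsSepHolo k) (hl : IsSepHolo l) (hj : j ≠ 0)
    (hM : ∀ᶠ p in 𝓝 (0 : ℂ × ℂ), p ∈ Model G q →
      (p.1 * (1 + p.1 ^ j * k p), p.2 + p.1 ^ j * l p) ∈ Model G q) (x : ℝ) :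
    IsFlat fun z => ((x * Complex.I - 1) ^ (j + 1) *
        (Complex.exp (q ‖z‖ * Complex.I) ^ j * k (0, z))).re +
      (x * deriv q ‖z‖ + deriv G ‖z‖ / G ‖z‖) * ((x * Complex.I - 1) ^ j *
        (Complex.exp (q ‖z‖ * Complex.I) ^ j * l (0, z) * conj z / ‖z‖)).re := by
  have hpos : ∀ᶠ z : ℂ in 𝓝[≠] 0, G ‖z‖ ^ j ≠ 0 :=
    H.eventually_G_norm_pos.mono fun z hz => (pow_pos hz j).ne'
  refine (H.isFlat_of_expansion (x := x) (H.normExpansion_curve hl hj x) hpos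
    (H.curve_pow_mul_isBigO hk x j) (H.curve_pow_mul_sub_isBigO hk x j) ?_).congr'
      (.of_eq <| funext fun z => ?_)
  · filter_upwards [eventually_re_mul_multiplier (k := fun p => 1 + p.1 ^ j * k p)
      (f₂ := fun p => p.2 + p.1 ^ j * l p) (H.tendsto_curve_const_mul_G x) hM] with z hz
    rw [← hz, multiplier]
    congr 1
    push_cast
    ring
  · rw [mul_pow (_ - 1)]
    congr 2
    · ring
    · congr 2
      ring

end Profile
end LeadingTerm

section Tangency

open ComplexConjugate

variable {G q : ℝ → ℝ} {k l : ℂ × ℂ → ℂ} {j : ℕ}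

theorem norm_mul_conj_div {E z : ℂ} (hE : ‖E‖ = 1) (hz : z ≠ 0) (u : ℂ) :
    ‖E * u * conj z / ‖z‖‖ = ‖u‖ := by
  rw [norm_div, norm_mul, norm_mul, hE, one_mul, Complex.norm_conj, Complex.norm_real, norm_norm,
    mul_div_cancel_right₀ _ (norm_ne_zero_iff.2 hz)]

theorem isBigO_pow_mul_of_le {v : ℂ → ℂ} {v₀ : ℂ} {m n : ℕ} (hv : Tendsto v (𝓝[≠] 0) (𝓝 v₀))
    (hv₀ : v₀ ≠ 0) (hmn : m ≤ n) :
    (fun z => z ^ n) =O[𝓝[≠] 0] fun z => z ^ m * v z := by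
  have hpow : (fun z : ℂ => z ^ n) =O[𝓝[≠] 0] fun z => z ^ m :=
    ((norm_pow_isBigO hmn).congr (fun z => (norm_pow z n).symm)
      fun z => (norm_pow z m).symm).of_norm_norm
  have hone : (fun _ => (1 : ℂ)) =O[𝓝[≠] 0] v :=
    (isBigO_const_const 1 hv₀ _).trans ((isEquivalent_const_iff_tendsto hv₀).2 hv).isBigO_symm
  exact (hpow.mul hone).congr_left fun z => mul_one _

/-- The function `S` is `E(z) z ^ i v(z) / |z| ^ i` along a ray in a direction `d` for which
`d ^ i * v₀` is positive. -/
theorem exists_tendsto_norm_re_add_im_isBigO {γ κ : ℝ → ℝ} {E v : ℂ → ℂ} {v₀ : ℂ} {i : ℕ}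
    (hE : Tendsto E (𝓝[≠] 0) (𝓝 1)) (hv : Tendsto v (𝓝[≠] 0) (𝓝 v₀)) (hi : i ≠ 0)
    (h : (fun z => γ ‖z‖ * (E z * (z ^ (i + 1) * v z) * conj z / ‖z‖).re +
      κ ‖z‖ * (E z * (z ^ (i + 1) * v z) * conj z / ‖z‖).im) =O[𝓝[≠] 0] fun z => ‖z‖ ^ (i + 1)) :
    ∃ S : ℝ → ℂ, Tendsto S (𝓝[>] 0) (𝓝 (‖v₀‖ : ℂ)) ∧
      (fun s => γ s * (S s).re + κ s * (S s).im) =O[𝓝[>] 0] fun _ => (1 : ℝ) := by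
  obtain ⟨d, hd, hdv⟩ := exists_norm_eq_one_pow_mul_eq_norm v₀ hi
  have hray := tendsto_ofReal_mul_nhdsGT hd
  set S : ℝ → ℂ := fun s => E (s * d) * (d ^ i * v (s * d)) with hS
  have hΛ : ∀ s : ℝ, 0 < s → E (s * d) * ((s * d) ^ (i + 1) * v (s * d)) * conj (s * d : ℂ) /
      (s : ℂ) = ((s ^ (i + 1) : ℝ) : ℂ) * S s := fun s hs => by
    have hdd : d * conj d = 1 := by simp [Complex.mul_conj, Complex.normSq_eq_norm_sq, hd]
    have hs' : (s : ℂ) ≠ 0 := by exact_mod_cast hs.ne'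
    rw [hS, div_eq_iff hs', map_mul, Complex.conj_ofReal]
    push_cast
    linear_combination (E (s * d) * s ^ (i + 2) * d ^ i * v (s * d)) * hdd
  refine ⟨S, by simpa [hdv] using (hE.comp hray).mul ((hv.comp hray).const_mul (d ^ i)), ?_⟩
  refine ((isBigO_refl (fun s : ℝ => (s ^ (i + 1))⁻¹) _).mul (h.comp_tendsto hray)).congr' ?_ ?_
  · filter_upwards [self_mem_nhdsWithin] with s (hs : 0 < s)
    rw [Function.comp_apply, norm_ofReal_mul hs hd, hΛ s hs, Complex.re_ofReal_mul,
      Complex.im_ofReal_mul]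
    field_simp
  · filter_upwards [self_mem_nhdsWithin] with s (hs : 0 < s)
    rw [Function.comp_apply, norm_ofReal_mul hs hd, inv_mul_cancel₀ (pow_pos hs _).ne']

namespace Profile

theorem tendsto_exp_q_norm_pow (H : Profile G q) (j : ℕ) :
    Tendsto (fun z : ℂ => Complex.exp (q ‖z‖ * Complex.I) ^ j) (𝓝[≠] 0) (𝓝 1) := by
  have h := (H.tendsto_phase (x := id) (y := fun _ => 0)
    (tendsto_id.mono_left nhdsWithin_le_nhds) tendsto_const_nhds).pow j
  simpa [phase, H.q_zero] using h

theorem not_isBigO_mul_deriv_div (H : Profile G q) :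
    ¬ (fun s => s * (deriv G s / G s)) =O[𝓝[>] 0] fun _ => (1 : ℝ) := fun h => by
  refine H.not_isBigO_mul_deriv ((h.mul (isBigO_refl G _)).congr' ?_ (.of_eq ?_))
  · filter_upwards [H.G_pos] with s hs
    rw [mul_assoc, div_mul_cancel₀ _ hs.ne']
  · simp only [one_mul]

theorem not_isBigO_one_of_order_le_one (H : Profile G q) {E u : ℂ → ℂ} (hE : ∀ z, ‖E z‖ = 1)
    (hu : (fun z => z) =O[𝓝[≠] 0] u) :
    ¬ (fun z => (((deriv G ‖z‖ / G ‖z‖ : ℝ) : ℂ) + (deriv q ‖z‖ : ℝ) * Complex.I) *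
      (E z * u z * conj z / ‖z‖)) =O[𝓝[≠] 0] fun _ => (1 : ℝ) := fun h => by
  have hγu : (fun z => ((deriv G ‖z‖ / G ‖z‖ : ℝ) : ℂ) * u z) =O[𝓝[≠] 0] fun _ => (1 : ℝ) := by
    refine IsBigO.trans (.of_bound 1 ?_) h
    filter_upwards [self_mem_nhdsWithin] with z (hz : z ≠ 0)
    rw [one_mul, norm_mul, norm_mul, norm_mul_conj_div (hE z) hz, Complex.norm_real]
    gcongr
    refine le_of_eq_of_le ?_ (Complex.abs_re_le_norm _)
    simp [abs_div]
  have hγ := ((isBigO_refl (fun z : ℂ => ((deriv G ‖z‖ / G ‖z‖ : ℝ) : ℂ)) _).mul hu).trans hγu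
  refine H.not_isBigO_mul_deriv_div
    ((hγ.norm_left.comp_tendsto (tendsto_ofReal_mul_nhdsGT norm_one)).congr' ?_ .rfl).of_norm_left
  filter_upwards [self_mem_nhdsWithin] with s (hs : 0 < s)
  simp [abs_of_pos hs, mul_comm]

theorem not_isBigO_of_one_lt_order (H : Profile G q) {E v : ℂ → ℂ} {v₀ : ℂ} {i : ℕ}
    (hE : Tendsto E (𝓝[≠] 0) (𝓝 1)) (hv : Tendsto v (𝓝[≠] 0) (𝓝 v₀)) (hv₀ : v₀ ≠ 0) (hi : i ≠ 0) :
    ¬ (fun z => deriv G ‖z‖ / G ‖z‖ * (E z * (z ^ (i + 1) * v z) * conj z / ‖z‖).re +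
      deriv q ‖z‖ * (E z * (z ^ (i + 1) * v z) * conj z / ‖z‖).im) =O[𝓝[≠] 0]
        fun z => ‖z‖ ^ (i + 1) := fun h => by
  obtain ⟨S, hSlim, hS⟩ :=
    exists_tendsto_norm_re_add_im_isBigO (γ := fun s => deriv G s / G s) (κ := deriv q) hE hv hi h
  have hκ : deriv q =O[𝓝[>] 0] fun _ => (1 : ℝ) := by
    refine (H.deriv_q_norm_isBigO_one.comp_tendsto (tendsto_ofReal_mul_nhdsGT norm_one)).congr'
      ?_ .rfl
    filter_upwards [self_mem_nhdsWithin] with s (hs : 0 < s)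
    rw [Function.comp_apply, norm_ofReal_mul hs norm_one]
  have him : (fun s => (S s).im) =O[𝓝[>] 0] fun _ => (1 : ℝ) :=
    ((Complex.continuous_im.tendsto _).comp hSlim).isBigO_one ℝ
  have hre : Tendsto (fun s => (S s).re) (𝓝[>] 0) (𝓝 ‖v₀‖) :=
    (Complex.continuous_re.tendsto _).comp hSlim
  have hv₀' : ‖v₀‖ ≠ 0 := norm_ne_zero_iff.2 hv₀
  have hγ : (fun s => deriv G s / G s) =O[𝓝[>] 0] fun _ => (1 : ℝ) := by
    have hκim := hκ.mul him
    simp only [mul_one] at hκim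
    refine ((hS.sub hκim).mul ((hre.inv₀ hv₀').isBigO_one ℝ)).congr' ?_
      (.of_eq <| funext fun _ => mul_one _)
    filter_upwards [hre.eventually_ne hv₀'] with s hs
    rw [add_sub_cancel_right, mul_inv_cancel_right₀ hs]
  refine H.not_isBigO_mul_deriv_div ?_
  have hid : Tendsto id (𝓝[>] (0 : ℝ)) (𝓝 0) := tendsto_id.mono_left nhdsWithin_le_nhds
  simpa using (hid.isBigO_one ℝ).mul hγ

theorem eventually_zero_left_eq_zero (H : Profile G q) (hk : IsSepHolo k) (hl : IsSepHolo l)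
    (hj : j ≠ 0) (hM : ∀ᶠ p in 𝓝 (0 : ℂ × ℂ), p ∈ Model G q →
      (p.1 * (1 + p.1 ^ j * k p), p.2 + p.1 ^ j * l p) ∈ Model G q) :
    ∀ᶠ z in 𝓝 0, l (0, z) = 0 := by
  by_contra htop
  rw [← analyticOrderAt_eq_top] at htop
  obtain ⟨v, hv, hv0, hlv⟩ := hl.analyticAt.analyticOrderAt_ne_top.1 htop
  simp only [sub_zero, smul_eq_mul] at hlv
  replace hlv := hlv.filter_mono (nhdsWithin_le_nhds (s := {0}ᶜ))
  have hvlim : Tendsto v (𝓝[≠] 0) (𝓝 (v 0)) :=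
    hv.continuousAt.tendsto.mono_left nhdsWithin_le_nhds
  have hE := H.tendsto_exp_q_norm_pow j
  have hlead := H.isFlat_leading_term hk hl hj hM
  rcases le_or_gt (analyticOrderNatAt (fun z => l (0, z)) 0) 1 with hν | hν
  · refine H.not_isBigO_one_of_order_le_one (E := fun z => Complex.exp (q ‖z‖ * Complex.I) ^ j)
      (u := fun z => l (0, z)) (fun z => by rw [norm_pow, Complex.norm_exp_ofReal_mul_I, one_pow])
      ?_ ?_
    · exact (isBigO_pow_mul_of_le hvlim hv0 hν).congr' (.of_eq <| funext fun z => pow_one z)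
        (hlv.mono fun z hz => hz.symm)
    · have hK : (fun z => Complex.exp (q ‖z‖ * Complex.I) ^ j * k (0, z)) =O[𝓝[≠] 0]
          fun _ => (1 : ℝ) := by
        simpa using (hE.isBigO_one ℝ).mul (hk.isBigO_one (W := fun _ => 0) tendsto_const_nhds)
      refine ((hK.sub (isFlat_sub_of_pencil hj hlead).isBigO_one).const_mul_left 2).congr_left
        fun z => ?_
      ring
  · obtain ⟨i, hi⟩ := Nat.exists_eq_add_of_lt hν
    refine H.not_isBigO_of_one_lt_order (i := i + 1) hE hvlim hv0 i.succ_ne_zero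
      ((isFlat_re_add_im_of_pencil hj hlead (i + 2)).congr' ?_ .rfl)
    filter_upwards [hlv] with z hz
    rw [hz, hi, add_comm 1, add_assoc]

theorem tangency_improves (H : Profile G q) (hk : IsSepHolo k) (hl : IsSepHolo l)
    (hj : j ≠ 0) (hM : ∀ᶠ p in 𝓝 (0 : ℂ × ℂ), p ∈ Model G q →
      (p.1 * (1 + p.1 ^ j * k p), p.2 + p.1 ^ j * l p) ∈ Model G q) :
    (∀ᶠ z in 𝓝 0, k (0, z) = 0) ∧ ∀ᶠ z in 𝓝 0, l (0, z) = 0 := by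
  have hl0 := H.eventually_zero_left_eq_zero hk hl hj hM
  refine ⟨IsFlat.eventually_eq_zero ?_ hk.analyticAt, hl0⟩
  refine (isFlat_sub_of_pencil hj (H.isFlat_leading_term hk hl hj hM)).of_isBigO (.of_bound 1 ?_)
  filter_upwards [hl0.filter_mono nhdsWithin_le_nhds] with z hz
  simp [hz, Complex.norm_exp_ofReal_mul_I]

end Profile
end Tangency

section Rotation

variable {G q : ℝ → ℝ} {f₁ f₂ k : ℂ × ℂ → ℂ} {b : ℂ}

theorem eventually_snd {Q : ℂ → Prop} (h : ∀ᶠ z in 𝓝 0, Q z) :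
    ∀ᶠ p : ℂ × ℂ in 𝓝 0, Q p.2 :=
  (continuous_snd.tendsto (0 : ℂ × ℂ)).eventually h

theorem fst_isBigO_norm : (fun p : ℂ × ℂ => p.1) =O[𝓝 0] fun p => ‖p‖ :=
  .of_bound 1 <| .of_forall fun p => by simpa using norm_fst_le p

theorem IsSepHolo.isBigO_one_nhds (h : IsSepHolo k) : k =O[𝓝 0] fun _ => (1 : ℝ) := by
  obtain ⟨r, hr, hk⟩ := h
  obtain ⟨C, hC⟩ := hk.bdd
  exact .of_bound C <| by filter_upwards [ball_mem_nhds 0 hr] with p hp using by simpa using hC p hp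

theorem IsSepHolo.continuousAt (h : IsSepHolo k) : ContinuousAt k 0 := by
  obtain ⟨g, hg, hkg⟩ := h.exists_eq_add_mul
  have hfst : Tendsto (fun p : ℂ × ℂ => p.1) (𝓝 0) (𝓝 0) := continuous_fst.tendsto' 0 0 rfl
  have hsnd : Tendsto (fun p : ℂ × ℂ => p.2) (𝓝 0) (𝓝 0) := continuous_snd.tendsto' 0 0 rfl
  have hlim := (h.analyticAt.continuousAt.tendsto.comp hsnd).add
    (hfst.zero_mul_isBoundedUnder_le (isBigO_one_iff ℝ |>.1 hg.isBigO_one_nhds))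
  rw [add_zero] at hlim
  exact hlim.congr fun p => (hkg p).symm

theorem IsSepHolo.hasFDerivAt_fst_mul (h : IsSepHolo k) :
    HasFDerivAt (fun p : ℂ × ℂ => p.1 * k p) (k 0 • ContinuousLinearMap.fst ℂ ℂ ℂ) 0 := by
  have hk0 : (fun p => k p - k 0) =o[𝓝 0] fun _ => (1 : ℝ) :=
    (isLittleO_one_iff ℝ).2 (tendsto_sub_nhds_zero_iff.2 h.continuousAt)
  rw [hasFDerivAt_iff_isLittleO_nhds_zero]
  refine ((fst_isBigO_norm.mul_isLittleO hk0).congr_right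
    fun p => mul_one _).of_norm_right.congr_left fun p => ?_
  simp only [zero_add, Prod.fst_zero, zero_mul, sub_zero, smul_apply,
    ContinuousLinearMap.coe_fst', smul_eq_mul]
  ring

theorem eq_zero_of_flat {E : Type*} [NormedAddCommGroup E] [NormedSpace ℂ E] {F : E → ℂ} {r : ℝ}
    (hF : DifferentiableOn ℂ F (ball 0 r)) (h : ∀ n : ℕ, F =O[𝓝 0] fun p => ‖p‖ ^ n) {p : E}
    (hp : p ∈ ball 0 r) : F p = 0 := by
  have hline : Continuous fun t : ℂ => t • p := by fun_prop
  set S : Set ℂ := (fun t : ℂ => t • p) ⁻¹' ball 0 r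
  have hS : IsPreconnected S := Convex.isPreconnected <|
    letI := NormedSpace.restrictScalars ℝ ℂ E
    (convex_ball (0 : E) r).is_linear_preimage
      ⟨fun _ _ => add_smul _ _ _, fun c t => smul_assoc c t p⟩
  have hS0 : (0 : ℂ) ∈ S := by
    simpa [S] using (norm_nonneg p).trans_lt (mem_ball_zero_iff.1 hp)
  have hS1 : (1 : ℂ) ∈ S := by simpa [S] using hp
  have han : AnalyticOnNhd ℂ (fun t : ℂ => F (t • p)) S :=
    DifferentiableOn.analyticOnNhd (hF.comp (by fun_prop) fun _ ht => ht)
      (isOpen_ball.preimage hline)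
  have hflat : IsFlat fun t : ℂ => F (t • p) := fun n => by
    refine ((h n).comp_tendsto ((hline.tendsto' 0 0 (zero_smul ℂ p)).mono_left
      nhdsWithin_le_nhds)).trans (.of_bound (‖p‖ ^ n) <| .of_forall fun t => ?_)
    simp [norm_smul, mul_pow, mul_comm]
  simpa using han.eqOn_zero_of_preconnected_of_eventuallyEq_zero hS hS0
    (hflat.eventually_eq_zero (han 0 hS0)) hS1

theorem mem_model_congr_snd {w z z' : ℂ} (h : ‖z‖ = ‖z'‖) :
    (w, z) ∈ Model G q ↔ (w, z') ∈ Model G q := by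
  simp only [Model, mem_ofPred_eq, h]

theorem Profile.exists_eq_rotation_add_pow (H : Profile G q) (hk : IsSepHolo k)
    (hf₂ : IsSepHolo f₂) (hb : ‖b‖ = 1) (hk1 : ∀ᶠ z in 𝓝 0, k (0, z) = 1)
    (hfb : ∀ᶠ z in 𝓝 0, f₂ (0, z) = b * z)
    (hM : ∀ᶠ p in 𝓝 (0 : ℂ × ℂ), p ∈ Model G q → (p.1 * k p, f₂ p) ∈ Model G q) (j : ℕ) :
    ∃ u v, IsSepHolo u ∧ IsSepHolo v ∧
      (∀ᶠ p in 𝓝 (0 : ℂ × ℂ), k p = 1 + p.1 ^ (j + 1) * u p) ∧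
      ∀ᶠ p in 𝓝 (0 : ℂ × ℂ), f₂ p = b * (p.2 + p.1 ^ (j + 1) * v p) := by
  induction j with
  | zero =>
    have hb0 : b ≠ 0 := norm_ne_zero_iff.1 (hb ▸ one_ne_zero)
    obtain ⟨u, hu, hku⟩ := hk.exists_eq_add_mul
    obtain ⟨v, hv, hfv⟩ := hf₂.exists_eq_add_mul
    refine ⟨u, fun p => b⁻¹ * v p, hu, hv.const_mul _, ?_, ?_⟩
    · filter_upwards [eventually_snd hk1] with p hp
      rw [hku p, hp, zero_add, pow_one]
    · filter_upwards [eventually_snd hfb] with p hp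
      rw [hfv p, hp]
      field_simp
      ring
  | succ j ih =>
    obtain ⟨u, v, hu, hv, hku, hfv⟩ := ih
    have hM' : ∀ᶠ p in 𝓝 (0 : ℂ × ℂ), p ∈ Model G q →
        (p.1 * (1 + p.1 ^ (j + 1) * u p), p.2 + p.1 ^ (j + 1) * v p) ∈ Model G q := by
      filter_upwards [hM, hku, hfv] with p hp hkp hfp hm
      have hmem := hp hm
      rw [hkp, hfp] at hmem
      exact (mem_model_congr_snd (by rw [norm_mul, hb, one_mul])).1 hmem
    obtain ⟨hu0, hv0⟩ := H.tangency_improves hu hv j.succ_ne_zero hM'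
    obtain ⟨u', hu', huu'⟩ := hu.exists_eq_add_mul
    obtain ⟨v', hv', hvv'⟩ := hv.exists_eq_add_mul
    refine ⟨u', v', hu', hv', ?_, ?_⟩
    · filter_upwards [hku, eventually_snd hu0] with p hp hp'
      rw [hp, huu' p, hp']
      ring
    · filter_upwards [hfv, eventually_snd hv0] with p hp hp'
      rw [hp, hvv' p, hp']
      ring

theorem IsSepHolo.fst_pow_mul_isBigO (h : IsSepHolo k) {m n : ℕ} (hmn : m ≤ n) :
    (fun p : ℂ × ℂ => p.1 ^ n * k p) =O[𝓝 0] fun p => ‖p‖ ^ m := by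
  have hpow : (fun p : ℂ × ℂ => ‖p‖ ^ n) =O[𝓝 0] fun p => ‖p‖ ^ m := .of_bound 1 <| by
    filter_upwards [tendsto_norm_zero.eventually (eventually_le_nhds one_pos)] with p hp
    simpa using pow_le_pow_of_le_one (norm_nonneg p) hp hmn
  simpa using ((fst_isBigO_norm.pow n).trans hpow).mul h.isBigO_one_nhds

theorem Profile.eq_rotation (H : Profile G q)
    (hd₁ : ∀ᶠ p in 𝓝 (0 : ℂ × ℂ), DifferentiableAt ℂ f₁ p)
    (hd₂ : ∀ᶠ p in 𝓝 (0 : ℂ × ℂ), DifferentiableAt ℂ f₂ p) (h₁ : f₁ 0 = 0) (h₂ : f₂ 0 = 0)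
    (hne : fderiv ℂ f₁ 0 ≠ 0)
    (hM : ∀ᶠ p in 𝓝 (0 : ℂ × ℂ), p ∈ Model G q → (f₁ p, f₂ p) ∈ Model G q) :
    ∃ b : ℂ, ‖b‖ = 1 ∧ ∀ᶠ p in 𝓝 (0 : ℂ × ℂ), f₁ p = p.1 ∧ f₂ p = b * p.2 := by
  have hf₁ := IsSepHolo.of_differentiableAt hd₁
  have hf₂ := IsSepHolo.of_differentiableAt hd₂
  obtain ⟨k, hk, hfk⟩ := hf₁.exists_eq_add_mul
  have hf₁k : f₁ =ᶠ[𝓝 0] fun p => p.1 * k p := by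
    filter_upwards [eventually_snd (H.eventually_fst_eq_zero hf₁ hf₂ h₁ h₂ hM)] with p hp
    rw [hfk p, hp, zero_add]
  have hk0 : k 0 ≠ 0 := fun h0 => hne <| by
    rw [hf₁k.fderiv_eq, hk.hasFDerivAt_fst_mul.fderiv, h0]
    exact zero_smul ℂ (ContinuousLinearMap.fst ℂ ℂ ℂ)
  have hMk : ∀ᶠ p in 𝓝 (0 : ℂ × ℂ), p ∈ Model G q → (p.1 * k p, f₂ p) ∈ Model G q := by
    filter_upwards [hM, hf₁k] with p hp hp' hm using hp' ▸ hp hm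
  obtain ⟨b, hb, hk1, hfb⟩ := H.exists_eventually_eq_rotation hk hf₂
    (hd₂.mono fun _ hp => hp.continuousAt) h₂ hk0 hMk
  obtain ⟨r, hr, hd⟩ := Metric.eventually_nhds_iff_ball.1 (hd₁.and hd₂)
  refine ⟨b, hb, ?_⟩
  have hexp := H.exists_eq_rotation_add_pow hk hf₂ hb hk1 hfb hMk
  filter_upwards [ball_mem_nhds (0 : ℂ × ℂ) hr] with p hp
  constructor
  · refine sub_eq_zero.1 (eq_zero_of_flat (F := fun p => f₁ p - p.1) (r := r)
      (fun p hp => ((hd p hp).1.sub differentiableAt_fst).differentiableWithinAt) (fun n => ?_) hp)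
    obtain ⟨u, -, hu, -, hku, -⟩ := hexp n
    refine EventuallyEq.trans_isBigO ?_ (hu.fst_pow_mul_isBigO (n := n + 2) (by omega))
    filter_upwards [hf₁k, hku] with p hp hkp
    rw [hp, hkp]
    ring
  · refine sub_eq_zero.1 (eq_zero_of_flat (F := fun p => f₂ p - b * p.2) (r := r)
      (fun p hp => ((hd p hp).2.sub (differentiableAt_snd.const_mul b)).differentiableWithinAt)
      (fun n => ?_) hp)
    obtain ⟨-, v, -, hv, -, hfv⟩ := hexp n
    refine EventuallyEq.trans_isBigO ?_
      ((hv.fst_pow_mul_isBigO (n := n + 1) (by omega)).const_mul_left b)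
    filter_upwards [hfv] with p hp
    rw [hp]
    ring

end Rotation

section SmoothProfile

theorem abs_sub_sub_mul_le_of_abs_deriv_le {f f' f'' : ℝ → ℝ} {S : Set ℝ} (hS : Convex ℝ S)
    {B : ℝ} (hf : ∀ u ∈ S, HasDerivWithinAt f (f' u) S u)
    (hf' : ∀ u ∈ S, HasDerivWithinAt f' (f'' u) S u) (hB : ∀ u ∈ S, |f'' u| ≤ B) {s t : ℝ}
    (hs : s ∈ S) (ht : t ∈ S) : |f t - f s - f' s * (t - s)| ≤ B * (t - s) ^ 2 := by
  have hsub : uIcc s t ⊆ S := hS.ordConnected.uIcc_subset hs ht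
  have hder : ∀ u ∈ uIcc s t,
      HasDerivWithinAt (fun u => f u - f' s * u) (f' u - f' s) (uIcc s t) u := fun u hu => by
    have hlin := (hasDerivWithinAt_id u (uIcc s t)).const_mul (f' s)
    rw [mul_one] at hlin
    exact ((hf u (hsub hu)).mono hsub).sub hlin
  have hle : ∀ u ∈ uIcc s t, ‖f' u - f' s‖ ≤ B * |t - s| := fun u hu =>
    (hS.norm_image_sub_le_of_norm_hasDerivWithin_le hf' hB hs (hsub hu)).trans
      (mul_le_mul_of_nonneg_left (abs_sub_left_of_mem_uIcc hu) ((abs_nonneg _).trans (hB s hs)))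
  calc |f t - f s - f' s * (t - s)| = ‖f t - f' s * t - (f s - f' s * s)‖ := by
        rw [Real.norm_eq_abs]; ring_nf
    _ ≤ B * |t - s| * ‖t - s‖ := (convex_uIcc s t).norm_image_sub_le_of_norm_hasDerivWithin_le
        hder hle left_mem_uIcc right_mem_uIcc
    _ = B * (t - s) ^ 2 := by rw [Real.norm_eq_abs, mul_assoc, ← sq, sq_abs]

variable {g : ℝ → ℝ}

theorem isBigO_pow_succ_of_deriv (hg : ∀ᶠ s in 𝓝 0, DifferentiableAt ℝ g s) (hg0 : g 0 = 0)
    {n : ℕ} (h : deriv g =O[𝓝 0] fun s => s ^ n) : g =O[𝓝 0] fun s => s ^ (n + 1) := by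
  obtain ⟨C, hC0, hC⟩ := h.exists_nonneg
  obtain ⟨δ, hδ, hball⟩ := Metric.eventually_nhds_iff_ball.1 (hC.bound.and hg)
  refine .of_bound C ?_
  filter_upwards [ball_mem_nhds (0 : ℝ) hδ] with s hs
  have hsub : ∀ u ∈ uIcc 0 s, |u| ≤ |s| := fun u hu => by
    simpa using abs_sub_left_of_mem_uIcc hu
  have hmem : ∀ u ∈ uIcc 0 s, u ∈ ball (0 : ℝ) δ := fun u hu =>
    mem_ball_zero_iff.2 ((hsub u hu).trans_lt (mem_ball_zero_iff.1 hs))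
  have hle : ∀ u ∈ uIcc 0 s, ‖deriv g u‖ ≤ C * |s| ^ n := fun u hu => by
    refine (hball u (hmem u hu)).1.trans (mul_le_mul_of_nonneg_left ?_ hC0)
    rw [norm_pow, Real.norm_eq_abs]
    exact pow_le_pow_left₀ (abs_nonneg u) (hsub u hu) n
  simpa [hg0, pow_succ, mul_assoc] using
    (convex_uIcc 0 s).norm_image_sub_le_of_norm_deriv_le (fun u hu => (hball u (hmem u hu)).2)
      hle left_mem_uIcc right_mem_uIcc

theorem eventually_differentiableAt_iteratedDeriv (hg : ContDiffAt ℝ ∞ g 0) (m : ℕ) :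
    ∀ᶠ s in 𝓝 0, DifferentiableAt ℝ (iteratedDeriv m g) s := by
  have hlt : (m : WithTop ℕ∞) < (m + 1 : ℕ) := by exact_mod_cast m.lt_succ_self
  have hsm : ContDiffAt ℝ (m + 1 : ℕ) g 0 := hg.of_le (by exact_mod_cast le_top)
  filter_upwards [hsm.eventually (by simp)] with s hs
  rw [iteratedDeriv_eq_equiv_comp, LinearIsometryEquiv.comp_differentiableAt_iff]
  exact hs.differentiableAt_iteratedFDeriv hlt

theorem iteratedDeriv_isBigO_pow (hg : ContDiffAt ℝ ∞ g 0) (h0 : ∀ m, iteratedDeriv m g 0 = 0)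
    (n m : ℕ) : iteratedDeriv m g =O[𝓝 0] fun s => s ^ n := by
  induction n generalizing m with
  | zero =>
    simpa using (eventually_differentiableAt_iteratedDeriv hg m).self_of_nhds.continuousAt
      |>.tendsto.isBigO_one ℝ
  | succ n ih =>
    refine isBigO_pow_succ_of_deriv (eventually_differentiableAt_iteratedDeriv hg m) (h0 m) ?_
    rw [← iteratedDeriv_succ]
    exact ih (m + 1)

theorem eventually_abs_taylor_le (hg : ContDiffAt ℝ ∞ g 0) (h0 : ∀ m, iteratedDeriv m g 0 = 0)
    (n : ℕ) : ∀ᶠ s in 𝓝[>] 0, ∀ t, |t - s| ≤ s →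
      |g t - g s - deriv g s * (t - s)| ≤ s ^ n * (t - s) ^ 2 := by
  obtain ⟨C, hC0, hC⟩ := (iteratedDeriv_isBigO_pow hg h0 (n + 1) 2).exists_nonneg
  obtain ⟨δ, hδ, hball⟩ := Metric.eventually_nhds_iff_ball.1 <| hC.bound.and <|
    (eventually_differentiableAt_iteratedDeriv hg 0).and
      (eventually_differentiableAt_iteratedDeriv hg 1)
  have hsmall : ∀ᶠ s : ℝ in 𝓝[>] 0, C * 2 ^ (n + 1) * s ≤ 1 :=
    ((continuous_const.mul continuous_id).tendsto' 0 0 (mul_zero _) |>.eventually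
      (eventually_le_nhds one_pos)).filter_mono nhdsWithin_le_nhds
  filter_upwards [Ioo_mem_nhdsGT (half_pos hδ), hsmall] with s hs hs1 t ht
  have hball' : ∀ u ∈ Icc 0 (2 * s), u ∈ ball (0 : ℝ) δ := fun u hu => by
    rw [mem_ball_zero_iff, Real.norm_of_nonneg hu.1]
    linarith [hu.2, hs.2]
  refine abs_sub_sub_mul_le_of_abs_deriv_le (f'' := iteratedDeriv 2 g) (convex_Icc 0 (2 * s))
    (fun u hu => ?_) (fun u hu => ?_) (fun u hu => ?_) ⟨hs.1.le, by linarith [hs.1]⟩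
    ⟨by linarith [(abs_le.1 ht).1], by linarith [(abs_le.1 ht).2]⟩
  · simpa using (hball u (hball' u hu)).2.1.hasDerivAt.hasDerivWithinAt
  · rw [iteratedDeriv_succ, iteratedDeriv_one]
    simpa using (hball u (hball' u hu)).2.2.hasDerivAt.hasDerivWithinAt
  · calc |iteratedDeriv 2 g u| ≤ C * ‖u ^ (n + 1)‖ := (hball u (hball' u hu)).1
      _ ≤ C * (2 * s) ^ (n + 1) := by
        rw [norm_pow, Real.norm_of_nonneg hu.1]
        exact mul_le_mul_of_nonneg_left (pow_le_pow_left₀ hu.1 hu.2 _) hC0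
      _ = C * 2 ^ (n + 1) * s * s ^ n := by ring
      _ ≤ s ^ n := mul_le_of_le_one_left (pow_nonneg hs.1.le n) hs1

/-- The restriction to the real axis of the radial function `z ↦ e ^ {p(|z|)}`. -/
noncomputable def radial (p : ℝ → ℝ) (s : ℝ) : ℝ := expRadial p (s : ℂ)

theorem radial_norm (p : ℝ → ℝ) (z : ℂ) : radial p ‖z‖ = expRadial p z := by
  simp [radial, expRadial]

theorem radial_pos (p : ℝ → ℝ) {s : ℝ} (hs : s ≠ 0) : 0 < radial p s := by
  rw [radial, expRadial, if_neg (Complex.ofReal_ne_zero.2 hs)]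
  positivity

theorem iteratedDeriv_comp_ofReal_eq_zero {g : ℂ → ℝ} {U : Set ℂ} (hU : IsOpen U) (h0 : 0 ∈ U)
    (hg : ContDiffOn ℝ ∞ g U) (hg₀ : VanishesToInfiniteOrder g) (m : ℕ) :
    iteratedDeriv m (fun s : ℝ => g s) 0 = 0 := by
  have hpre : IsOpen (Complex.ofRealCLM ⁻¹' U) := hU.preimage Complex.continuous_ofReal
  have hcomp := Complex.ofRealCLM.iteratedFDerivWithin_comp_right hg hU.uniqueDiffOn
    hpre.uniqueDiffOn (x := 0) (by simpa using h0) (i := m) (by exact_mod_cast le_top)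
  rw [iteratedFDerivWithin_of_isOpen m hpre (by simpa using h0),
    iteratedFDerivWithin_of_isOpen m hU (by simpa using h0), map_zero, hg₀ m] at hcomp
  rw [iteratedDeriv_eq_iteratedFDeriv]
  exact congrArg (fun A => A fun _ => (1 : ℝ)) hcomp

theorem exists_lipschitzOnWith_and_taylor {ε₀ : ℝ} (hε₀ : 0 < ε₀) {q : ℝ → ℝ}
    (hq : ContDiffOn ℝ 2 q (Ico 0 ε₀)) : ∃ C : NNReal, LipschitzOnWith C q (Icc 0 (ε₀ / 2)) ∧
      ∀ s ∈ Ioc 0 (ε₀ / 2), ∀ t ∈ Icc 0 (ε₀ / 2),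
        |q t - q s - deriv q s * (t - s)| ≤ C * (t - s) ^ 2 := by
  set I := Icc 0 (ε₀ / 2)
  have hun : UniqueDiffOn ℝ I := uniqueDiffOn_Icc (half_pos hε₀)
  have hqI : ContDiffOn ℝ 2 q I := hq.mono fun s hs => ⟨hs.1, hs.2.trans_lt (half_lt_self hε₀)⟩
  have hq' : ContDiffOn ℝ 1 (derivWithin q I) I := hqI.derivWithin hun (by norm_num)
  have hd : ∀ u ∈ I, HasDerivWithinAt q (derivWithin q I u) I u := fun u hu =>
    (hqI.differentiableOn (by norm_num) u hu).hasDerivWithinAt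
  have hd' : ∀ u ∈ I, HasDerivWithinAt (derivWithin q I) (derivWithin (derivWithin q I) I u) I u :=
    fun u hu => (hq'.differentiableOn (by norm_num) u hu).hasDerivWithinAt
  obtain ⟨C₁, hC₁⟩ := isCompact_Icc.exists_bound_of_continuousOn hq'.continuousOn
  obtain ⟨C₂, hC₂⟩ := isCompact_Icc.exists_bound_of_continuousOn
    (hq'.continuousOn_derivWithin hun (by norm_num))
  have hderiv : ∀ s ∈ Ioc 0 (ε₀ / 2), deriv q s = derivWithin q I s := fun s hs => by
    refine ((hq.contDiffAt (Ico_mem_nhds hs.1 ?_)).differentiableAt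
      (by norm_num)).hasDerivAt.hasDerivWithinAt.derivWithin (hun s ⟨hs.1.le, hs.2⟩) |>.symm
    exact hs.2.trans_lt (half_lt_self hε₀)
  refine ⟨(max C₁ C₂).toNNReal, (convex_Icc _ _).lipschitzOnWith_of_nnnorm_hasDerivWithin_le hd
    fun u hu => ?_, fun s hs t ht => hderiv s hs ▸ abs_sub_sub_mul_le_of_abs_deriv_le
      (convex_Icc _ _) hd hd' (fun u hu => ?_) ⟨hs.1.le, hs.2⟩ ht⟩
  · exact NNReal.le_toNNReal_of_coe_le ((hC₁ u hu).trans (le_max_left _ _))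
  · exact (hC₂ u hu).trans ((le_max_right _ _).trans (Real.le_coe_toNNReal _))

theorem profile_of_smooth {ε₀ : ℝ} (hε₀ : 0 < ε₀) {p q : ℝ → ℝ}
    (hq : ContDiffOn ℝ 2 q (Ico 0 ε₀)) (hq₀ : q 0 = 0)
    (hg : ContDiffOn ℝ ∞ (expRadial p) (ball (0 : ℂ) ε₀))
    (hg₀ : VanishesToInfiniteOrder (expRadial p)) : Profile (radial p) q := by
  have hgc : ContDiffAt ℝ ∞ (expRadial p) 0 := hg.contDiffAt (ball_mem_nhds 0 hε₀)
  have hG : ContDiffAt ℝ ∞ (radial p) 0 :=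
    ContDiffAt.comp (0 : ℝ) (by simpa using hgc) Complex.ofRealCLM.contDiff.contDiffAt
  have hG0 := iteratedDeriv_comp_ofReal_eq_zero isOpen_ball (mem_ball_self hε₀) hg hg₀
  obtain ⟨C, hlip, htaylor⟩ := exists_lipschitzOnWith_and_taylor hε₀ hq
  have hδ : ∀ᶠ δ in 𝓝[>] 0, δ < ε₀ / 2 :=
    (eventually_lt_nhds (half_pos hε₀)).filter_mono nhdsWithin_le_nhds
  exact
    { G_zero := by simp [radial, expRadial]
      G_pos := eventually_mem_nhdsWithin.mono fun s hs => radial_pos p (ne_of_gt hs)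
      G_differentiableAt := by
        simpa using eventually_differentiableAt_iteratedDeriv hG 0
      G_isBigO := fun n => by simpa using iteratedDeriv_isBigO_pow hG hG0 n 0
      deriv_G_isBigO := fun n => by simpa using iteratedDeriv_isBigO_pow hG hG0 n 1
      G_taylor := eventually_abs_taylor_le hG hG0
      q_zero := hq₀
      q_lipschitz := ⟨C, hδ.mono fun δ hδ => hlip.mono fun s hs => ⟨hs.1, (hs.2.trans hδ).le⟩⟩
      q_taylor := ⟨C, hδ.mono fun δ hδ s hs t ht =>
        htaylor s ⟨hs.1, (hs.2.trans hδ).le⟩ t ⟨ht.1.le, (ht.2.trans hδ).le⟩⟩ }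

end SmoothProfile

section Primitive

/-- The primitive `∑_{n ≥ 1} (a_n / n) z^n` of `a(z) / z`. -/
noncomputable def primitive (c : ℕ → ℂ) (z : ℂ) : ℂ :=
  ∑' n : ℕ, c (n + 1) / ((n : ℂ) + 1) * z ^ (n + 1)

theorem tsum_div_I_mul (c : ℕ → ℂ) (z : ℂ) :
    ∑' n : ℕ, c (n + 1) / (Complex.I * ((n : ℂ) + 1)) * z ^ (n + 1)
      = -(Complex.I * primitive c z) := by
  rw [primitive, ← neg_mul, ← tsum_mul_left]
  refine tsum_congr fun n => ?_
  rw [mul_comm Complex.I, ← div_div, Complex.div_I]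
  ring

theorem norm_div_add_one_mul_pow_le (b : ℂ) (n : ℕ) {w : ℂ} {ρ : ℝ} (hw : ‖w‖ ≤ ρ) :
    ‖b / ((n : ℂ) + 1) * w ^ (n + 1)‖ ≤ ‖b‖ * ρ ^ (n + 1) := by
  rw [norm_mul, norm_div, norm_pow]
  have hn : 1 ≤ ‖(n : ℂ) + 1‖ := by
    rw [← Nat.cast_add_one, Complex.norm_natCast, Nat.cast_add_one]
    exact le_add_of_nonneg_left n.cast_nonneg
  exact mul_le_mul (div_le_self (norm_nonneg _) hn) (pow_le_pow_left₀ (norm_nonneg _) hw _)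
    (by positivity) (norm_nonneg _)

theorem mul_deriv_div_add_one_mul_pow (b : ℂ) (n : ℕ) (z : ℂ) :
    z * deriv (fun w => b / ((n : ℂ) + 1) * w ^ (n + 1)) z = b * z ^ (n + 1) := by
  have hn : (n : ℂ) + 1 ≠ 0 := Nat.cast_add_one_ne_zero n
  rw [((hasDerivAt_pow (n + 1) z).const_mul _).deriv]
  push_cast
  field_simp
  ring

variable {ε₀ : ℝ} {a : ℂ → ℂ} {c : ℕ → ℂ}

theorem primitive_differentiableAt_and_mul_deriv
    (ha : ∀ z ∈ ball (0 : ℂ) ε₀, HasSum (fun n : ℕ => c (n + 1) * z ^ (n + 1)) (a z))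
    {z : ℂ} (hz : z ∈ ball 0 ε₀) :
    DifferentiableAt ℂ (primitive c) z ∧ z * deriv (primitive c) z = a z := by
  obtain ⟨ρ, hzρ, hρ⟩ := exists_between (mem_ball_zero_iff.1 hz)
  have hρ0 : 0 < ρ := (norm_nonneg z).trans_lt hzρ
  have hsum : Summable fun n : ℕ => ‖c (n + 1)‖ * ρ ^ (n + 1) := by
    have hmem : (ρ : ℂ) ∈ ball (0 : ℂ) ε₀ := by simpa [abs_of_pos hρ0] using hρ
    simpa [abs_of_pos hρ0] using (ha ρ hmem).summable.norm
  have hdiff : ∀ n : ℕ, DifferentiableOn ℂ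
      (fun w : ℂ => c (n + 1) / ((n : ℂ) + 1) * w ^ (n + 1)) (ball 0 ρ) := fun n => by fun_prop
  have hle := fun (n : ℕ) (w : ℂ) (hw : w ∈ ball (0 : ℂ) ρ) =>
    norm_div_add_one_mul_pow_le (c (n + 1)) n (mem_ball_zero_iff.1 hw).le
  have hmem : z ∈ ball (0 : ℂ) ρ := mem_ball_zero_iff.2 hzρ
  refine ⟨(Complex.differentiableOn_tsum_of_summable_norm hsum hdiff isOpen_ball
    hle).differentiableAt (isOpen_ball.mem_nhds hmem), ?_⟩
  have hderiv := (Complex.hasSum_deriv_of_summable_norm hsum hdiff isOpen_ball hle hmem).mul_left z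
  simp only [mul_deriv_div_add_one_mul_pow] at hderiv
  exact hderiv.unique (ha z hz)

end Primitive

section Linearization

/-- The coordinate `(1 - e^{-αw}) / α` on the first factor, which linearizes `L^α(w) ∂/∂w`. -/
noncomputable def zeta (α : ℝ) (w : ℂ) : ℂ :=
  if α = 0 then w else (1 - Complex.exp (-(α : ℂ) * w)) / α

/-- The local inverse `-log (1 - αu) / α` of `zeta α`. -/
noncomputable def zetaInv (α : ℝ) (u : ℂ) : ℂ :=
  if α = 0 then u else -(1 / (α : ℂ)) * Complex.log (1 - α * u)

variable {α : ℝ} {u : ℂ}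

theorem differentiable_zeta (α : ℝ) : Differentiable ℂ (zeta α) := by
  unfold zeta
  split_ifs <;> fun_prop

theorem zeta_zero (α : ℝ) : zeta α 0 = 0 := by simp [zeta]

theorem zetaInv_zero (α : ℝ) : zetaInv α 0 = 0 := by simp [zetaInv]

theorem one_sub_mem_slitPlane (hu : ‖u‖ < 1) : 1 - u ∈ Complex.slitPlane := by
  simpa [sub_eq_add_neg] using Complex.mem_slitPlane_of_norm_lt_one (z := -u) (by simpa using hu)

theorem zeta_mul_exp (α : ℝ) (w : ℂ) : zeta α w * Complex.exp (α * w) = L α w := by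
  unfold zeta L
  split_ifs with hα
  · simp [hα]
  · rw [div_mul_eq_mul_div, sub_mul, ← Complex.exp_add]
    simp [div_eq_inv_mul]

theorem exp_mul_zetaInv (hu : ‖α * u‖ < 1) : Complex.exp (α * zetaInv α u) = (1 - α * u)⁻¹ := by
  rcases eq_or_ne α 0 with rfl | hα
  · simp
  · have hα' : (α : ℂ) ≠ 0 := Complex.ofReal_ne_zero.2 hα
    have hlog : α * zetaInv α u = -Complex.log (1 - α * u) := by
      rw [zetaInv, if_neg hα]
      field_simp
    rw [hlog, Complex.exp_neg,
      Complex.exp_log (Complex.slitPlane_ne_zero (one_sub_mem_slitPlane hu))]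

theorem zeta_zetaInv (hu : ‖α * u‖ < 1) : zeta α (zetaInv α u) = u := by
  rcases eq_or_ne α 0 with rfl | hα
  · simp [zeta, zetaInv]
  · have hα' : (α : ℂ) ≠ 0 := Complex.ofReal_ne_zero.2 hα
    rw [zeta, if_neg hα, neg_mul, Complex.exp_neg, exp_mul_zetaInv hu, inv_inv]
    field_simp
    ring

theorem zetaInv_zeta {w : ℂ} (hw : |α * w.im| < Real.pi) : zetaInv α (zeta α w) = w := by
  unfold zeta zetaInv
  split_ifs with hα
  · rfl
  · have hα' : (α : ℂ) ≠ 0 := Complex.ofReal_ne_zero.2 hα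
    have him : (-(α : ℂ) * w).im = -(α * w.im) := by simp
    rw [mul_div_cancel₀ _ hα', sub_sub_cancel, Complex.log_exp]
    · field_simp
    · linarith [(abs_lt.1 hw).2]
    · linarith [(abs_lt.1 hw).1]

theorem abs_mul_im_zetaInv_lt (hu : ‖α * u‖ < 1) : |α * (zetaInv α u).im| < Real.pi := by
  rcases eq_or_ne α 0 with rfl | hα
  · simp [Real.pi_pos]
  · have hα' : (α : ℂ) ≠ 0 := Complex.ofReal_ne_zero.2 hα
    have harg : α * (zetaInv α u).im = -(1 - α * u).arg := by
      rw [zetaInv, if_neg hα, ← Complex.im_ofReal_mul, ← Complex.log_im, ← Complex.neg_im]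
      congr 1
      field_simp
    rw [harg, abs_neg]
    exact abs_lt.2 ⟨Complex.neg_pi_lt_arg _, (Complex.arg_le_pi _).lt_of_ne
      (Complex.mem_slitPlane_iff_arg.1 (one_sub_mem_slitPlane hu)).1⟩

theorem hasDerivAt_zetaInv (hu : ‖α * u‖ < 1) :
    HasDerivAt (zetaInv α) (Complex.exp (α * zetaInv α u)) u := by
  rw [exp_mul_zetaInv hu]
  unfold zetaInv
  split_ifs with hα
  · simpa [hα] using hasDerivAt_id' u
  · have hα' : (α : ℂ) ≠ 0 := Complex.ofReal_ne_zero.2 hα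
    refine (((hasDerivAt_const_mul (α : ℂ)).const_sub 1).clog
      (one_sub_mem_slitPlane hu) |>.const_mul _).congr_deriv ?_
    field_simp

theorem φ_fst (a : ℂ → ℂ) (α t : ℝ) (z : ℂ × ℂ) :
    (φ a α t z).1 = zetaInv α (zeta α z.1 * flowFactor a t z.2) := by
  unfold φ zeta zetaInv
  split_ifs with hα
  · rfl
  · have hα' : (α : ℂ) ≠ 0 := Complex.ofReal_ne_zero.2 hα
    have harg (E f : ℂ) : 1 - α * ((1 - E) / α * f) = 1 + (E - 1) * f := by
      field_simp
      ring
    rw [harg]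

end Linearization

section Chart

variable {a A : ℂ → ℂ} {α ε δ : ℝ}

/-- The change of coordinates `(z₁, z₂) ↦ (ζ(z₁) e^{iA(z₂)}, z₂)`, which takes the hypersurface to
its model and the flow `φ` to the rotations of the second coordinate. -/
noncomputable def toModel (A : ℂ → ℂ) (α : ℝ) (z : ℂ × ℂ) : ℂ × ℂ :=
  (zeta α z.1 * Complex.exp (Complex.I * A z.2), z.2)

/-- The local inverse of `toModel A α`. -/
noncomputable def ofModel (A : ℂ → ℂ) (α : ℝ) (p : ℂ × ℂ) : ℂ × ℂ :=
  (zetaInv α (p.1 * Complex.exp (-(Complex.I * A p.2))), p.2)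

/-- The rotation `(w, z) ↦ (w, z e^{it})`. -/
noncomputable def rotate (t : ℝ) (p : ℂ × ℂ) : ℂ × ℂ :=
  (p.1, p.2 * Complex.exp (Complex.I * t))

/-- A primitive `A` of `a(z) / z`, together with radii `δ` and `ε` of a bidisc in the model
coordinates on which `ofModel A α` is holomorphic. -/
structure ModelChart (a A : ℂ → ℂ) (α ε δ : ℝ) : Prop where
  base_pos : 0 < ε
  fiber_pos : 0 < δ
  differentiableOn : DifferentiableOn ℂ A (ball 0 ε)
  mul_deriv : ∀ z ∈ ball (0 : ℂ) ε, z * deriv A z = a z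
  norm_lt_one : ∀ w ∈ ball (0 : ℂ) δ, ∀ z ∈ ball (0 : ℂ) ε,
    ‖α * (w * Complex.exp (-(Complex.I * A z)))‖ < 1

/-- The preimage of the bidisc of a `ModelChart`; it is invariant under the flow `φ`. -/
def domain (A : ℂ → ℂ) (α ε δ : ℝ) : Set (ℂ × ℂ) :=
  {z | (z.2 ∈ ball 0 ε ∧ |α * z.1.im| < Real.pi) ∧ (toModel A α z).1 ∈ ball 0 δ}

theorem toModel_zero (A : ℂ → ℂ) (α : ℝ) : toModel A α 0 = 0 := by
  simp [toModel, zeta_zero]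

theorem ofModel_zero (A : ℂ → ℂ) (α : ℝ) : ofModel A α 0 = 0 := by
  simp [ofModel, zetaInv_zero]

theorem ofModel_toModel {z : ℂ × ℂ} (hz : |α * z.1.im| < Real.pi) :
    ofModel A α (toModel A α z) = z := by
  refine Prod.ext ?_ rfl
  simp only [toModel, ofModel]
  rw [mul_assoc, ← Complex.exp_add, add_neg_cancel, Complex.exp_zero, mul_one, zetaInv_zeta hz]

theorem mul_exp_I_mul_mem_ball {z : ℂ} (hz : z ∈ ball 0 ε) (t : ℝ) :
    z * Complex.exp (Complex.I * t) ∈ ball 0 ε := by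
  rwa [mem_ball_zero_iff, norm_mul, mul_comm Complex.I, Complex.norm_exp_ofReal_mul_I, mul_one,
    ← mem_ball_zero_iff]

theorem rotate_rotate (s t : ℝ) (p : ℂ × ℂ) : rotate s (rotate t p) = rotate (s + t) p := by
  simp only [rotate, mul_assoc, ← Complex.exp_add]
  push_cast
  ring_nf

theorem hasDerivAt_mul_exp_I_mul (z : ℂ) (t : ℝ) :
    HasDerivAt (fun τ : ℝ => z * Complex.exp (Complex.I * τ))
      (Complex.I * (z * Complex.exp (Complex.I * t))) t := by
  refine ((Complex.ofRealCLM.hasDerivAt (x := t)).const_mul Complex.I).cexp.const_mul z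
    |>.congr_deriv ?_
  simp only [Complex.ofRealCLM_apply, Complex.ofReal_one]
  ring

theorem exists_modelChart {ε₀ : ℝ} (hε₀ : 0 < ε₀) {c : ℕ → ℂ}
    (ha : ∀ z ∈ ball (0 : ℂ) ε₀, HasSum (fun n : ℕ => c (n + 1) * z ^ (n + 1)) (a z)) (α : ℝ) :
    ∃ ε δ, ModelChart a (primitive c) α ε δ := by
  have hA := fun z hz => primitive_differentiableAt_and_mul_deriv ha (z := z) hz
  have hcont : ContinuousAt (fun p : ℂ × ℂ =>
      ‖α * (p.1 * Complex.exp (-(Complex.I * primitive c p.2)))‖) 0 := by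
    have := (hA 0 (mem_ball_self hε₀)).1.continuousAt.comp_of_eq
      (continuousAt_snd (p := (0 : ℂ × ℂ))) rfl
    simp only [Function.comp_def] at this
    fun_prop
  obtain ⟨r, hr, hball⟩ := Metric.eventually_nhds_iff_ball.1
    (hcont.eventually_lt continuousAt_const (g := fun _ => (1 : ℝ)) (by simp))
  have hmem : ∀ z ∈ ball (0 : ℂ) (min ε₀ r), z ∈ ball 0 ε₀ := fun z hz =>
    ball_subset_ball (min_le_left _ _) hz
  exact ⟨min ε₀ r, r,
    { base_pos := lt_min hε₀ hr
      fiber_pos := hr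
      differentiableOn := fun z hz => (hA z (hmem z hz)).1.differentiableWithinAt
      mul_deriv := fun z hz => (hA z (hmem z hz)).2
      norm_lt_one := fun w hw z hz =>
        hball (w, z) (mem_ball_zero_prod.2 ⟨hw, ball_subset_ball (min_le_right _ _) hz⟩) }⟩

namespace ModelChart

variable (C : ModelChart a A α ε δ)
include C

theorem differentiableAt {z : ℂ} (hz : z ∈ ball 0 ε) : DifferentiableAt ℂ A z :=
  C.differentiableOn.differentiableAt (isOpen_ball.mem_nhds hz)

theorem differentiableAt_toModel {z : ℂ × ℂ} (hz : z.2 ∈ ball 0 ε) :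
    DifferentiableAt ℂ (toModel A α) z := by
  have hA : DifferentiableAt ℂ (fun z : ℂ × ℂ => A z.2) z :=
    (C.differentiableAt hz).comp z differentiableAt_snd
  have hζ : DifferentiableAt ℂ (fun z : ℂ × ℂ => zeta α z.1) z :=
    (differentiable_zeta α).differentiableAt.comp z differentiableAt_fst
  exact (hζ.mul (hA.const_mul Complex.I).cexp).prodMk differentiableAt_snd

theorem differentiableAt_ofModel {p : ℂ × ℂ} (h₁ : p.1 ∈ ball 0 δ) (h₂ : p.2 ∈ ball 0 ε) :
    DifferentiableAt ℂ (ofModel A α) p := by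
  have hA : DifferentiableAt ℂ (fun p : ℂ × ℂ => A p.2) p :=
    (C.differentiableAt h₂).comp p differentiableAt_snd
  have hu : DifferentiableAt ℂ (fun p : ℂ × ℂ => p.1 * Complex.exp (-(Complex.I * A p.2))) p :=
    differentiableAt_fst.mul (hA.const_mul Complex.I).neg.cexp
  exact ((hasDerivAt_zetaInv (C.norm_lt_one _ h₁ _ h₂)).differentiableAt.comp p hu).prodMk
    differentiableAt_snd

theorem toModel_ofModel {p : ℂ × ℂ} (h₁ : p.1 ∈ ball 0 δ) (h₂ : p.2 ∈ ball 0 ε) :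
    toModel A α (ofModel A α p) = p := by
  refine Prod.ext ?_ rfl
  simp only [toModel, ofModel]
  rw [zeta_zetaInv (C.norm_lt_one _ h₁ _ h₂), mul_assoc, ← Complex.exp_add, neg_add_cancel,
    Complex.exp_zero, mul_one]

theorem ofModel_mem_domain {p : ℂ × ℂ} (h₁ : p.1 ∈ ball 0 δ) (h₂ : p.2 ∈ ball 0 ε) :
    ofModel A α p ∈ domain A α ε δ :=
  ⟨⟨h₂, abs_mul_im_zetaInv_lt (C.norm_lt_one _ h₁ _ h₂)⟩, by rwa [C.toModel_ofModel h₁ h₂]⟩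

theorem zero_mem_domain : (0 : ℂ × ℂ) ∈ domain A α ε δ :=
  ⟨⟨mem_ball_self C.base_pos, by simpa using Real.pi_pos⟩, by
    rw [toModel_zero]
    exact mem_ball_self C.fiber_pos⟩

theorem isOpen_domain : IsOpen (domain A α ε δ) := by
  have hopen : IsOpen {z : ℂ × ℂ | z.2 ∈ ball 0 ε ∧ |α * z.1.im| < Real.pi} :=
    (isOpen_ball.preimage continuous_snd).inter
      (isOpen_lt (f := fun z : ℂ × ℂ => |α * z.1.im|) (by fun_prop) continuous_const)
  refine ContinuousOn.isOpen_inter_preimage (f := fun z => (toModel A α z).1) (fun z hz => ?_)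
    hopen isOpen_ball
  exact (C.differentiableAt_toModel hz.1).continuousAt.fst.continuousWithinAt

theorem hasDerivAt_comp_mul_exp {z : ℂ} (hz : z ∈ ball 0 ε) (t : ℝ) :
    HasDerivAt (fun τ : ℝ => -(Complex.I * A (z * Complex.exp (Complex.I * τ))))
      (a (z * Complex.exp (Complex.I * t))) t := by
  have hmem := mul_exp_I_mul_mem_ball hz t
  refine ((C.differentiableAt hmem).hasDerivAt.comp_of_eq t (hasDerivAt_mul_exp_I_mul z t)
    rfl |>.const_mul Complex.I).neg.congr_deriv ?_
  rw [← C.mul_deriv _ hmem]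
  linear_combination (-(z * Complex.exp (Complex.I * t)
    * deriv A (z * Complex.exp (Complex.I * t)))) * Complex.I_mul_I

theorem continuousOn_ball : ContinuousOn a (ball 0 ε) :=
  (continuousOn_id.mul (C.differentiableOn.deriv isOpen_ball).continuousOn).congr fun z hz =>
    (C.mul_deriv z hz).symm

theorem flowFactor_eq {z : ℂ} (hz : z ∈ ball 0 ε) (t : ℝ) :
    flowFactor a t z
      = Complex.exp (Complex.I * A z) *
        Complex.exp (-(Complex.I * A (z * Complex.exp (Complex.I * t)))) := by
  have hcont : Continuous fun τ : ℝ => a (z * Complex.exp (Complex.I * τ)) :=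
    C.continuousOn_ball.comp_continuous (by fun_prop) fun τ => mul_exp_I_mul_mem_ball hz τ
  rw [flowFactor, intervalIntegral.integral_eq_sub_of_hasDerivAt
    (fun τ _ => C.hasDerivAt_comp_mul_exp hz τ) (hcont.intervalIntegrable _ _), ← Complex.exp_add]
  simp only [Complex.ofReal_zero, mul_zero, Complex.exp_zero, mul_one]
  ring_nf

theorem hasDerivAt_flowFactor {z : ℂ} (hz : z ∈ ball 0 ε) (t : ℝ) :
    HasDerivAt (fun τ : ℝ => flowFactor a τ z)
      (flowFactor a t z * a (z * Complex.exp (Complex.I * t))) t := by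
  simp only [C.flowFactor_eq hz, mul_assoc]
  exact (C.hasDerivAt_comp_mul_exp hz t).cexp.const_mul _

theorem zeta_mul_flowFactor {z : ℂ × ℂ} (hz : z.2 ∈ ball 0 ε) (t : ℝ) :
    zeta α z.1 * flowFactor a t z.2 = (toModel A α z).1 *
      Complex.exp (-(Complex.I * A (z.2 * Complex.exp (Complex.I * t)))) := by
  rw [C.flowFactor_eq hz, toModel, mul_assoc]

theorem φ_eq {z : ℂ × ℂ} (hz : z.2 ∈ ball 0 ε) (t : ℝ) :
    φ a α t z = ofModel A α (rotate t (toModel A α z)) :=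
  Prod.ext (by rw [φ_fst, C.zeta_mul_flowFactor hz]; rfl) rfl

theorem φ_mem_domain {z : ℂ × ℂ} (hz : z ∈ domain A α ε δ) (t : ℝ) :
    φ a α t z ∈ domain A α ε δ := by
  rw [C.φ_eq hz.1.1]
  exact C.ofModel_mem_domain hz.2 (mul_exp_I_mul_mem_ball hz.1.1 t)

theorem toModel_φ {z : ℂ × ℂ} (hz : z ∈ domain A α ε δ) (t : ℝ) :
    toModel A α (φ a α t z) = rotate t (toModel A α z) := by
  rw [C.φ_eq hz.1.1]
  exact C.toModel_ofModel hz.2 (mul_exp_I_mul_mem_ball hz.1.1 t)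

theorem φ_add {z : ℂ × ℂ} (hz : z ∈ domain A α ε δ) (s t : ℝ) :
    φ a α s (φ a α t z) = φ a α (s + t) z := by
  rw [C.φ_eq (C.φ_mem_domain hz t).1.1, C.toModel_φ hz, C.φ_eq hz.1.1, rotate_rotate]

theorem φ_zero {z : ℂ × ℂ} (hz : z ∈ domain A α ε δ) : φ a α 0 z = z := by
  have hrot : rotate 0 (toModel A α z) = toModel A α z := by simp [rotate]
  rw [C.φ_eq hz.1.1, hrot, ofModel_toModel hz.1.2]

theorem differentiableOn_φ (t : ℝ) : DifferentiableOn ℂ (φ a α t) (domain A α ε δ) := by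
  refine DifferentiableOn.congr (fun z hz => ?_) fun z hz => C.φ_eq hz.1.1 t
  have hrot : Differentiable ℂ (rotate t) := by unfold rotate; fun_prop
  refine DifferentiableAt.differentiableWithinAt (DifferentiableAt.fun_comp' z ?_
    (hrot.differentiableAt.fun_comp' z (C.differentiableAt_toModel hz.1.1)))
  exact C.differentiableAt_ofModel hz.2 (mul_exp_I_mul_mem_ball hz.1.1 t)

theorem hasDerivAt_φ {z : ℂ × ℂ} (hz : z ∈ domain A α ε δ) (t : ℝ) :
    HasDerivAt (fun τ : ℝ => φ a α τ z) (H a α (φ a α t z)) t := by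
  refine HasDerivAt.prodMk ?_ (hasDerivAt_mul_exp_I_mul z.2 t)
  have hnorm : ‖α * (zeta α z.1 * flowFactor a t z.2)‖ < 1 := by
    rw [C.zeta_mul_flowFactor hz.1.1]
    exact C.norm_lt_one _ hz.2 _ (mul_exp_I_mul_mem_ball hz.1.1 t)
  have hfst : (fun τ => (φ a α τ z).1) = fun τ => zetaInv α (zeta α z.1 * flowFactor a τ z.2) :=
    funext fun τ => φ_fst a α τ z
  refine HasDerivAt.congr_of_eventuallyEq ?_ (Eventually.of_forall (congrFun hfst))
  refine ((hasDerivAt_zetaInv hnorm).comp_of_eq t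
    ((C.hasDerivAt_flowFactor hz.1.1 t).const_mul (zeta α z.1)) rfl).congr_deriv ?_
  rw [← zeta_mul_exp, φ_fst, zeta_zetaInv hnorm]
  simp only [φ]
  ring

end ModelChart

end Chart

section Hypersurface

variable {ε₀ α : ℝ} {c : ℕ → ℂ} {p q : ℝ → ℝ} {z : ℂ × ℂ}

theorem P₁_eq {z : ℂ} (hR : 0 < Real.cos (R c q z)) :
    P₁ c p q z = radial p ‖z‖ * Real.exp (primitive c z).im / Real.cos (R c q z) := by
  rw [radial_norm, P₁, expRadial]
  split_ifs with hz
  · simp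
  · rw [tsum_div_I_mul, abs_of_pos hR, Real.exp_sub, Real.exp_add, Real.exp_log hR]
    simp

theorem re_zeta_mul_exp (θ : ℝ) (w : ℂ) :
    (zeta α w * Complex.exp ((-θ : ℝ) * Complex.I)).re =
      if α = 0 then w.re * Real.cos θ + w.im * Real.sin θ
      else (Real.cos θ - Real.exp (-α * w.re) * Real.cos (θ + α * w.im)) / α := by
  unfold zeta
  split_ifs with hα
  · rw [Complex.mul_re, Complex.exp_ofReal_mul_I_re, Complex.exp_ofReal_mul_I_im, Real.cos_neg,
      Real.sin_neg]
    ring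
  · have hcos : (Complex.exp (-(α : ℂ) * w + (-θ : ℝ) * Complex.I)).re =
        Real.exp (-α * w.re) * Real.cos (θ + α * w.im) := by
      rw [Complex.exp_re, ← Real.cos_neg]
      simp
    rw [div_mul_eq_mul_div, sub_mul, one_mul, ← Complex.exp_add, Complex.div_ofReal_re,
      Complex.sub_re, hcos, Complex.exp_ofReal_mul_I_re, Real.cos_neg]

theorem toModel_fst_mul_exp (z : ℂ × ℂ) :
    (toModel (primitive c) α z).1 * Complex.exp ((-q ‖(toModel (primitive c) α z).2‖ : ℝ) *
      Complex.I) =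
      (Real.exp (-(primitive c z.2).im) : ℝ) *
        (zeta α z.1 * Complex.exp ((-R c q z.2 : ℝ) * Complex.I)) := by
  have hR : R c q z.2 = q ‖z.2‖ - (primitive c z.2).re := rfl
  simp only [toModel]
  rw [mul_assoc, ← Complex.exp_add, Complex.ofReal_exp, mul_left_comm, ← Complex.exp_add, hR]
  congr 2
  conv_lhs => rw [← Complex.re_add_im (primitive c z.2)]
  push_cast
  linear_combination ((primitive c z.2).im : ℂ) * Complex.I_mul_I

theorem toModel_mem_model_iff (hR : 0 < Real.cos (R c q z.2)) :
    toModel (primitive c) α z ∈ Model (radial p) q ↔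
      (zeta α z.1 * Complex.exp ((-R c q z.2 : ℝ) * Complex.I)).re
        + P₁ c p q z.2 * Real.cos (R c q z.2) = 0 := by
  set E := Real.exp (-(primitive c z.2).im) with hE
  have hG : radial p ‖z.2‖ = E * (P₁ c p q z.2 * Real.cos (R c q z.2)) := by
    rw [P₁_eq hR, div_mul_cancel₀ _ hR.ne', mul_left_comm, hE, ← Real.exp_add, neg_add_cancel,
      Real.exp_zero, mul_one]
  simp only [Model, mem_ofPred_eq, toModel_fst_mul_exp, Complex.re_ofReal_mul]
  rw [show (toModel (primitive c) α z).2 = z.2 from rfl, hG, ← mul_add,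
    mul_eq_zero_iff_left (Real.exp_pos _).ne']

theorem log_equation_iff {x C C' Q : ℝ} (hα : α ≠ 0) (hC : 0 < C) (hC' : 0 < C')
    (hQ : 0 < 1 + α * Q) :
    x + 1 / α * Real.log (1 + α * Q) + -(1 / α) * Real.log |C' / C| = 0
      ↔ (C - Real.exp (-α * x) * C') / α + Q * C = 0 := by
  have hlog : x + 1 / α * Real.log (1 + α * Q) + -(1 / α) * Real.log |C' / C| = 0
      ↔ Real.log ((1 + α * Q) * C) = Real.log (Real.exp (-α * x) * C') := by
    rw [abs_of_pos (div_pos hC' hC), Real.log_div hC'.ne' hC.ne', Real.log_mul hQ.ne' hC.ne',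
      Real.log_mul (Real.exp_pos _).ne' hC'.ne', Real.log_exp]
    field_simp
    constructor <;> intro h <;> linarith
  rw [hlog, Real.log_injOn_pos.eq_iff (mul_pos hQ hC) (mul_pos (Real.exp_pos _) hC')]
  field_simp
  constructor <;> intro h <;> linarith

theorem mem_M_iff (hz : ‖z.2‖ < ε₀) (hR : 0 < Real.cos (R c q z.2))
    (hRα : 0 < Real.cos (R c q z.2 + α * z.1.im)) (hP : 0 < 1 + α * P₁ c p q z.2) :
    z ∈ M ε₀ c α p q ↔ toModel (primitive c) α z ∈ Model (radial p) q := by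
  rw [toModel_mem_model_iff hR, re_zeta_mul_exp]
  simp only [M, P, F, mem_ofPred_eq, hz, true_and]
  split_ifs with hα
  · rw [Real.tan_eq_sin_div_cos, ← mul_eq_zero_iff_left hR.ne']
    field_simp
    ring_nf
  · exact log_equation_iff hα hR hRα hP

theorem eventually_mem_M_iff (hε₀ : 0 < ε₀) (α : ℝ) (H : Profile (radial p) q)
    (hA : ContinuousAt (primitive c) 0) :
    ∀ᶠ z in 𝓝 0, z ∈ M ε₀ c α p q ↔ toModel (primitive c) α z ∈ Model (radial p) q := by
  have hR : ContinuousAt (R c q) 0 :=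
    H.eventually_continuousAt_q_norm.self_of_nhds.sub (Complex.continuous_re.continuousAt.comp hA)
  have hR0 : R c q 0 = 0 := by simp [R, H.q_zero]
  have hcos : ContinuousAt (fun z => Real.cos (R c q z)) 0 :=
    Real.continuous_cos.continuousAt.comp hR
  have hP : ContinuousAt (fun z => 1 + α *
      (radial p ‖z‖ * Real.exp (primitive c z).im / Real.cos (R c q z))) 0 := by
    have hG := H.eventually_continuousAt_G_norm.self_of_nhds
    have hexp : ContinuousAt (fun z => Real.exp (primitive c z).im) 0 :=
      Real.continuous_exp.continuousAt.comp (Complex.continuous_im.continuousAt.comp hA)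
    exact ((((hG.mul hexp).div hcos (by simp [hR0])).const_mul α).const_add 1)
  have hRα : ContinuousAt (fun z : ℂ × ℂ => Real.cos (R c q z.2 + α * z.1.im)) 0 := by
    have hR' : ContinuousAt (fun z : ℂ × ℂ => R c q z.2) 0 :=
      hR.comp_of_eq continuousAt_snd rfl
    fun_prop
  have hpos := continuousAt_const.eventually_lt hcos (f := fun _ => (0 : ℝ)) (by simp [hR0])
  filter_upwards [eventually_snd (ball_mem_nhds 0 hε₀), eventually_snd hpos,
    eventually_snd (continuousAt_const.eventually_lt hP (f := fun _ => (0 : ℝ))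
      (by simp [H.G_zero])),
    continuousAt_const.eventually_lt hRα (f := fun _ => (0 : ℝ)) (by simp [hR0])]
    with z hz hR hP hRα
  exact mem_M_iff (mem_ball_zero_iff.1 hz) hR hRα (by rwa [P₁_eq hR])

end Hypersurface

section Automorphisms

variable {a A : ℂ → ℂ} {α ε δ : ℝ} {f g : ℂ × ℂ → ℂ × ℂ} {S N : Set (ℂ × ℂ)} {G q : ℝ → ℝ}

/-- The map `f` read in the model coordinates. -/
noncomputable def modelConj (A : ℂ → ℂ) (α : ℝ) (f : ℂ × ℂ → ℂ × ℂ) (p : ℂ × ℂ) : ℂ × ℂ :=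
  toModel A α (f (ofModel A α p))

theorem modelConj_zero (hf₀ : f 0 = 0) : modelConj A α f 0 = 0 := by
  rw [modelConj, ofModel_zero, hf₀, toModel_zero]

theorem mul_eq_rotate_arg {b : ℂ} (hb : ‖b‖ = 1) (p : ℂ × ℂ) : (p.1, b * p.2) = rotate b.arg p := by
  rw [rotate, mul_comm Complex.I, ← one_mul (Complex.exp _), ← Complex.ofReal_one, ← hb,
    Complex.norm_mul_exp_arg_mul_I, mul_comm]

theorem fderiv_fst_ne_zero_of_rightInverse {𝕜 E F F' : Type*} [NontriviallyNormedField 𝕜]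
    [NormedAddCommGroup E] [NormedSpace 𝕜 E] [NormedAddCommGroup F] [NormedSpace 𝕜 F]
    [NormedAddCommGroup F'] [NormedSpace 𝕜 F'] [Nontrivial F] {f : E → F × F'} {g : F × F' → E}
    {x : F × F'} (hf : DifferentiableAt 𝕜 f (g x)) (hg : DifferentiableAt 𝕜 g x)
    (hfg : ∀ᶠ p in 𝓝 x, f (g p) = p) : fderiv 𝕜 (fun y => (f y).1) (g x) ≠ 0 := by
  intro h0
  obtain ⟨v, hv⟩ := exists_ne (0 : F)
  have hcomp : HasFDerivAt (fun p => (f (g p)).1) (0 : F × F' →L[𝕜] F) x := by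
    have h := hf.fst.hasFDerivAt.comp x hg.hasFDerivAt
    rwa [h0, ContinuousLinearMap.zero_comp] at h
  have hfst : HasFDerivAt (fun p => (f (g p)).1) (ContinuousLinearMap.fst 𝕜 F F') x :=
    hasFDerivAt_fst.congr_of_eventuallyEq (hfg.mono fun p hp => congrArg Prod.fst hp)
  exact hv (DFunLike.congr_fun (hfst.unique hcomp) (v, 0))

namespace ModelChart

variable (C : ModelChart a A α ε δ)
include C

theorem eventually_mem_domain : ∀ᶠ z in 𝓝 0, z ∈ domain A α ε δ :=
  C.isOpen_domain.mem_nhds C.zero_mem_domain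

theorem eventually_mem_bidisc :
    ∀ᶠ p in 𝓝 (0 : ℂ × ℂ), p.1 ∈ ball 0 δ ∧ p.2 ∈ ball 0 ε :=
  prod_mem_nhds (ball_mem_nhds _ C.fiber_pos) (ball_mem_nhds _ C.base_pos)

theorem tendsto_toModel : Tendsto (toModel A α) (𝓝 0) (𝓝 0) := by
  have hcont := (C.differentiableAt_toModel (z := 0) (mem_ball_self C.base_pos)).continuousAt
  rwa [ContinuousAt, toModel_zero] at hcont

theorem tendsto_ofModel : Tendsto (ofModel A α) (𝓝 0) (𝓝 0) := by
  have hcont := (C.differentiableAt_ofModel (p := 0) (mem_ball_self C.fiber_pos)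
    (mem_ball_self C.base_pos)).continuousAt
  rwa [ContinuousAt, ofModel_zero] at hcont

theorem eventually_differentiableAt_modelConj (hf : ∀ᶠ z in 𝓝 0, DifferentiableAt ℂ f z)
    (hlim : Tendsto f (𝓝 0) (𝓝 0)) : ∀ᶠ p in 𝓝 0, DifferentiableAt ℂ (modelConj A α f) p := by
  filter_upwards [C.eventually_mem_bidisc, C.tendsto_ofModel.eventually hf,
    (hlim.comp C.tendsto_ofModel).eventually C.eventually_mem_bidisc] with p hp hfp hp'
  exact (C.differentiableAt_toModel hp'.2).fun_comp' p
    (hfp.fun_comp' p (C.differentiableAt_ofModel hp.1 hp.2))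

theorem eventually_modelConj_modelConj (hlim : Tendsto f (𝓝 0) (𝓝 0))
    (hgf : ∀ᶠ z in 𝓝 0, g (f z) = z) :
    ∀ᶠ p in 𝓝 0, modelConj A α g (modelConj A α f p) = p := by
  filter_upwards [C.eventually_mem_bidisc, C.tendsto_ofModel.eventually hgf,
    (hlim.comp C.tendsto_ofModel).eventually C.eventually_mem_domain] with p hp hgfp hp'
  rw [modelConj, modelConj, ofModel_toModel (z := f _) hp'.1.2, hgfp, C.toModel_ofModel hp.1 hp.2]

theorem eventually_modelConj_mem (hS : ∀ᶠ z in 𝓝 0, z ∈ S ↔ toModel A α z ∈ N)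
    (hlim : Tendsto f (𝓝 0) (𝓝 0)) (hf : ∀ᶠ z in 𝓝 0, z ∈ S → f z ∈ S) :
    ∀ᶠ p in 𝓝 0, p ∈ N → modelConj A α f p ∈ N := by
  filter_upwards [C.eventually_mem_bidisc, C.tendsto_ofModel.eventually hS,
    C.tendsto_ofModel.eventually hf,
    (hlim.comp C.tendsto_ofModel).eventually hS] with p hp hSp hfp hSfp hpN
  rw [C.toModel_ofModel hp.1 hp.2] at hSp
  exact hSfp.1 (hfp (hSp.2 hpN))

theorem eventuallyEq_φ (hlim : Tendsto f (𝓝 0) (𝓝 0)) {t : ℝ}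
    (hf : ∀ᶠ p in 𝓝 0, modelConj A α f p = rotate t p) : f =ᶠ[𝓝 0] φ a α t := by
  filter_upwards [C.eventually_mem_domain, hlim.eventually C.eventually_mem_domain,
    C.tendsto_toModel.eventually hf] with z hz hfz hrot
  rw [modelConj, ofModel_toModel hz.1.2] at hrot
  rw [C.φ_eq hz.1.1, ← hrot, ofModel_toModel hfz.1.2]

theorem φ_apply_zero (t : ℝ) : φ a α t 0 = 0 := by
  rw [C.φ_eq (mem_ball_self C.base_pos), toModel_zero]
  simp [rotate, ofModel, zetaInv_zero]

theorem tendsto_φ (t : ℝ) : Tendsto (φ a α t) (𝓝 0) (𝓝 0) := by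
  have hcont := ((C.differentiableOn_φ t).differentiableAt C.eventually_mem_domain).continuousAt
  rwa [ContinuousAt, C.φ_apply_zero] at hcont

/-- The map `φ_t` as a self-homeomorphism of the flow-invariant domain. -/
noncomputable def flowHomeomorph (t : ℝ) : OpenPartialHomeomorph (ℂ × ℂ) (ℂ × ℂ) where
  toFun := φ a α t
  invFun := φ a α (-t)
  source := domain A α ε δ
  target := domain A α ε δ
  map_source' _ hz := C.φ_mem_domain hz t
  map_target' _ hz := C.φ_mem_domain hz (-t)
  left_inv' _ hz := by rw [C.φ_add hz, neg_add_cancel, C.φ_zero hz]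
  right_inv' _ hz := by rw [C.φ_add hz, add_neg_cancel, C.φ_zero hz]
  open_source := C.isOpen_domain
  open_target := C.isOpen_domain
  continuousOn_toFun := (C.differentiableOn_φ t).continuousOn
  continuousOn_invFun := (C.differentiableOn_φ (-t)).continuousOn

theorem φ_mem_Aut (hS : ∀ᶠ z in 𝓝 0, z ∈ S ↔ toModel A α z ∈ Model G q) (t : ℝ) :
    (φ a α t : Germ (𝓝 (0 : ℂ × ℂ)) (ℂ × ℂ)) ∈ Aut S 0 := by
  refine ⟨C.flowHomeomorph t, C.zero_mem_domain, C.differentiableOn_φ t, C.differentiableOn_φ (-t),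
    C.φ_apply_zero t, ?_, rfl⟩
  filter_upwards [hS, (C.tendsto_φ t).eventually hS, C.eventually_mem_domain]
    with z hSz hSφ hz hzS
  refine hSφ.2 ?_
  rw [C.toModel_φ hz]
  refine (mem_model_congr_snd ?_).2 (hSz.1 hzS)
  rw [norm_mul, mul_comm Complex.I, Complex.norm_exp_ofReal_mul_I, mul_one, toModel]

theorem exists_eq_φ_of_mem_Aut (H : Profile G q)
    (hS : ∀ᶠ z in 𝓝 0, z ∈ S ↔ toModel A α z ∈ Model G q)
    {f : Germ (𝓝 (0 : ℂ × ℂ)) (ℂ × ℂ)} (hf : f ∈ Aut S 0) :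
    ∃ t : ℝ, (φ a α t : Germ (𝓝 (0 : ℂ × ℂ)) (ℂ × ℂ)) = f := by
  obtain ⟨e, h0, hd, hd', he0, hM, rfl⟩ := hf
  have h0' : (0 : ℂ × ℂ) ∈ e.target := by simpa only [he0] using e.map_source h0
  have hs0 : e.symm 0 = 0 := by simpa only [he0] using e.left_inv h0
  have hlim : Tendsto e (𝓝 0) (𝓝 0) := by simpa only [ContinuousAt, he0] using e.continuousAt h0
  have hlim' : Tendsto e.symm (𝓝 0) (𝓝 0) := by
    simpa only [ContinuousAt, hs0] using e.continuousAt_symm h0'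
  have hD := C.eventually_differentiableAt_modelConj
    (hd.eventually_differentiableAt (e.open_source.mem_nhds h0)) hlim
  have hD' := C.eventually_differentiableAt_modelConj
    (hd'.eventually_differentiableAt (e.open_target.mem_nhds h0')) hlim'
  have hsymm0 : modelConj A α e.symm 0 = 0 := modelConj_zero hs0
  have hne := fderiv_fst_ne_zero_of_rightInverse (by rw [hsymm0]; exact hD.self_of_nhds)
    hD'.self_of_nhds (C.eventually_modelConj_modelConj hlim' (e.eventually_right_inverse h0'))
  rw [hsymm0] at hne
  obtain ⟨b, hb, hrot⟩ := H.eq_rotation (f₁ := fun p => (modelConj A α e p).1)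
    (f₂ := fun p => (modelConj A α e p).2) (hD.mono fun _ h => h.fst) (hD.mono fun _ h => h.snd)
    (by simp only [modelConj_zero he0, Prod.fst_zero])
    (by simp only [modelConj_zero he0, Prod.snd_zero]) hne (C.eventually_modelConj_mem hS hlim hM)
  refine ⟨b.arg, (Germ.coe_eq.2 (C.eventuallyEq_φ hlim (hrot.mono fun p hp => ?_))).symm⟩
  rw [← mul_eq_rotate_arg hb]
  exact Prod.ext hp.1 hp.2

end ModelChart

end Automorphisms

end InfiniteType

theorem theoremA_general
    (ε₀ : ℝ) (hε₀ : 0 < ε₀)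
    (a : ℂ → ℂ) (c : ℕ → ℂ)
    (ha : ∀ z ∈ Metric.ball (0 : ℂ) ε₀, HasSum (fun n : ℕ => c (n + 1) * z ^ (n + 1)) (a z))
    (α : ℝ)
    (p q : ℝ → ℝ)
    (hq : ContDiffOn ℝ 2 q (Set.Ico 0 ε₀))
    (hq₀ : q 0 = 0)
    (hg : ContDiffOn ℝ ∞ (InfiniteType.expRadial p) (Metric.ball (0 : ℂ) ε₀))
    (hg₀ : InfiniteType.VanishesToInfiniteOrder (InfiniteType.expRadial p)) :
    InfiniteType.Aut (InfiniteType.M ε₀ c α p q) (0 : ℂ × ℂ) =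
        Set.range (fun t : ℝ =>
          (InfiniteType.φ a α t : Filter.Germ (𝓝 (0 : ℂ × ℂ)) (ℂ × ℂ))) ∧
      ∃ U : Set (ℂ × ℂ), IsOpen U ∧ (0 : ℂ × ℂ) ∈ U ∧
        (∀ t : ℝ, DifferentiableOn ℂ (InfiniteType.φ a α t) U) ∧
        (∀ z ∈ U, InfiniteType.φ a α 0 z = z) ∧
        (∀ z ∈ U, ∀ s t : ℝ,
          InfiniteType.φ a α s (InfiniteType.φ a α t z) = InfiniteType.φ a α (s + t) z) ∧
        (∀ z ∈ U, ∀ t : ℝ,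
          HasDerivAt (fun τ : ℝ => InfiniteType.φ a α τ z)
            (InfiniteType.H a α (InfiniteType.φ a α t z)) t) := by
  obtain ⟨ε, δ, C⟩ := InfiniteType.exists_modelChart hε₀ ha α
  have hprofile := InfiniteType.profile_of_smooth hε₀ hq hq₀ hg hg₀
  have hM := InfiniteType.eventually_mem_M_iff hε₀ α hprofile
    (C.differentiableAt (Metric.mem_ball_self C.base_pos)).continuousAt
  refine ⟨Set.Subset.antisymm (fun f hf => C.exists_eq_φ_of_mem_Aut hprofile hM hf) ?_,
    InfiniteType.domain (InfiniteType.primitive c) α ε δ, C.isOpen_domain, C.zero_mem_domain,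
    C.differentiableOn_φ, fun z hz => C.φ_zero hz, fun z hz => C.φ_add hz,
    fun z hz => C.hasDerivAt_φ hz⟩
  rintro _ ⟨t, rfl⟩
  exact C.φ_mem_Aut hM t

theorem theoremA
    (ε₀ : ℝ) (hε₀ : 0 < ε₀)
    (a : ℂ → ℂ) (c : ℕ → ℂ)
    (ha : ∀ z ∈ Metric.ball (0 : ℂ) ε₀, HasSum (fun n : ℕ => c (n + 1) * z ^ (n + 1)) (a z))
    (ha₀ : ∃ z ∈ Metric.ball (0 : ℂ) ε₀, a z ≠ 0)
    (α : ℝ)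
    (p q : ℝ → ℝ)
    (hp : ContDiffOn ℝ ∞ p (Set.Ioo 0 ε₀))
    (hq : ContDiffOn ℝ ∞ q (Set.Ico 0 ε₀))
    (hq₀ : q 0 = 0)
    (hg : ContDiffOn ℝ ∞ (InfiniteType.expRadial p) (Metric.ball (0 : ℂ) ε₀))
    (hg₀ : InfiniteType.VanishesToInfiniteOrder (InfiniteType.expRadial p)) :
    InfiniteType.Aut (InfiniteType.M ε₀ c α p q) (0 : ℂ × ℂ) =
        Set.range (fun t : ℝ =>
          (InfiniteType.φ a α t : Filter.Germ (𝓝 (0 : ℂ × ℂ)) (ℂ × ℂ))) ∧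
      ∃ U : Set (ℂ × ℂ), IsOpen U ∧ (0 : ℂ × ℂ) ∈ U ∧
        (∀ t : ℝ, DifferentiableOn ℂ (InfiniteType.φ a α t) U) ∧
        (∀ z ∈ U, InfiniteType.φ a α 0 z = z) ∧
        (∀ z ∈ U, ∀ s t : ℝ,
          InfiniteType.φ a α s (InfiniteType.φ a α t z) = InfiniteType.φ a α (s + t) z) ∧
        (∀ z ∈ U, ∀ t : ℝ,
          HasDerivAt (fun τ : ℝ => InfiniteType.φ a α τ z)
            (InfiniteType.H a α (InfiniteType.φ a α t z)) t) :=
  theoremA_general ε₀ hε₀ a c ha α p q (contDiffOn_infty.1 hq 2) hq₀ hg hg₀
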